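/- **Setting.** Let $X$ be a smooth manifold (finite-dimensional, Hausdorff, $\sigma$-compact, without boundary) and let $E\to X$ be a smooth complex vector bundle of finite rank, with space of sections $\mathcal E$. Functions and differential forms are complex-valued. Let $\mathcal J$ be the algebra of smooth sections of the bundle of infinite jets of functions on $X$, and $\mathcal J(E)$ the $\mathcal J$-module of smooth sections of the bundle $J(E)$ of infinite jets of sections of $E$. Concretely, elements of $\mathcal J$ and $\mathcal J(E)$ are given by smooth families $f(x,y)\in\mathbb C$ and $s(x,y)\in E_y$ on $X\times X$ (standing for the jets at $x$ of $f(x,\cdot)$ and $s(x,\cdot)$), modulo families that vanish to infinite order along the diagonal. Functions on $X$ act on $\mathcal J(E)$ through $f(x)$. Let $j:\mathcal E\to\mathcal J(E)$ be the infinite jet prolongation $s\mapsto s(y)$, and $q:\mathcal J(E)\to\mathcal E$ the restriction to the diagonal (the projection $J(E)\to J(E)/F^1=E$). Let $\Omega_X^*(\Omega^*_{\mathfrak J})$ be the bigraded algebra of forms on $X$ with values in the infinite jets of forms on $X$ (that is, forms along the formal neighbourhood of the diagonal of $X\times X$), with two anticommuting differentials: $d$, from the flat connection of the jet bundles (differentiation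 in $x$), and $d_{dR}$, the de Rham differential in the jet direction (differentiation in $y$). Infinite jet prolongation of forms is a quasi-isomorphism $J:\Omega_X^*\to(\Omega_X^*(\Omega_{\mathfrak J}^*),d+d_{dR})$; write $\Delta^*:\Omega_X^*(\Omega_{\mathfrak J}^*)\to\Omega_X^*$ for the restriction to the diagonal, so that $\Delta^*J=\mathrm{id}$. Likewise $d$ acts on $\Omega_X^*(\Omega_{\mathfrak J}^*(J(E)))$. Let $\sigma:\mathcal E\to\mathcal J(E)$ be a splitting: a $C^\infty(X)$-linear map with $q\sigma=\mathrm{id}$. Let $$\operatorname{ch}_k(\nabla)=\frac{1}{k!(-2\pi i)^k}\operatorname{Tr}(F_\nabla^k)\in\Omega^{2k}_X$$ for a connection $\nabla$ on $E$ with curvature $F_\nabla$. **Proposition.** 1. There is a unique connection $\nabla_\sigma$ on $\mathcal J(E)$ in the jet direction (additive, linear over $\mathcal J$ in the vector field in the sense that $\nabla_{\sigma,fY}=f(y)\,\nabla_{\sigma,Y}$, with $\nabla_{\sigma}(a m)=d_{dR}a\cdot m+a\nabla_\sigma m$ for $a\in\mathcal J$) such that $\nabla_\sigma(a\cdot\sigma(s))=d_{dR}a\cdot\sigma(s)$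 for all $a\in\mathcal J$ and $s\in\mathcal E$. It is flat. 2. The operator $\nabla^E_\sigma=q\circ\nabla_\sigma\circ j$ is a connection on $E$. Let $\alpha_E=[\nabla_\sigma,d]=\nabla_\sigma d+d\nabla_\sigma$ be the Atiyah class of $\nabla_\sigma$ (the commutator is graded). Its constant part is the curvature of $\nabla_\sigma^E$: $$q\big(\alpha_E(m)|_\Delta(Y,Z)\big)=F_{\nabla_\sigma^E}(Y,Z)\,q(m)$$ for all $m\in\mathcal J(E)$ and all vector fields $Y,Z$ on $X$, where $|_\Delta(Y,Z)$ denotes the evaluation on the vector fields $(Y,Y)$ and $(Z,Z)$ on $X \times X$. 3. For every $k\ge 0$ the form $$\omega_k=\frac{1}{k!(-2\pi i)^k}\operatorname{Tr}(\alpha_E^k)$$ is an element of $\Omega_X^*(\Omega_{\mathfrak J}^*)$ of total degree $2k$ with $d\omega_k=0$ and $d_{dR}\omega_k=0$, and it represents $\operatorname{ch}_k(E)\in H^{2k}(X;\mathbb C)$: for every connection $\nabla$ on $E$, $\operatorname{ch}_k(\nabla)$ is a closed form on $X$, $J(\operatorname{ch}_k(\nabla))-\omega_k$ is exact for $d+d_{dR}$,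 and $\operatorname{ch}_k(\nabla)-\Delta^*\omega_k$ is exact on $X$. -/

import Mathlib

open scoped Manifold ContDiff Bundle
open Bundle

namespace JetChern
noncomputable section

/-- Multiplication of complex numbers is smooth over `ℝ`. -/
instance instContMDiffRingComplex : ContMDiffRing 𝓘(ℝ, ℂ) ∞ ℂ :=
  { instNormedSpaceLieAddGroup with
    contMDiff_mul := by
      rw [contMDiff_iff]
      refine ⟨continuous_mul, fun x y => ?_⟩
      simp only [mfld_simps, chartAt_self_eq]
      rw [contDiffOn_univ]
      exact contDiff_mul }

set_option linter.unusedSectionVars false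

section Manifold
variable {EM HM : Type*} [NormedAddCommGroup EM] [NormedSpace ℝ EM] [TopologicalSpace HM]
  (IM : ModelWithCorners ℝ EM HM) (M : Type*) [TopologicalSpace M] [ChartedSpace HM M]

/-- Smooth complex-valued functions on `M`. -/
abbrev Fn := C^∞⟮IM, M; 𝓘(ℝ, ℂ), ℂ⟯


variable [IsManifold IM ∞ M]

/-- Smooth (real) vector fields on `M`. -/
abbrev VF := Cₛ^∞⟮IM; EM, (TangentSpace IM : M → Type _)⟯

variable {IM M}

/-- The derivative at `p` in the direction `v` of a map into a normed space. -/
def derivAlong {G : Type*} [NormedAddCommGroup G] [NormedSpace ℝ G]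
    (g : M → G) (p : M) (v : TangentSpace IM p) : G :=
  mfderiv IM 𝓘(ℝ, G) g p v

theorem contMDiffAt_derivAlong {G : Type*} [NormedAddCommGroup G] [NormedSpace ℝ G]
    {g : M → G} {U : Set M} (hU : IsOpen U) (hg : ContMDiffOn IM 𝓘(ℝ, G) ∞ g U)
    (Z : VF IM M) {p : M} (hp : p ∈ U) :
    ContMDiffAt IM 𝓘(ℝ, G) ∞ (fun q => derivAlong g q (Z q)) p := by
  have : IsManifold IM 1 M := IsManifold.of_le (n := ∞) (by simp)
  have h1 := hg.contMDiffOn_tangentMapWithin (m := ∞) (by simp) hU.uniqueMDiffOn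
  have h2 : ContMDiffOn IM 𝓘(ℝ, G).tangent ∞
      (fun q => tangentMapWithin IM 𝓘(ℝ, G) g U (⟨q, Z q⟩ : TangentBundle IM M)) U :=
    h1.comp Z.contMDiff.contMDiffOn (fun q hq => hq)
  have h3 := (contMDiff_snd_tangentBundle_modelSpace (n := ∞) G 𝓘(ℝ, G)).comp_contMDiffOn h2
  refine ((h3 p hp).contMDiffAt (hU.mem_nhds hp)).congr_of_eventuallyEq ?_
  filter_upwards [hU.mem_nhds hp] with q hq
  change mfderiv IM 𝓘(ℝ, G) g q (Z q) = mfderivWithin IM 𝓘(ℝ, G) g U q (Z q)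
  rw [mfderivWithin_of_isOpen hU hq]

/-- The derivative `Z f` of a smooth function along a vector field. -/
def lieDer (Z : VF IM M) (f : Fn IM M) : Fn IM M :=
  ⟨fun p => derivAlong f p (Z p), fun _ =>
    contMDiffAt_derivAlong isOpen_univ f.contMDiff.contMDiffOn Z (Set.mem_univ _)⟩

theorem lieDer_add (Z : VF IM M) (f g : Fn IM M) :
    lieDer Z (f + g) = lieDer Z f + lieDer Z g := by
  ext p
  have hf : MDifferentiableAt IM 𝓘(ℝ, ℂ) f p := f.contMDiff.mdifferentiableAt (by simp)
  have hg : MDifferentiableAt IM 𝓘(ℝ, ℂ) g p := g.contMDiff.mdifferentiableAt (by simp)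
  change mfderiv IM 𝓘(ℝ, ℂ) (⇑f + ⇑g) p (Z p) = _
  rw [mfderiv_add hf hg]
  rfl

theorem derivAlong_smul {G : Type*} [NormedAddCommGroup G] [NormedSpace ℂ G]
    {f : M → ℂ} {g : M → G} {p : M} (hf : MDifferentiableAt IM 𝓘(ℝ, ℂ) f p)
    (hg : MDifferentiableAt IM 𝓘(ℝ, G) g p) (v : TangentSpace IM p) :
    derivAlong (fun q => f q • g q) p v =
      derivAlong f p v • g p + f p • derivAlong g p v := by
  obtain ⟨hf1, hf2⟩ := hf.hasMFDerivAt
  obtain ⟨hg1, hg2⟩ := hg.hasMFDerivAt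
  let A : EM →L[ℝ] ℂ := mfderiv IM 𝓘(ℝ, ℂ) f p
  let B : EM →L[ℝ] G := mfderiv IM 𝓘(ℝ, G) g p
  have h : HasMFDerivAt IM 𝓘(ℝ, G) (fun q => f q • g q) p
      (f p • B + A.smulRight (g p) : EM →L[ℝ] G) :=
    ⟨hf1.smul hg1, by simpa only [mfld_simps] using! hf2.smul hg2⟩
  rw [derivAlong, h.mfderiv]
  exact add_comm _ _

theorem lieDer_mul (Z : VF IM M) (f g : Fn IM M) :
    lieDer Z (f * g) = lieDer Z f * g + f * lieDer Z g := by
  ext p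
  exact derivAlong_smul (f.contMDiff.mdifferentiableAt (by simp))
    (g.contMDiff.mdifferentiableAt (by simp)) (Z p)

/-- The Lie bracket of vector fields. -/
def bracket [FiniteDimensional ℝ EM] (Z W : VF IM M) : VF IM M :=
  ⟨VectorField.mlieBracket IM Z W, by
    have : CompleteSpace EM := FiniteDimensional.complete ℝ EM
    have : IsManifold IM (minSmoothness ℝ 2) M :=
      IsManifold.of_le (n := ∞) (by simpa using ENat.LEInfty.out)
    have : IsManifold IM (((⊤ : ℕ∞) : WithTop ℕ∞) + 1) M := by simpa using ‹IsManifold IM ∞ M›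
    exact fun p => ContMDiffAt.mlieBracket_vectorField (n := ⊤) (m := ⊤) (Z.contMDiff p) (W.contMDiff p) (by simp)⟩

/-- The product of a real function and a vector field. -/
def smulVF (f : C^∞⟮IM, M; 𝓘(ℝ, ℝ), ℝ⟯) (Z : VF IM M) : VF IM M :=
  ⟨(f : M → ℝ) • (Z : ∀ p, TangentSpace IM p), f.contMDiff.smul_section Z.contMDiff⟩

/-- A real function regarded as a complex-valued one. -/
def toFn (f : C^∞⟮IM, M; 𝓘(ℝ, ℝ), ℝ⟯) : Fn IM M :=
  ⟨fun p => (f p : ℂ), Complex.ofRealCLM.contMDiff.comp f.contMDiff⟩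

end Manifold

section Product
variable {EM HM : Type*} [NormedAddCommGroup EM] [NormedSpace ℝ EM] [TopologicalSpace HM]
  {IM : ModelWithCorners ℝ EM HM} {M : Type*} [TopologicalSpace M] [ChartedSpace HM M] [IsManifold IM ∞ M]

/-- The vector field `(Z, 0)` on `M × M`. -/
def lift₁ (Z : VF IM M) : VF (IM.prod IM) (M × M) :=
  ⟨fun p => ((Z p.1, 0) : EM × EM), by
    have : IsManifold IM 1 M := IsManifold.of_le (n := ∞) (by simp)
    exact (contMDiff_equivTangentBundleProd_symm (n := ∞)).comp
      ((Z.contMDiff.comp contMDiff_fst).prodMk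
        ((0 : VF IM M).contMDiff.comp contMDiff_snd))⟩

/-- The vector field `(0, Z)` on `M × M`. -/
def lift₂ (Z : VF IM M) : VF (IM.prod IM) (M × M) :=
  ⟨fun p => ((0, Z p.2) : EM × EM), by
    have : IsManifold IM 1 M := IsManifold.of_le (n := ∞) (by simp)
    exact (contMDiff_equivTangentBundleProd_symm (n := ∞)).comp
      (((0 : VF IM M).contMDiff.comp contMDiff_fst).prodMk
        (Z.contMDiff.comp contMDiff_snd))⟩
end Product
section Bundle
variable {EM HM : Type*} [NormedAddCommGroup EM] [NormedSpace ℝ EM] [TopologicalSpace HM]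
  (I : ModelWithCorners ℝ EM HM) {X : Type*} [TopologicalSpace X] [ChartedSpace HM X]
  [IsManifold I ∞ X]
  (F : Type*) [NormedAddCommGroup F] [NormedSpace ℂ F]
  (E : X → Type*) [TopologicalSpace (TotalSpace F E)] [∀ x, TopologicalSpace (E x)]
  [∀ x, AddCommGroup (E x)] [∀ x, Module ℂ (E x)] [FiberBundle F E]
  [VectorBundle ℂ F E] [VectorBundle ℝ F E] [ContMDiffVectorBundle ∞ F E I]

section Along
variable {EN HN : Type*} [NormedAddCommGroup EN] [NormedSpace ℝ EN] [TopologicalSpace HN]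
  {IN : ModelWithCorners ℝ EN HN} {N : Type*} [TopologicalSpace N] [ChartedSpace HN N]
  {I F E} {h : N → X}

theorem smooth_smul_along (f : Fn IN N) {s : ∀ p, E (h p)}
    (hs : ContMDiff IN (I.prod 𝓘(ℝ, F)) ∞ (fun p => (⟨h p, s p⟩ : TotalSpace F E))) :
    ContMDiff IN (I.prod 𝓘(ℝ, F)) ∞ (fun p => (⟨h p, f p • s p⟩ : TotalSpace F E)) := by
  intro p
  have hp := contMDiffAt_totalSpace.1 (hs p)
  refine contMDiffAt_totalSpace.2 ⟨hp.1, ?_⟩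
  have hf : ContMDiffAt IN 𝓘(ℝ, ℂ) ∞ f p := f.contMDiff p
  refine ((contDiff_smul (𝕜 := ℝ) (F := F) (𝕜' := ℂ)).contMDiff.contMDiffAt.comp p
    (hf.prodMk_space hp.2)).congr_of_eventuallyEq ?_
  have hc : ContinuousAt h p := hp.1.continuousAt
  filter_upwards [hc ((trivializationAt F E (h p)).open_baseSet.mem_nhds
    (mem_baseSet_trivializationAt F E (h p)))] with q hq
  exact ((trivializationAt F E (h p)).linear ℂ hq).2 _ _

theorem smooth_add_along {s t : ∀ p, E (h p)}
    (hs : ContMDiff IN (I.prod 𝓘(ℝ, F)) ∞ (fun p => (⟨h p, s p⟩ : TotalSpace F E)))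
    (ht : ContMDiff IN (I.prod 𝓘(ℝ, F)) ∞ (fun p => (⟨h p, t p⟩ : TotalSpace F E))) :
    ContMDiff IN (I.prod 𝓘(ℝ, F)) ∞ (fun p => (⟨h p, s p + t p⟩ : TotalSpace F E)) := by
  intro p
  have hp := contMDiffAt_totalSpace.1 (hs p)
  have hp' := contMDiffAt_totalSpace.1 (ht p)
  refine contMDiffAt_totalSpace.2 ⟨hp.1, ?_⟩
  refine (hp.2.add hp'.2).congr_of_eventuallyEq ?_
  have hc : ContinuousAt h p := hp.1.continuousAt
  filter_upwards [hc ((trivializationAt F E (h p)).open_baseSet.mem_nhds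
    (mem_baseSet_trivializationAt F E (h p)))] with q hq
  exact ((trivializationAt F E (h p)).linear ℂ hq).1 _ _

end Along

/-- The smooth sections of `E`. -/
abbrev Sec := Cₛ^∞⟮I; F, E⟯

instance : SMul (Fn I X) (Sec I F E) :=
  ⟨fun f s => ⟨fun x => f x • s x, smooth_smul_along f s.contMDiff⟩⟩

instance : Module (Fn I X) (Sec I F E) where
  one_smul s := by ext x; exact one_smul ℂ (s x)
  mul_smul f g s := by ext x; exact mul_smul (f x) (g x) (s x)
  smul_zero f := by ext x; exact smul_zero (f x)
  smul_add f s t := by ext x; exact smul_add (f x) (s x) (t x)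
  add_smul f g s := by ext x; exact add_smul (f x) (g x) (s x)
  zero_smul s := by ext x; exact zero_smul ℂ (s x)

/-- Smooth sections over `X × X` of the pullback of `E` along the second projection: families
`s (x, y) ∈ E y`, smooth as maps into the total space of `E`. -/
def kernelSections : AddSubgroup (∀ p : X × X, E p.2) where
  carrier := {s | ContMDiff (I.prod I) (I.prod 𝓘(ℝ, F)) ∞
    (fun p : X × X => (⟨p.2, s p⟩ : TotalSpace F E))}
  add_mem' hs ht := smooth_add_along hs ht
  zero_mem' := ((0 : Sec I F E).contMDiff).comp contMDiff_snd
  neg_mem' {s} hs := by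
    have := smooth_smul_along (-1 : Fn (I.prod I) (X × X)) hs
    refine this.congr fun p => ?_
    change (⟨p.2, -s p⟩ : TotalSpace F E) = ⟨p.2, (-1 : ℂ) • s p⟩
    simp

/-- `kernelSections` as a type. -/
abbrev KSec := kernelSections I F E

instance : SMul (Fn (I.prod I) (X × X)) (KSec I F E) :=
  ⟨fun f s => ⟨fun p => f p • s.1 p, smooth_smul_along f s.2⟩⟩

instance : Module (Fn (I.prod I) (X × X)) (KSec I F E) where
  one_smul s := by ext p; exact one_smul ℂ (s.1 p)
  mul_smul f g s := by ext p; exact mul_smul (f p) (g p) (s.1 p)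
  smul_zero f := by ext p; exact smul_zero (f p)
  smul_add f s t := by ext p; exact smul_add (f p) (s.1 p) (t.1 p)
  add_smul f g s := by ext p; exact add_smul (f p) (g p) (s.1 p)
  zero_smul s := by ext p; exact zero_smul ℂ (s.1 p)

variable {I F E}

theorem contMDiffOn_coord (s : KSec I F E)
    (e : Trivialization F (TotalSpace.proj : TotalSpace F E → X)) [MemTrivializationAtlas e] :
    ContMDiffOn (I.prod I) 𝓘(ℝ, F) ∞ (fun p : X × X => (e ⟨p.2, s.1 p⟩).2)
      {p | p.2 ∈ e.baseSet} := by
  intro p hp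
  have hm : (⟨p.2, s.1 p⟩ : TotalSpace F E) ∈ e.source := e.mem_source.2 hp
  exact ((e.contMDiffAt_iff (f := fun p : X × X => (⟨p.2, s.1 p⟩ : TotalSpace F E)) hm).1
    (s.2 p)).2.contMDiffWithinAt

theorem isOpen_snd_baseSet (e : Trivialization F (TotalSpace.proj : TotalSpace F E → X)) :
    IsOpen {p : X × X | p.2 ∈ e.baseSet} :=
  e.open_baseSet.preimage continuous_snd

theorem mdifferentiableAt_coord (s : KSec I F E)
    (e : Trivialization F (TotalSpace.proj : TotalSpace F E → X)) [MemTrivializationAtlas e]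
    {p : X × X} (hp : p.2 ∈ e.baseSet) :
    MDifferentiableAt (I.prod I) 𝓘(ℝ, F) (fun p : X × X => (e ⟨p.2, s.1 p⟩).2) p :=
  ((contMDiffOn_coord s e p hp).contMDiffAt
    ((isOpen_snd_baseSet e).mem_nhds hp)).mdifferentiableAt (by simp)

theorem mdifferentiableAt_slice {G : Type*} [NormedAddCommGroup G] [NormedSpace ℝ G]
    {g : X × X → G} {p : X × X} (hg : MDifferentiableAt (I.prod I) 𝓘(ℝ, G) g p) :
    MDifferentiableAt I 𝓘(ℝ, G) (fun x => g (x, p.2)) p.1 := by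
  have h : MDifferentiableAt I (I.prod I) (fun x : X => (x, p.2)) p.1 :=
    mdifferentiableAt_id.prodMk mdifferentiableAt_const
  exact MDifferentiableAt.comp p.1 (I' := I.prod I) (g := g) hg h

theorem derivAlong_slice {G : Type*} [NormedAddCommGroup G] [NormedSpace ℝ G]
    {g : X × X → G} {p : X × X} (hg : MDifferentiableAt (I.prod I) 𝓘(ℝ, G) g p) (Z : VF I X) :
    derivAlong (IM := I) (fun x => g (x, p.2)) p.1 (Z p.1) =
      derivAlong (IM := I.prod I) g p (lift₁ Z p) := by
  have h : MDifferentiableAt I (I.prod I) (fun x : X => (x, p.2)) p.1 :=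
    mdifferentiableAt_id.prodMk mdifferentiableAt_const
  have h2 := mfderiv_comp p.1 (I' := I.prod I) (g := g) hg h
  rw [mfderiv_prod_left] at h2
  unfold derivAlong
  change mfderiv I 𝓘(ℝ, G) (g ∘ fun x => (x, p.2)) p.1 (Z p.1) = _
  rw [h2]
  rfl

/-- The value at `p` of the derivative in the first variable, along a vector field, of a family
`s (x, y) ∈ E y`; for fixed `y` this differentiates a function with values in the fixed vector
space `E y`, which is identified with `F` in order to do so. -/
def derivFstFun (Z : VF I X) (s : KSec I F E) (p : X × X) : E p.2 :=
  (trivializationAt F E p.2).symm p.2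
    (derivAlong (IM := I) (fun x => (trivializationAt F E p.2 ⟨p.2, s.1 (x, p.2)⟩).2) p.1 (Z p.1))

theorem coord_derivFstFun (Z : VF I X) (s : KSec I F E) (p : X × X)
    (e : Trivialization F (TotalSpace.proj : TotalSpace F E → X)) [MemTrivializationAtlas e]
    (hp : p.2 ∈ e.baseSet) :
    (e ⟨p.2, derivFstFun Z s p⟩).2 =
      derivAlong (IM := I.prod I) (fun q : X × X => (e ⟨q.2, s.1 q⟩).2) p (lift₁ Z p) := by
  have hy : p.2 ∈ (trivializationAt F E p.2).baseSet := mem_baseSet_trivializationAt F E p.2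
  let L : F →L[ℝ] F := (trivializationAt F E p.2).coordChangeL ℝ e p.2
  have hL : ∀ w, (e ⟨p.2, (trivializationAt F E p.2).symm p.2 w⟩).2 = L w := fun w =>
    ((trivializationAt F E p.2).coordChangeL_apply e ⟨hy, hp⟩ w).symm
  rw [← derivAlong_slice (mdifferentiableAt_coord s e hp) Z]
  have hfun : (fun x => (e ⟨p.2, s.1 (x, p.2)⟩).2) =
      fun x => L ((trivializationAt F E p.2 ⟨p.2, s.1 (x, p.2)⟩).2) := by
    funext x
    rw [← hL, (trivializationAt F E p.2).symm_apply_apply_mk hy]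
  have hd : MDifferentiableAt I 𝓘(ℝ, F)
      (fun x => (trivializationAt F E p.2 ⟨p.2, s.1 (x, p.2)⟩).2) p.1 :=
    mdifferentiableAt_slice (mdifferentiableAt_coord s (trivializationAt F E p.2) hy)
  have h2 := mfderiv_comp p.1 (I' := 𝓘(ℝ, F)) (g := L) L.mdifferentiableAt hd
  rw [derivFstFun, hL]
  change _ = derivAlong (fun x => (e ⟨p.2, s.1 (x, p.2)⟩).2) p.1 (Z p.1)
  rw [hfun]
  unfold derivAlong
  change _ = mfderiv I 𝓘(ℝ, F)
    (L ∘ fun x => (trivializationAt F E p.2 ⟨p.2, s.1 (x, p.2)⟩).2) p.1 (Z p.1)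
  rw [h2, L.mfderiv_eq]
  rfl

theorem derivFstFun_ext {p : X × X} {v w : E p.2}
    (h : (trivializationAt F E p.2 ⟨p.2, v⟩).2 = (trivializationAt F E p.2 ⟨p.2, w⟩).2) :
    v = w := by
  have hy : p.2 ∈ (trivializationAt F E p.2).baseSet := mem_baseSet_trivializationAt F E p.2
  rw [← (trivializationAt F E p.2).symm_apply_apply_mk hy v, h,
    (trivializationAt F E p.2).symm_apply_apply_mk hy w]

/-- `derivFstFun` as an operator on smooth families. -/
def derivFst (Z : VF I X) (s : KSec I F E) : KSec I F E :=
  ⟨derivFstFun Z s, by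
    intro p
    refine contMDiffAt_totalSpace.2 ⟨contMDiffAt_snd, ?_⟩
    have hp : p.2 ∈ (trivializationAt F E p.2).baseSet := mem_baseSet_trivializationAt F E p.2
    refine (contMDiffAt_derivAlong (isOpen_snd_baseSet (trivializationAt F E p.2))
      (contMDiffOn_coord s _) (lift₁ Z) hp).congr_of_eventuallyEq ?_
    filter_upwards [(isOpen_snd_baseSet (trivializationAt F E p.2)).mem_nhds hp] with q hq
    exact coord_derivFstFun Z s q _ hq⟩

theorem derivFst_add (Z : VF I X) (s t : KSec I F E) :
    derivFst Z (s + t) = derivFst Z s + derivFst Z t := by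
  ext p
  have hp : p.2 ∈ (trivializationAt F E p.2).baseSet := mem_baseSet_trivializationAt F E p.2
  apply derivFstFun_ext (F := F)
  have hl := ((trivializationAt F E p.2).linear ℂ hp).1
    (derivFstFun Z s p) (derivFstFun Z t p)
  refine (coord_derivFstFun Z (s + t) p _ hp).trans (Eq.trans ?_ hl.symm)
  rw [coord_derivFstFun Z s p _ hp, coord_derivFstFun Z t p _ hp]
  have hev : (fun q : X × X => (trivializationAt F E p.2 ⟨q.2, (s + t).1 q⟩).2) =ᶠ[nhds p]
      (fun q : X × X => (trivializationAt F E p.2 ⟨q.2, s.1 q⟩).2) +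
        (fun q : X × X => (trivializationAt F E p.2 ⟨q.2, t.1 q⟩).2) := by
    filter_upwards [(isOpen_snd_baseSet (trivializationAt F E p.2)).mem_nhds hp] with q hq
    exact ((trivializationAt F E p.2).linear ℂ hq).1 _ _
  unfold derivAlong
  rw [hev.mfderiv_eq, mfderiv_add (mdifferentiableAt_coord s (trivializationAt F E p.2) hp)
    (mdifferentiableAt_coord t (trivializationAt F E p.2) hp)]
  rfl

theorem derivFst_smul (Z : VF I X) (f : Fn (I.prod I) (X × X)) (s : KSec I F E) :
    derivFst Z (f • s) = lieDer (lift₁ Z) f • s + f • derivFst Z s := by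
  ext p
  have hp : p.2 ∈ (trivializationAt F E p.2).baseSet := mem_baseSet_trivializationAt F E p.2
  apply derivFstFun_ext (F := F)
  have hl := ((trivializationAt F E p.2).linear ℂ hp).1
    (lieDer (lift₁ Z) f p • s.1 p) (f p • derivFstFun Z s p)
  rw [((trivializationAt F E p.2).linear ℂ hp).2, ((trivializationAt F E p.2).linear ℂ hp).2,
    coord_derivFstFun Z s p _ hp] at hl
  refine (coord_derivFstFun Z (f • s) p _ hp).trans (Eq.trans ?_ hl.symm)
  have hev : (fun q : X × X => (trivializationAt F E p.2 ⟨q.2, (f • s).1 q⟩).2) =ᶠ[nhds p]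
      fun q : X × X => f q • (trivializationAt F E p.2 ⟨q.2, s.1 q⟩).2 := by
    filter_upwards [(isOpen_snd_baseSet (trivializationAt F E p.2)).mem_nhds hp] with q hq
    exact ((trivializationAt F E p.2).linear ℂ hq).2 _ _
  unfold derivAlong
  rw [hev.mfderiv_eq]
  exact derivAlong_smul (f.contMDiff.mdifferentiableAt (by simp))
    (mdifferentiableAt_coord s (trivializationAt F E p.2) hp) _
end Bundle

section Jets
variable {EM HM : Type*} [NormedAddCommGroup EM] [NormedSpace ℝ EM] [TopologicalSpace HM]
  (I : ModelWithCorners ℝ EM HM) (X : Type*) [TopologicalSpace X] [ChartedSpace HM X]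
  [IsManifold I ∞ X]

/-- Smooth functions of two points `(x, y) ∈ X × X`. -/
abbrev Fn₂ := Fn (I.prod I) (X × X)

/-- The ideal of functions vanishing on the diagonal of `X × X`. -/
def diagIdeal : Ideal (Fn₂ I X) where
  carrier := {f | ∀ x, f (x, x) = 0}
  add_mem' {f g} hf hg x := by
    change f (x, x) + g (x, x) = 0
    rw [hf x, hg x, add_zero]
  zero_mem' _ := rfl
  smul_mem' c f hf x := by
    change c (x, x) * f (x, x) = 0
    rw [hf x, mul_zero]

section Module
variable (N : Type*) [AddCommGroup N] [Module (Fn₂ I X) N]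

/-- The elements of a module over `C^∞(X × X)` which vanish to order `k` along the diagonal, that
is, which lie in `𝓘 ^ k • N` near each point of the diagonal. -/
def vanishing (k : ℕ) : Submodule (Fn₂ I X) N where
  carrier := {m | ∀ x : X, ∃ χ : Fn₂ I X, χ (x, x) = 1 ∧
    χ • m ∈ (diagIdeal I X ^ k • ⊤ : Submodule (Fn₂ I X) N)}
  add_mem' {m m'} hm hm' x := by
    obtain ⟨χ, h1, h2⟩ := hm x
    obtain ⟨χ', h1', h2'⟩ := hm' x
    refine ⟨χ * χ', ?_, ?_⟩
    · change χ (x, x) * χ' (x, x) = 1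
      rw [h1, h1', one_mul]
    · rw [smul_add]
      refine Submodule.add_mem _ ?_ ?_
      · rw [mul_comm, mul_smul]
        exact Submodule.smul_mem _ _ h2
      · rw [mul_smul]
        exact Submodule.smul_mem _ _ h2'
  zero_mem' x := ⟨1, rfl, by simp⟩
  smul_mem' c m hm x := by
    obtain ⟨χ, h1, h2⟩ := hm x
    refine ⟨χ, h1, ?_⟩
    rw [smul_comm]
    exact Submodule.smul_mem _ _ h2

/-- The elements which vanish to infinite order along the diagonal. -/
def flat : Submodule (Fn₂ I X) N := ⨅ k, vanishing I X N k

variable {I X N}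

theorem lieDer_pow_mem (Z : VF (I.prod I) (X × X)) (k : ℕ) {f : Fn₂ I X}
    (hf : f ∈ diagIdeal I X ^ (k + 1)) : lieDer Z f ∈ diagIdeal I X ^ k := by
  induction k generalizing f with
  | zero => simp
  | succ k ih =>
    rw [pow_succ] at hf
    refine Submodule.mul_induction_on hf (fun a ha b hb => ?_) (fun a b ha hb => ?_)
    · rw [lieDer_mul]
      refine Ideal.add_mem _ ?_ (Ideal.mul_mem_right _ _ ha)
      rw [pow_succ]
      exact Ideal.mul_mem_mul (ih ha) hb
    · rw [lieDer_add]
      exact Ideal.add_mem _ ha hb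

theorem map_flat (Z : VF (I.prod I) (X × X)) (D : N → N) (hadd : ∀ m m', D (m + m') = D m + D m')
    (hsmul : ∀ (f : Fn₂ I X) m, D (f • m) = lieDer Z f • m + f • D m) {m : N}
    (hm : m ∈ flat I X N) : D m ∈ flat I X N := by
  have key : ∀ (k : ℕ) (m : N), m ∈ (diagIdeal I X ^ (k + 1) • ⊤ : Submodule (Fn₂ I X) N) →
      D m ∈ (diagIdeal I X ^ k • ⊤ : Submodule (Fn₂ I X) N) := by
    intro k m hm
    refine Submodule.smul_induction_on hm (fun f hf n _ => ?_) (fun a b ha hb => ?_)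
    · rw [hsmul]
      exact Submodule.add_mem _
        (Submodule.smul_mem_smul (lieDer_pow_mem Z k hf) Submodule.mem_top)
        (Submodule.smul_mem_smul (Ideal.pow_le_pow_right (Nat.le_succ k) hf) Submodule.mem_top)
    · rw [hadd]
      exact Submodule.add_mem _ ha hb
  rw [flat, Submodule.mem_iInf] at hm ⊢
  intro k x
  obtain ⟨χ, h1, h2⟩ := hm (k + 1) x
  refine ⟨χ * χ, ?_, ?_⟩
  · change χ (x, x) * χ (x, x) = 1
    rw [h1, one_mul]
  · have h3 : (χ * χ) • D m = χ • D (χ • m) - lieDer Z χ • (χ • m) := by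
      rw [hsmul, smul_add, smul_comm (lieDer Z χ) χ m, mul_smul]
      abel
    rw [h3]
    refine Submodule.sub_mem _ (Submodule.smul_mem _ _ (key k _ h2)) (Submodule.smul_mem _ _ ?_)
    exact Submodule.smul_mono_left (Ideal.pow_le_pow_right (Nat.le_succ k)) h2

theorem D_sub_mem (Z : VF (I.prod I) (X × X)) (D : N → N)
    (hadd : ∀ m m', D (m + m') = D m + D m')
    (hsmul : ∀ (f : Fn₂ I X) m, D (f • m) = lieDer Z f • m + f • D m) {m m' : N}
    (h : m - m' ∈ flat I X N) : D m - D m' ∈ flat I X N := by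
  have h2 : D m - D m' = D (m - m') := by
    rw [sub_eq_iff_eq_add, ← hadd, sub_add_cancel]
  rw [h2]
  exact map_flat Z D hadd hsmul h

end Module

/-- The algebra `𝓙` of smooth sections of the bundle of infinite jets of functions on `X`: a smooth
function `f (x, y)` gives the family of the jets at `x` of the functions `f (x, ·)`, and two
functions give the same family iff their difference vanishes to infinite order along the
diagonal. -/
abbrev Jet := Fn₂ I X ⧸ (flat I X (Fn₂ I X) : Ideal (Fn₂ I X))


variable {I X}

/-- The jet family of a function of two variables. -/
def jmk : Fn₂ I X →+* Jet I X := Ideal.Quotient.mk _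

/-- Descent of a first order operator. -/
def jetDer (Z : VF (I.prod I) (X × X)) : Jet I X → Jet I X :=
  Quotient.map' (lieDer Z) (by
    intro a b h
    rw [Submodule.quotientRel_def] at h ⊢
    exact D_sub_mem Z (lieDer Z) (lieDer_add Z) (lieDer_mul Z) h)
end Jets

section Restriction
variable {EM HM : Type*} [NormedAddCommGroup EM] [NormedSpace ℝ EM] [TopologicalSpace HM]
  {I : ModelWithCorners ℝ EM HM} {X : Type*} [TopologicalSpace X] [ChartedSpace HM X]
  [IsManifold I ∞ X]

/-- Constant functions. -/
def constFn (c : ℂ) : Fn I X := ⟨fun _ => c, contMDiff_const⟩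

/-- Pullback of functions along the first projection `X × X → X`. -/
def pullFst : Fn I X →+* Fn₂ I X where
  toFun f := ⟨fun p => f p.1, f.contMDiff.comp contMDiff_fst⟩
  map_one' := rfl
  map_mul' _ _ := rfl
  map_zero' := rfl
  map_add' _ _ := rfl

/-- Pullback of functions along the second projection `X × X → X`. -/
def pullSnd : Fn I X →+* Fn₂ I X where
  toFun f := ⟨fun p => f p.2, f.contMDiff.comp contMDiff_snd⟩
  map_one' := rfl
  map_mul' _ _ := rfl
  map_zero' := rfl
  map_add' _ _ := rfl

/-- Restriction of functions to the diagonal. -/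
def restrictDiag : Fn₂ I X →+* Fn I X where
  toFun f := ⟨fun x => f (x, x), f.contMDiff.comp (contMDiff_id.prodMk contMDiff_id)⟩
  map_one' := rfl
  map_mul' _ _ := rfl
  map_zero' := rfl
  map_add' _ _ := rfl

theorem eq_zero_of_mem_flat {f : Fn₂ I X} (hf : f ∈ flat I X (Fn₂ I X)) (x : X) :
    f (x, x) = 0 := by
  rw [flat, Submodule.mem_iInf] at hf
  obtain ⟨χ, h1, h2⟩ := hf 1 x
  have h3 : χ * f ∈ diagIdeal I X := by
    rw [pow_one] at h2
    exact Submodule.smul_le.2 (fun a ha b _ => Ideal.mul_mem_right b _ ha) h2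
  have h4 : χ (x, x) * f (x, x) = 0 := h3 x
  rwa [h1, one_mul] at h4

/-- `C^∞(X) → 𝓙`, the structure of an algebra over the functions on the base: a function `f`
gives the family of constant jets `f (x)`. -/
def pr₁ : Fn I X →+* Jet I X := jmk.comp pullFst

/-- `C^∞(X) → 𝓙`, the infinite jet prolongation `f ↦ (j_x f)_x`. -/
def pr₂ : Fn I X →+* Jet I X := jmk.comp pullSnd

/-- `𝓙 → C^∞(X)`, the values of the jets at their base points. -/
def jetValue : Jet I X →+* Fn I X :=
  Ideal.Quotient.lift _ restrictDiag (fun f hf => by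
    ext x
    exact eq_zero_of_mem_flat hf x)

/-- The flat connection on the jet bundle, along `Z`: the derivative in the base point. -/
def act₁ (Z : VF I X) : Jet I X → Jet I X := jetDer (lift₁ Z)

/-- The derivative of jets in the jet direction, along the infinite jet of `Z`. -/
def act₂ (Z : VF I X) : Jet I X → Jet I X := jetDer (lift₂ Z)

end Restriction

section JetBundle
variable {EM HM : Type*} [NormedAddCommGroup EM] [NormedSpace ℝ EM] [TopologicalSpace HM]
  (I : ModelWithCorners ℝ EM HM) {X : Type*} [TopologicalSpace X] [ChartedSpace HM X]
  [IsManifold I ∞ X]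
  (F : Type*) [NormedAddCommGroup F] [NormedSpace ℂ F]
  (E : X → Type*) [TopologicalSpace (TotalSpace F E)] [∀ x, TopologicalSpace (E x)]
  [∀ x, AddCommGroup (E x)] [∀ x, Module ℂ (E x)] [FiberBundle F E]
  [VectorBundle ℂ F E] [VectorBundle ℝ F E] [ContMDiffVectorBundle ∞ F E I]

/-- The module of smooth sections of the bundle `J(E)` of infinite jets of sections of `E`: a
family `s (x, y) ∈ E y` gives the family of the jets at `x` of the sections `s (x, ·)`, and two
families are identified iff their difference vanishes to infinite order along the diagonal. -/
abbrev JetE := KSec I F E ⧸ flat I X (KSec I F E)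

variable {I F E}

theorem smul_mem_flat {f : Fn₂ I X} (hf : f ∈ flat I X (Fn₂ I X)) (m : KSec I F E) :
    f • m ∈ flat I X (KSec I F E) := by
  rw [flat, Submodule.mem_iInf] at hf ⊢
  intro k x
  obtain ⟨χ, h1, h2⟩ := hf k x
  refine ⟨χ, h1, ?_⟩
  rw [← mul_smul]
  have h3 : χ * f ∈ diagIdeal I X ^ k := by
    exact Submodule.smul_le.2 (fun a ha b _ => Ideal.mul_mem_right b _ ha) h2
  exact Submodule.smul_mem_smul h3 Submodule.mem_top

instance instModuleJetE : Module (Jet I X) (JetE I F E) :=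
  Module.IsTorsionBySet.module (R := Fn₂ I X) (M := JetE I F E)
    (I := (flat I X (Fn₂ I X) : Ideal (Fn₂ I X))) (by
      intro m f
      obtain ⟨m, rfl⟩ := Submodule.Quotient.mk_surjective _ m
      rw [← Submodule.Quotient.mk_smul, Submodule.Quotient.mk_eq_zero]
      exact smul_mem_flat f.2 m)

theorem jmk_smul_mk (f : Fn₂ I X) (m : KSec I F E) :
    (jmk f • (Submodule.Quotient.mk m : JetE I F E) : JetE I F E) =
      Submodule.Quotient.mk (f • m) := rfl

theorem derivFst_sub_mem (Z : VF I X) {s t : KSec I F E} (h : s - t ∈ flat I X (KSec I F E)) :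
    derivFst Z s - derivFst Z t ∈ flat I X (KSec I F E) :=
  D_sub_mem (N := KSec I F E) (lift₁ Z) (fun m => derivFst Z m) (derivFst_add Z)
    (derivFst_smul Z) h

/-- The flat connection of `J(E)`, along `Z`: the derivative in the base point. -/
def actE₁ (Z : VF I X) : JetE I F E → JetE I F E :=
  Quotient.lift
    (fun s => (Submodule.Quotient.mk (derivFst Z s) : JetE I F E)) (fun _ _ h =>
      (Submodule.Quotient.eq _).2 (derivFst_sub_mem Z ((Submodule.quotientRel_def _).1 h)))

/-- The infinite jet of a section, as a family: `s (y)`, independent of `x`. -/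
def pullSec (s : Sec I F E) : KSec I F E :=
  ⟨fun p => s p.2, s.contMDiff.comp contMDiff_snd⟩

/-- The infinite jet prolongation `s ↦ (j_x s)_x` of a section of `E`. -/
def jetProlong (s : Sec I F E) : JetE I F E := Submodule.Quotient.mk (pullSec s)

/-- Restriction of a family to the diagonal. -/
def restrictSec : KSec I F E →+ Sec I F E where
  toFun s := ⟨fun x => s.1 (x, x), s.2.comp (contMDiff_id.prodMk contMDiff_id)⟩
  map_zero' := rfl
  map_add' _ _ := rfl

theorem restrictSec_smul (f : Fn₂ I X) (s : KSec I F E) :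
    restrictSec (f • s) = restrictDiag f • restrictSec s := rfl

theorem restrictSec_eq_zero {s : KSec I F E} (hs : s ∈ flat I X (KSec I F E)) :
    restrictSec s = 0 := by
  have key : ∀ t ∈ (diagIdeal I X • ⊤ : Submodule (Fn₂ I X) (KSec I F E)),
      restrictSec t = 0 := by
    intro t ht
    refine Submodule.smul_induction_on ht (fun f hf n _ => ?_) (fun a b ha hb => ?_)
    · have h0 : (restrictDiag f : Fn I X) = 0 := by
        ext x
        exact hf x
      rw [restrictSec_smul, h0, zero_smul]
    · rw [map_add, ha, hb, add_zero]
  rw [flat, Submodule.mem_iInf] at hs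
  ext x
  obtain ⟨χ, h1, h2⟩ := hs 1 x
  rw [pow_one] at h2
  have h3 := key _ h2
  have h4 : χ (x, x) • s.1 (x, x) = 0 := DFunLike.congr_fun h3 x
  rwa [h1, one_smul] at h4

/-- The projection `J(E) → J(E) / F¹ = E`, the values of the jets at their base points. -/
def value : JetE I F E →+ Sec I F E where
  toFun := Quotient.lift restrictSec (by
    intro a b h
    have h2 : a - b ∈ flat I X (KSec I F E) := (Submodule.quotientRel_def _).1 h
    have h3 := restrictSec_eq_zero h2
    rwa [map_sub, sub_eq_zero] at h3)
  map_zero' := rfl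
  map_add' := by
    rintro ⟨a⟩ ⟨b⟩
    rfl

end JetBundle

section Algebra

/-- The Chevalley–Eilenberg differential of cochains on a Lie algebra with bracket `br` acting by
`ρ`:
`(dθ)(v₀, …, vₙ) = ∑ᵢ (-1)ⁱ ρ(vᵢ) θ(…, v̂ᵢ, …) + ∑_{i<j} (-1)ʲ θ(…, [vᵢ, vⱼ], …, v̂ⱼ, …)`,
where `[vᵢ, vⱼ]` stands in the place of `vᵢ`. With covariant derivatives for `ρ` it is the
exterior covariant derivative. -/
def ceDiff {L N : Type*} [AddCommGroup N] (br : L → L → L) (ρ : L → N → N) {n : ℕ}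
    (θ : (Fin n → L) → N) : (Fin (n + 1) → L) → N := fun v =>
  ∑ i : Fin (n + 1), (-1 : ℤ) ^ (i : ℕ) • ρ (v i) (θ fun l => v (i.succAbove l)) +
    ∑ i : Fin (n + 1), ∑ j ∈ Finset.Ioi i, (-1 : ℤ) ^ (j : ℕ) •
      θ fun l => Function.update v i (br (v i) (v j)) (j.succAbove l)

/-- `t` is the trace of the endomorphism `φ` of a locally free module `N` of finite rank: whenever
`χ = ∑ eᵢ ⊗ e'ᵢ` on `N`, one has `χ t = ∑ e'ᵢ (φ eᵢ)`. -/
def IsTrace {S N : Type*} [CommRing S] [AddCommGroup N] [Module S N] (φ : N → N) (t : S) : Prop :=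
  ∀ (χ : S) (r : ℕ) (e : Fin r → N) (e' : Fin r → N →ₗ[S] S),
    (∀ m, χ • m = ∑ i, e' i m • e i) → χ * t = ∑ i, e' i (φ (e i))

open Classical in
/-- The trace of an endomorphism of a locally free module of finite rank. -/
def trace {S N : Type*} [CommRing S] [AddCommGroup N] [Module S N] (φ : N → N) : S :=
  if h : ∃ t : S, IsTrace φ t then h.choose else 0

/-- The normalisation `1 / (k! (-2πi)ᵏ)`. -/
def chernConst (k : ℕ) : ℂ :=
  1 / ((Nat.factorial k : ℂ) * (-2 * (Real.pi : ℂ) * Complex.I) ^ k)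

end Algebra

section Forms
variable {EM HM : Type*} [NormedAddCommGroup EM] [NormedSpace ℝ EM] [FiniteDimensional ℝ EM]
  [TopologicalSpace HM] {I : ModelWithCorners ℝ EM HM} {X : Type*} [TopologicalSpace X]
  [ChartedSpace HM X] [IsManifold I ∞ X]

/-- `θ` is a complex-valued differential `n`-form on `X`, as an alternating function of vector
fields which is linear over the smooth functions. -/
structure IsForm {n : ℕ} (θ : (Fin n → VF I X) → Fn I X) : Prop where
  map_add : ∀ v i Z W, θ (Function.update v i (Z + W)) =
    θ (Function.update v i Z) + θ (Function.update v i W)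
  map_smul : ∀ v i f Z, θ (Function.update v i (smulVF f Z)) = toFn f * θ (Function.update v i Z)
  map_eq_zero : ∀ v i j, v i = v j → i ≠ j → θ v = 0

/-- The exterior derivative. -/
def extDeriv {n : ℕ} (θ : (Fin n → VF I X) → Fn I X) : (Fin (n + 1) → VF I X) → Fn I X :=
  ceDiff bracket lieDer θ

/-- `θ` is the exterior derivative of a form. -/
def IsExact : {n : ℕ} → ((Fin n → VF I X) → Fn I X) → Prop
  | 0, θ => θ = 0
  | _ + 1, θ => ∃ η, IsForm η ∧ θ = extDeriv η

/-- `θ` is an element of total degree `n` of `Ω_X^*(Ω_𝔍^*)`, the forms on `X` with values in the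
jets of forms on `X`. It is evaluated on pairs `(Y, Z)`, where `Y` is a vector field on the base
and `Z` acts in the jet direction; `θ` is alternating, and linear over the functions of the base
point in `Y` and over the jets of functions in `Z`. Its component in `Ω_X^p(Ω_𝔍^q)` is its
restriction to `p` pairs of the form `(Y, 0)` and `q` of the form `(0, Z)`. -/
structure IsJetForm {n : ℕ} (θ : (Fin n → VF I X × VF I X) → Jet I X) : Prop where
  map_add : ∀ v i z w, θ (Function.update v i (z + w)) =
    θ (Function.update v i z) + θ (Function.update v i w)
  map_smul_fst : ∀ v i f Y, θ (Function.update v i (smulVF f Y, 0)) =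
    pr₁ (toFn f) * θ (Function.update v i (Y, 0))
  map_smul_snd : ∀ v i f Z, θ (Function.update v i (0, smulVF f Z)) =
    pr₂ (toFn f) * θ (Function.update v i (0, Z))
  map_eq_zero : ∀ v i j, v i = v j → i ≠ j → θ v = 0

/-- The bracket of the vector fields on the base. -/
def br₁ (v w : VF I X × VF I X) : VF I X × VF I X := (bracket v.1 w.1, 0)

/-- The bracket of the vector fields in the jet direction. -/
def br₂ (v w : VF I X × VF I X) : VF I X × VF I X := (0, bracket v.2 w.2)

/-- The differential of `Ω_X^*(Ω_𝔍^*)` that comes from the flat connection of the jet bundle. -/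
def dBase {n : ℕ} (θ : (Fin n → VF I X × VF I X) → Jet I X) :
    (Fin (n + 1) → VF I X × VF I X) → Jet I X :=
  ceDiff br₁ (fun v => act₁ v.1) θ

/-- The de Rham differential `d_dR` of `Ω_X^*(Ω_𝔍^*)`, in the jet direction. -/
def dJet {n : ℕ} (θ : (Fin n → VF I X × VF I X) → Jet I X) :
    (Fin (n + 1) → VF I X × VF I X) → Jet I X :=
  ceDiff br₂ (fun v => act₂ v.2) θ

/-- `θ` is exact in the total complex of `Ω_X^*(Ω_𝔍^*)`. -/
def IsJetExact : {n : ℕ} → ((Fin n → VF I X × VF I X) → Jet I X) → Prop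
  | 0, θ => θ = 0
  | _ + 1, θ => ∃ η, IsJetForm η ∧ θ = dBase η + dJet η

/-- The quasi-isomorphism `Ω_X^n → Ω_X^0(Ω_𝔍^n)`, the infinite jet prolongation of forms. -/
def jetForm {n : ℕ} (θ : (Fin n → VF I X) → Fn I X) : (Fin n → VF I X × VF I X) → Jet I X :=
  fun v => pr₂ (θ fun i => (v i).2)

/-- The map from the total complex of `Ω_X^*(Ω_𝔍^*)` to `Ω_X^*` that multiplies a form on the base
with the value of a jet of a form at its base point; it is a one-sided inverse of `jetForm`. -/
def valueForm {n : ℕ} (θ : (Fin n → VF I X × VF I X) → Jet I X) : (Fin n → VF I X) → Fn I X :=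
  fun v => jetValue (θ fun i => (v i, v i))

end Forms

section Chern
variable {EM HM : Type*} [NormedAddCommGroup EM] [NormedSpace ℝ EM] [FiniteDimensional ℝ EM]
  [TopologicalSpace HM] {I : ModelWithCorners ℝ EM HM} {X : Type*} [TopologicalSpace X]
  [ChartedSpace HM X] [IsManifold I ∞ X]
  {F : Type*} [NormedAddCommGroup F] [NormedSpace ℂ F]
  {E : X → Type*} [TopologicalSpace (TotalSpace F E)] [∀ x, TopologicalSpace (E x)]
  [∀ x, AddCommGroup (E x)] [∀ x, Module ℂ (E x)] [FiberBundle F E]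
  [VectorBundle ℂ F E] [VectorBundle ℝ F E] [ContMDiffVectorBundle ∞ F E I]

/-- `D` is a connection on the complex vector bundle `E`. -/
structure IsConnection (D : VF I X → Sec I F E → Sec I F E) : Prop where
  map_add : ∀ Z s t, D Z (s + t) = D Z s + D Z t
  leibniz : ∀ Z (f : Fn I X) s, D Z (f • s) = lieDer Z f • s + f • D Z s
  add_vector : ∀ Z W s, D (Z + W) s = D Z s + D W s
  smul_vector : ∀ f Z s, D (smulVF f Z) s = toFn f • D Z s

/-- The curvature of a connection. -/
def curvature (D : VF I X → Sec I F E → Sec I F E) (Z W : VF I X) (s : Sec I F E) : Sec I F E :=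
  D Z (D W s) - D W (D Z s) - D (bracket Z W) s

/-- The `k`-th exterior power of the curvature `F_D = (d^D)²`, applied to a section. -/
def curvaturePow (D : VF I X → Sec I F E → Sec I F E) :
    (k : ℕ) → Sec I F E → (Fin (2 * k) → VF I X) → Sec I F E
  | 0, s => fun _ => s
  | k + 1, s => ceDiff bracket D (ceDiff bracket D (curvaturePow D k s))

/-- The form `1 / (k! (-2πi)ᵏ) Tr(F_D^k)`, which represents the component of degree `2 k` of the
Chern character of `E`. -/
def chernWeil (D : VF I X → Sec I F E → Sec I F E) (k : ℕ) : (Fin (2 * k) → VF I X) → Fn I X :=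
  fun v => constFn (chernConst k) * trace fun s => curvaturePow D k s v

/-- `σ` is a splitting of the projection `J(E) → E`, linear over the functions on the base. -/
structure IsSplitting (σ : Sec I F E → JetE I F E) : Prop where
  map_add : ∀ s t, σ (s + t) = σ s + σ t
  map_smul : ∀ (f : Fn I X) s, σ (f • s) = pr₁ f • σ s
  value_eq : ∀ s, value (σ s) = s

/-- `nab` is the connection `∇_σ` on `J(E)` along the jet direction: a connection over the de Rham
algebra of jets, with `∇_σ (j • σ s) = d_dR j • σ s`. -/
structure IsSplittingConnection (σ : Sec I F E → JetE I F E)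
    (nab : VF I X → JetE I F E → JetE I F E) : Prop where
  map_add : ∀ Z m m', nab Z (m + m') = nab Z m + nab Z m'
  leibniz : ∀ Z (j : Jet I X) m, nab Z (j • m) = act₂ Z j • m + j • nab Z m
  add_vector : ∀ Z W m, nab (Z + W) m = nab Z m + nab W m
  smul_vector : ∀ f Z m, nab (smulVF f Z) m = pr₂ (toFn f) • nab Z m
  apply_splitting : ∀ Z (j : Jet I X) s, nab Z (j • σ s) = act₂ Z j • σ s

/-- The differential of `Ω_X^*(Ω_𝔍^*(J(E)))` that comes from the flat connection of `J(E)`. -/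
def dBaseE {n : ℕ} (θ : (Fin n → VF I X × VF I X) → JetE I F E) :
    (Fin (n + 1) → VF I X × VF I X) → JetE I F E :=
  ceDiff br₁ (fun v => actE₁ v.1) θ

/-- The extension of `nab` to `Ω_X^*(Ω_𝔍^*(J(E)))`. -/
def covDeriv (nab : VF I X → JetE I F E → JetE I F E) {n : ℕ}
    (θ : (Fin n → VF I X × VF I X) → JetE I F E) : (Fin (n + 1) → VF I X × VF I X) → JetE I F E :=
  ceDiff br₂ (fun v => nab v.2) θ

/-- The Atiyah class of `nab`, the (graded) commutator of `nab` with the differential of the de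
Rham complex of `J(E)`, as an operator on `Ω_X^*(Ω_𝔍^*(J(E)))`. -/
def atiyah (nab : VF I X → JetE I F E → JetE I F E) {n : ℕ}
    (θ : (Fin n → VF I X × VF I X) → JetE I F E) :
    (Fin (n + 1 + 1) → VF I X × VF I X) → JetE I F E :=
  covDeriv nab (dBaseE θ) + dBaseE (covDeriv nab θ)

/-- The `k`-th exterior power of the Atiyah class, applied to an element of `J(E)`. -/
def atiyahPow (nab : VF I X → JetE I F E → JetE I F E) :
    (k : ℕ) → JetE I F E → (Fin (2 * k) → VF I X × VF I X) → JetE I F E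
  | 0, m => fun _ => m
  | k + 1, m => atiyah nab (atiyahPow nab k m)

/-- The form `1 / (k! (-2πi)ᵏ) Tr(α^k)`, where `α` is the Atiyah class of `nab`. -/
def chernJet (nab : VF I X → JetE I F E → JetE I F E) (k : ℕ) :
    (Fin (2 * k) → VF I X × VF I X) → Jet I X :=
  fun v => pr₁ (constFn (chernConst k)) * trace fun m => atiyahPow nab k m v

/-- The operator `s ↦ q (nab (j s))`, with `j` the jet prolongation and `q : J(E) → E`. -/
def inducedConnection (nab : VF I X → JetE I F E → JetE I F E) (Z : VF I X) (s : Sec I F E) :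
    Sec I F E :=
  value (nab Z (jetProlong s))

end Chern

end

end JetChern

/-! The operators `d` and `∇_σ` are the two halves of one connection `d + ∇_σ` on `J(E)`, taken
along pairs `(Y, Z)` of vector fields, where `Y` moves the base point `x` and `Z` acts in the jet
direction `y`. Since `d² = 0` and `∇_σ² = 0`, the curvature of this total connection is `d∇_σ + ∇_σ
d`, the Atiyah class (`IsSplittingConnection.curvature_eq`). The statements about `ω_k` are then
Chern–Weil theory.

The connection `∇_σ`. On a local frame of `E` the splitting `σ` is given by a matrix of jets,
relative to the prolonged frame. On the diagonal this matrix is the identity up to a cutoff factor,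
so Cramer's rule makes the sections `σ(s)` local generators of `J(E)` (`Frame.splitBasis`). A
derivation with a given symbol is determined by its values on generators, and local derivations glue
because jets are concentrated on the diagonal and partitions of unity exist. This gives existence
and uniqueness. The same principle gives flatness: the curvature is linear and kills every `σ(s)`.

Closedness. From `d² = 0` and `∇_σ² = 0` it follows that `α_E` commutes with `d` and with `∇_σ`
separately. The trace turns the commutator with a derivation into the derivative of the trace
(`IsTrace.commutator`, `IsTrace.diff`), so `Tr(α_E^k)` is closed for both differentials.

The class. A connection `D` on `E` prolongs to a connection `Δ` on `J(E)` with `Δ(j s) = j(D s)`. As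
`d` kills prolongations, the total connection `d + Δ` has the prolonged curvature of `D`, and its
Chern form is `J(ch_k(D))` (`trForm_prolong`). The total connections `d + Δ` and `d + ∇_σ` have the
same symbol, hence differ by a one-form with values in endomorphisms, and transgression makes the
difference of their Chern forms exact (`HasTrace.exists_transgression`). On the diagonal, `q`
intertwines `d + ∇_σ` along `(Z, Z)` with the induced connection on `E` (`value_actE₁_add`).
Therefore `F` is the constant part of `α_E`, and the restriction of `ω_k` is the Chern form of the
induced connection; the last claim is the classical comparison of two connections on `E`.

Both Chern–Weil arguments, on `X` and on jets, are instances of one algebraic version. Forms of all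
degrees are alternating functions on lists, the differential is given by Cartan's recursion `ι_v d =
L_v - d ι_v`, and identities between operators are proved by contracting until degree zero is
reached. The relation `Rel x' x a`, meaning `x' = a x`, accounts for vectors being scaled only by
certain scalars: real functions on `X`, and for pairs functions of `x` on the first component and of
`y` on the second. -/

namespace JetChern
noncomputable section

set_option linter.unusedSectionVars false

/-! ### Alternating cochains on lists and Cartan's recursion. -/

section Cochains
variable {S L N : Type*} [CommRing S] [AddCommGroup L] [AddCommGroup N] [Module S N]

/-- The sum of the values of a cochain at the lists that arise by applying `b` to one entry. -/
def slotSum (b : L → L) : List L → (List L → N) → N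
  | [], _ => 0
  | x :: w, θ => θ (b x :: w) + slotSum b w fun u => θ (x :: u)

/-- The Lie derivative of a cochain. -/
def lieList (br : L → L → L) (D : L → N → N) (v : L) (θ : List L → N) : List L → N :=
  fun w => D v (θ w) - slotSum (br v) w θ

/-- The Chevalley–Eilenberg differential on cochains of all degrees, by Cartan's recursion. -/
def ceList (br : L → L → L) (D : L → N → N) : List L → (List L → N) → N
  | [], _ => 0
  | x :: w, θ => lieList br D x θ w - ceList br D w fun u => θ (x :: u)

/-- The product of a cochain with the differential of a scalar. -/
def dMul (ρ : L → S → S) (a : S) : List L → (List L → N) → N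
  | [], _ => 0
  | x :: w, θ => ρ x a • θ w - dMul ρ a w fun u => θ (x :: u)

/-- Alternating multilinear cochains, where the linearity is with respect to a relation
`Rel x' x a`, to be thought of as `x' = a x`. -/
structure IsAltForm (Rel : L → L → S → Prop) (θ : List L → N) : Prop where
  add : ∀ l x y r, θ (l ++ (x + y) :: r) = θ (l ++ x :: r) + θ (l ++ y :: r)
  alt : ∀ l x r, θ (l ++ x :: x :: r) = 0
  smul : ∀ l r x' x a, Rel x' x a → θ (l ++ x' :: r) = a • θ (l ++ x :: r)

variable {Rel : L → L → S → Prop} {θ θ' : List L → N}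

namespace IsAltForm

theorem cons (h : IsAltForm Rel θ) (v : L) : IsAltForm Rel fun u => θ (v :: u) :=
  ⟨fun l => h.add (v :: l), fun l => h.alt (v :: l), fun l => h.smul (v :: l)⟩

theorem plus (h : IsAltForm Rel θ) (h' : IsAltForm Rel θ') : IsAltForm Rel (θ + θ') where
  add l x y r := by simp only [Pi.add_apply, h.add, h'.add]; abel
  alt l x r := by simp only [Pi.add_apply, h.alt, h'.alt, add_zero]
  smul l r x' x a hr := by simp only [Pi.add_apply, h.smul _ _ _ _ _ hr, h'.smul _ _ _ _ _ hr, smul_add]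

theorem zero : IsAltForm Rel (0 : List L → N) :=
  ⟨fun _ _ _ _ => (add_zero _).symm, fun _ _ _ => rfl, fun _ _ _ _ _ _ => (smul_zero _).symm⟩

theorem neg (h : IsAltForm Rel θ) : IsAltForm Rel (-θ) where
  add l x y r := by simp only [Pi.neg_apply, h.add]; abel
  alt l x r := by simp only [Pi.neg_apply, h.alt, neg_zero]
  smul l r x' x a hr := by simp only [Pi.neg_apply, h.smul _ _ _ _ _ hr, smul_neg]

theorem smul_left (h : IsAltForm Rel θ) (c : S) : IsAltForm Rel (c • θ) where
  add l x y r := by simp only [Pi.smul_apply, h.add, smul_add]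
  alt l x r := by simp only [Pi.smul_apply, h.alt, smul_zero]
  smul l r x' x a hr := by
    simp only [Pi.smul_apply, h.smul _ _ _ _ _ hr]
    rw [smul_comm]

theorem map_zero (h : IsAltForm Rel θ) (l r : List L) : θ (l ++ 0 :: r) = 0 := by
  have := h.add l 0 0 r
  rwa [add_zero, left_eq_add] at this

theorem map_neg (h : IsAltForm Rel θ) (l r : List L) (x : L) :
    θ (l ++ (-x) :: r) = -θ (l ++ x :: r) := by
  rw [eq_neg_iff_add_eq_zero, ← h.add, neg_add_cancel, h.map_zero]

theorem map_sub (h : IsAltForm Rel θ) (l r : List L) (x y : L) :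
    θ (l ++ (x - y) :: r) = θ (l ++ x :: r) - θ (l ++ y :: r) := by
  rw [sub_eq_add_neg, h.add, h.map_neg, sub_eq_add_neg]

theorem swap (h : IsAltForm Rel θ) (l r : List L) (x y : L) :
    θ (l ++ x :: y :: r) = -θ (l ++ y :: x :: r) := by
  have h1 := h.alt l (x + y) r
  have h2 := h.add (l ++ [x]) x y r
  have h3 := h.add (l ++ [y]) x y r
  simp only [List.append_assoc, List.singleton_append] at h2 h3
  rw [h.add, h2, h3, h.alt, h.alt, zero_add, add_zero] at h1
  exact eq_neg_of_add_eq_zero_left h1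

theorem move (h : IsAltForm Rel θ) (l m r : List L) (x : L) :
    θ (l ++ x :: (m ++ r)) = (-1 : ℤ) ^ m.length • θ (l ++ m ++ x :: r) := by
  induction m generalizing l with
  | nil => simp
  | cons y m ih =>
    rw [List.cons_append, h.swap]
    have := ih (l ++ [y])
    simp only [List.append_assoc, List.singleton_append] at this
    rw [this, List.length_cons, pow_succ]
    simp

theorem eq_zero (h : IsAltForm Rel θ) (l m r : List L) (x : L) :
    θ (l ++ x :: (m ++ x :: r)) = 0 := by
  rw [h.move, List.append_assoc]
  have := h.alt (l ++ m) x r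
  simp only [List.append_assoc] at this
  rw [this, smul_zero]

end IsAltForm

theorem slotSum_add (b : L → L) (w : List L) (θ θ' : List L → N) :
    slotSum b w (θ + θ') = slotSum b w θ + slotSum b w θ' := by
  induction w generalizing θ θ' with
  | nil => simp [slotSum]
  | cons x w ih =>
    have := ih (fun u => θ (x :: u)) (fun u => θ' (x :: u))
    simp only [slotSum]
    change _ + slotSum b w ((fun u => θ (x :: u)) + fun u => θ' (x :: u)) = _
    rw [this, Pi.add_apply]
    abel

theorem slotSum_zero (b : L → L) (w : List L) : slotSum b w (0 : List L → N) = 0 := by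
  have := slotSum_add b w (0 : List L → N) 0
  rwa [add_zero, left_eq_add] at this

theorem slotSum_neg (b : L → L) (w : List L) (θ : List L → N) :
    slotSum b w (-θ) = -slotSum b w θ := by
  rw [eq_neg_iff_add_eq_zero, ← slotSum_add, neg_add_cancel, slotSum_zero]

theorem slotSum_sub (b : L → L) (w : List L) (θ θ' : List L → N) :
    slotSum b w (θ - θ') = slotSum b w θ - slotSum b w θ' := by
  rw [sub_eq_add_neg, slotSum_add, slotSum_neg, sub_eq_add_neg]

theorem slotSum_map {N' : Type*} [AddCommGroup N'] (g : N →+ N') (b : L → L) (w : List L)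
    (θ : List L → N) : slotSum b w (fun u => g (θ u)) = g (slotSum b w θ) := by
  induction w generalizing θ with
  | nil => simp [slotSum]
  | cons x w ih => simp only [slotSum, map_add, ih]

theorem slotSum_smul (a : S) (b : L → L) (w : List L) (θ : List L → N) :
    slotSum b w (a • θ) = a • slotSum b w θ :=
  slotSum_map (DistribSMul.toAddMonoidHom N a) b w θ

theorem slotSum_append (b : L → L) (l r : List L) (θ : List L → N) :
    slotSum b (l ++ r) θ =
      slotSum b l (fun u => θ (u ++ r)) + slotSum b r (fun u => θ (l ++ u)) := by
  induction l generalizing θ with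
  | nil => simp [slotSum]
  | cons x l ih => simp only [slotSum, List.cons_append, ih, add_assoc]

theorem slotSum_insert (b : L → L) (l r : List L) (z : L) (θ : List L → N) :
    slotSum b (l ++ z :: r) θ = slotSum b l (fun u => θ (u ++ z :: r)) + θ (l ++ b z :: r) +
      slotSum b r (fun u => θ (l ++ z :: u)) := by
  rw [slotSum_append, slotSum, add_assoc]

theorem IsAltForm.slotSum_add_left (h : IsAltForm Rel θ) (b b' : L → L) (w : List L) :
    slotSum (b + b') w θ = slotSum b w θ + slotSum b' w θ := by
  induction w generalizing θ with
  | nil => simp [slotSum]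
  | cons x w ih =>
    have := h.add [] (b x) (b' x) w
    simp only [List.nil_append] at this
    simp only [slotSum, ih (h.cons x), Pi.add_apply, this]
    abel

theorem IsAltForm.slotSum_zero_left (h : IsAltForm Rel θ) (w : List L) :
    slotSum (0 : L → L) w θ = 0 := by
  have := h.slotSum_add_left 0 0 w
  rwa [add_zero, left_eq_add] at this

/-- Conditions on a bracket, an action on scalars and an operator `D` under which the
Chevalley–Eilenberg differential acts on alternating forms. -/
structure IsConn (Rel : L → L → S → Prop) (br : L → L → L) (ρ : L → S → S) (D : L → N → N) :
    Prop where
  br_add_left : ∀ x y z, br (x + y) z = br x z + br y z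
  br_add_right : ∀ x y z, br x (y + z) = br x y + br x z
  br_self : ∀ x, br x x = 0
  ρ_add : ∀ x a b, ρ x (a + b) = ρ x a + ρ x b
  ρ_mul : ∀ x a b, ρ x (a * b) = ρ x a * b + a * ρ x b
  D_add : ∀ x m m', D x (m + m') = D x m + D x m'
  D_add_left : ∀ x y m, D (x + y) m = D x m + D y m
  leibniz : ∀ x (a : S) m, D x (a • m) = ρ x a • m + a • D x m
  D_rel : ∀ x' x a, Rel x' x a → ∀ m, D x' m = a • D x m
  -- The rule `[a x, w] = a [x, w] - w(a) x` is imposed only after insertion into a form: the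
  -- vectors `L` are not a module over `S`, so the right-hand side need not make sense in `L`.
  br_rel : ∀ x' x a, Rel x' x a → ∀ w (θ : List L → N), IsAltForm Rel θ → ∀ l r,
    θ (l ++ br x' w :: r) = a • θ (l ++ br x w :: r) - ρ w a • θ (l ++ x :: r)

variable {br : L → L → L} {ρ : L → S → S} {D : L → N → N}

theorem dMul_neg (ρ : L → S → S) (a : S) (w : List L) (φ : List L → N) :
    dMul ρ a w (-φ) = -dMul ρ a w φ := by
  induction w generalizing φ with
  | nil => simp [dMul]
  | cons z w ih =>
    have := ih fun u => φ (z :: u)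
    simp only [dMul]
    change _ - dMul ρ a w (-fun u => φ (z :: u)) = _
    rw [this, Pi.neg_apply]
    module

namespace IsConn

theorem br_swap (h : IsConn Rel br ρ D) (x y : L) : br x y = -br y x := by
  have := h.br_self (x + y)
  rw [h.br_add_left, h.br_add_right, h.br_add_right, h.br_self, h.br_self, zero_add,
    add_zero] at this
  exact eq_neg_of_add_eq_zero_left this

/-- `D x` as a homomorphism. -/
def toHom (h : IsConn Rel br ρ D) (x : L) : N →+ N := AddMonoidHom.mk' (D x) (h.D_add x)

theorem D_zero (h : IsConn Rel br ρ D) (x : L) : D x 0 = 0 := (h.toHom x).map_zero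
theorem D_sub (h : IsConn Rel br ρ D) (x : L) (m m' : N) : D x (m - m') = D x m - D x m' :=
  (h.toHom x).map_sub m m'

/-- For linearity, the term `v(a) θ(…, x, …)` that the Leibniz rule of `D v` produces cancels
against the one produced by the bracket `[v, a x]`. -/
theorem isAltForm_lieList (h : IsConn Rel br ρ D) (v : L) (hθ : IsAltForm Rel θ) :
    IsAltForm Rel (lieList br D v θ) where
  add l x y r := by
    have h1 : (fun u => θ (u ++ (x + y) :: r)) =
      (fun u => θ (u ++ x :: r)) + fun u => θ (u ++ y :: r) := funext fun u => hθ.add u x y r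
    have h2 : (fun u => θ (l ++ (x + y) :: u)) =
      (fun u => θ (l ++ x :: u)) + fun u => θ (l ++ y :: u) := funext fun u => hθ.add l x y u
    simp only [lieList, slotSum_insert]
    rw [h1, h2]
    simp only [slotSum_add, hθ.add, h.D_add, h.br_add_right]
    abel
  alt l x r := by
    have h1 : (fun u => θ (u ++ x :: x :: r)) = 0 := funext fun u => hθ.alt u x r
    have h2 : (fun u => θ (l ++ x :: x :: u)) = 0 := funext fun u => hθ.alt l x u
    simp only [lieList, slotSum_insert, slotSum]
    rw [h1, h2, hθ.alt, hθ.swap l r (br v x) x, slotSum_zero, slotSum_zero, h.D_zero]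
    abel
  smul l r x' x a hr := by
    have h1 : (fun u => θ (u ++ x' :: r)) = a • fun u => θ (u ++ x :: r) :=
      funext fun u => hθ.smul u r _ _ _ hr
    have h2 : (fun u => θ (l ++ x' :: u)) = a • fun u => θ (l ++ x :: u) :=
      funext fun u => hθ.smul l u _ _ _ hr
    simp only [lieList, slotSum_insert]
    rw [h1, h2, h.br_swap v x', h.br_swap v x]
    simp only [slotSum_smul, hθ.smul _ _ _ _ _ hr, h.leibniz, hθ.map_neg,
      h.br_rel _ _ _ hr v θ hθ]
    module

theorem ceList_add (h : IsConn Rel br ρ D) (w : List L) (θ θ' : List L → N) :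
    ceList br D w (θ + θ') = ceList br D w θ + ceList br D w θ' := by
  induction w generalizing θ θ' with
  | nil => simp [ceList]
  | cons x w ih =>
    have := ih (fun u => θ (x :: u)) (fun u => θ' (x :: u))
    simp only [ceList, lieList, slotSum_add]
    change _ - ceList br D w ((fun u => θ (x :: u)) + fun u => θ' (x :: u)) = _
    rw [this, Pi.add_apply, h.D_add]
    abel

theorem ceList_zero (h : IsConn Rel br ρ D) (w : List L) :
    ceList br D w (0 : List L → N) = 0 := by
  have := h.ceList_add w (0 : List L → N) 0
  rwa [add_zero, left_eq_add] at this

theorem ceList_smul (h : IsConn Rel br ρ D) (a : S) (w : List L) (θ : List L → N) :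
    ceList br D w (a • θ) = a • ceList br D w θ + dMul ρ a w θ := by
  induction w generalizing θ with
  | nil => simp [ceList, dMul]
  | cons x w ih =>
    have := ih (fun u => θ (x :: u))
    simp only [ceList, lieList, slotSum_smul, dMul]
    change _ - ceList br D w (a • fun u => θ (x :: u)) = _
    rw [this, Pi.smul_apply, h.leibniz]
    module

/-- This is the bracket part of `L_{a x} = a L_x + da ∧ ι_x`. -/
theorem slotSum_rel (h : IsConn Rel br ρ D) {x' x : L} {a : S} (hr : Rel x' x a) (w : List L)
    (hθ : IsAltForm Rel θ) :
    slotSum (br x') w θ + dMul ρ a w (fun u => θ (x :: u)) = a • slotSum (br x) w θ := by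
  induction w generalizing θ with
  | nil => simp [slotSum, dMul]
  | cons y w ih =>
    have h1 := h.br_rel _ _ _ hr y θ hθ [] w
    have h2 := ih (hθ.cons y)
    have h3 : ∀ u, θ (x :: y :: u) = -θ (y :: x :: u) := fun u => hθ.swap [] u x y
    have h4 : dMul ρ a w (fun u => θ (x :: y :: u)) = -dMul ρ a w (fun u => θ (y :: x :: u)) := by
      rw [funext h3]
      exact dMul_neg ρ a w _
    simp only [List.nil_append] at h1
    simp only [slotSum, dMul, h1, h4]
    rw [smul_add, ← h2]
    module

/-- Only the first slot needs an argument, as the others follow by induction along the recursion.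
There, linearity holds because `L_{a x} θ` and `d(a ι_x θ)` both contain the term `da ∧ ι_x θ`,
which drops out of the difference. Alternation holds because the two copies of `L_x ι_x θ` cancel.
-/
theorem isAltForm_ceList (h : IsConn Rel br ρ D) (hθ : IsAltForm Rel θ) :
    IsAltForm Rel fun w => ceList br D w θ where
  add l x y r := by
    induction l generalizing θ with
    | nil =>
      have h1 : (fun u => θ ((x + y) :: u)) = (fun u => θ (x :: u)) + fun u => θ (y :: u) :=
        funext fun u => hθ.add [] x y u
      have h2 : br (x + y) = br x + br y := funext fun u => h.br_add_left x y u
      simp only [List.nil_append, ceList, lieList, h1, h2, hθ.slotSum_add_left, h.ceList_add,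
        h.D_add_left]
      abel
    | cons z l ih =>
      simp only [List.cons_append, ceList, ih (hθ.cons z), (h.isAltForm_lieList z hθ).add]
      abel
  alt l x r := by
    induction l generalizing θ with
    | nil =>
      have h1 : (fun u => θ (x :: x :: u)) = 0 := funext fun u => hθ.alt [] x u
      have h2 := hθ.map_zero [] r
      simp only [List.nil_append] at h2
      simp only [List.nil_append, ceList, lieList, h1, h.ceList_zero, slotSum, h.br_self, h2]
      abel
    | cons z l ih =>
      simp only [List.cons_append, ceList, ih (hθ.cons z), (h.isAltForm_lieList z hθ).alt, sub_zero]
  smul l r x' x a hr := by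
    induction l generalizing θ with
    | nil =>
      have h1 : (fun u => θ (x' :: u)) = a • fun u => θ (x :: u) :=
        funext fun u => hθ.smul [] u _ _ _ hr
      have h2 := h.slotSum_rel hr r hθ
      simp only [List.nil_append, ceList, lieList, h1, h.ceList_smul, h.D_rel _ _ _ hr]
      rw [smul_sub, smul_sub, ← h2]
      module
    | cons z l ih =>
      simp only [List.cons_append, ceList, ih (hθ.cons z),
        (h.isAltForm_lieList z hθ).smul _ _ _ _ _ hr, smul_sub]

end IsConn

/-- Comparison of differentials along a map of Lie algebras and a compatible map of
coefficients. -/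
theorem ceList_comp {L' N' : Type*} [AddCommGroup N'] {br' : L' → L' → L'} {D' : L' → N' → N'}
    (f : L → L') (q : N' →+ N) (hf : ∀ x y, f (br x y) = br' (f x) (f y))
    (hq : ∀ x m, q (D' (f x) m) = D x (q m)) (w : List L) (θ : List L' → N') :
    ceList br D w (fun u => q (θ (u.map f))) = q (ceList br' D' (w.map f) θ) := by
  have h1 : ∀ (x : L) (w : List L) (θ : List L' → N'),
      slotSum (br x) w (fun u => q (θ (u.map f))) = q (slotSum (br' (f x)) (w.map f) θ) := by
    intro x w
    induction w with
    | nil => intro θ; simp [slotSum]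
    | cons y w ih =>
      intro θ
      have := ih (fun u => θ (f y :: u))
      simp only [slotSum, List.map_cons, map_add, hf, this]
  induction w generalizing θ with
  | nil => simp [ceList]
  | cons x w ih =>
    have := ih (fun u => θ (f x :: u))
    simp only [ceList, lieList, List.map_cons, map_sub, h1, hq, this]

end Cochains

/-! ### The alternating-sum formula and Cartan's recursion agree. -/

section Conversion
variable {S L N : Type*} [CommRing S] [AddCommGroup L] [AddCommGroup N] [Module S N]
  {Rel : L → L → S → Prop} {θ : List L → N}

/-- The sign `(-1)ʲ` is the cost of moving the altered entry from slot `j` to the front. -/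
theorem IsAltForm.sum_slots (hθ : IsAltForm Rel θ) (b : L → L) {n : ℕ} (w : Fin (n + 1) → L) :
    ∑ j : Fin (n + 1), (-1 : ℤ) ^ (j : ℕ) •
      θ (b (w j) :: List.ofFn fun l => w (j.succAbove l)) = slotSum b (List.ofFn w) θ := by
  induction n generalizing θ with
  | zero => simp [slotSum]
  | succ n ih =>
    rw [Fin.sum_univ_succ, List.ofFn_succ (f := w), slotSum, ← ih (hθ.cons (w 0)) fun l => w l.succ]
    congr 1
    · simp
    · refine Finset.sum_congr rfl fun j _ => ?_
      rw [List.ofFn_succ]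
      have := hθ.swap [] (List.ofFn fun l : Fin n => w (j.succ.succAbove l.succ)) (b (w j.succ)) (w 0)
      simp only [List.nil_append, Fin.succ_succAbove_succ] at this
      simp only [Fin.succ_succAbove_zero, Fin.val_succ, Fin.succ_succAbove_succ, this, pow_succ]
      simp

/-- The Chevalley–Eilenberg differential satisfies Cartan's recursion. -/
theorem IsAltForm.ceDiff_ofFn (hθ : IsAltForm Rel θ) (br : L → L → L) (D : L → N → N)
    {n : ℕ} (v : Fin (n + 1) → L) :
    ceDiff br D (fun u : Fin n → L => θ (List.ofFn u)) v = ceList br D (List.ofFn v) θ := by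
  induction n generalizing θ with
  | zero => simp [ceDiff, ceList, lieList, slotSum]
  | succ n ih =>
    rw [List.ofFn_succ, ceList, lieList, ← ih (hθ.cons (v 0)) fun l => v l.succ,
      ← hθ.sum_slots (br (v 0)) fun l => v l.succ]
    unfold ceDiff
    -- The terms with `i = 0` make up the Lie derivative along `v 0`. In all others `v 0` stays in
    -- front, so they make up the differential of the contraction with `v 0`, with a sign from the
    -- shift of the indices.
    rw [Fin.sum_univ_succ, Fin.sum_univ_succ (n := n + 1)
      (f := fun i => ∑ j ∈ Finset.Ioi i, (-1 : ℤ) ^ (j : ℕ) •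
        θ (List.ofFn fun l => Function.update v i (br (v i) (v j)) (j.succAbove l)))]
    simp only [Fin.sum_Ioi_zero, Fin.sum_Ioi_succ]
    have h1 : ∀ i : Fin (n + 1), (fun l : Fin (n + 1) => v (i.succ.succAbove l)) =
        Fin.cons (v 0) fun l => v (i.succAbove l).succ := fun i => by
      funext l
      cases l using Fin.cases <;> simp
    have h2 : ∀ i : Fin (n + 1),
        (fun l : Fin (n + 1) => Function.update v 0 (br (v 0) (v i.succ)) (i.succ.succAbove l)) =
        Fin.cons (br (v 0) (v i.succ)) fun l => v (i.succAbove l).succ := fun i => by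
      funext l
      cases l using Fin.cases <;> simp
    have h3 : ∀ i j : Fin (n + 1),
        (fun l : Fin (n + 1) => Function.update v i.succ (br (v i.succ) (v j.succ))
          (j.succ.succAbove l)) =
        Fin.cons (v 0) fun l => Function.update (fun l : Fin (n + 1) => v l.succ) i
          (br (v i.succ) (v j.succ)) (j.succAbove l) := fun i j => by
      funext l
      cases l using Fin.cases <;> simp [Function.update_apply, (Fin.succ_ne_zero i).symm]
    simp only [h1, h2, h3, List.ofFn_cons, Fin.val_succ, pow_succ, mul_neg, mul_one, neg_smul,
      Finset.sum_neg_distrib]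
    simp only [Fin.succAbove_zero, Fin.val_zero, pow_zero, one_smul]
    abel

end Conversion

/-! ### Operators on forms and products with endomorphism-valued forms. -/

section Operators
variable {S L N : Type*} [CommRing S] [AddCommGroup L] [AddCommGroup N] [Module S N]

/-- The group of alternating forms of all degrees. -/
def forms (Rel : L → L → S → Prop) (N : Type*) [AddCommGroup N] [Module S N] :
    AddSubgroup (List L → N) where
  carrier := {θ | IsAltForm Rel θ}
  add_mem' h h' := h.plus h'
  zero_mem' := IsAltForm.zero
  neg_mem' h := h.neg

/-- Additive operators on forms. -/
def Op (Rel : L → L → S → Prop) (N : Type*) [AddCommGroup N] [Module S N] :=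
  AddMonoid.End (forms Rel N)

instance (Rel : L → L → S → Prop) : Ring (Op Rel N) :=
  inferInstanceAs (Ring (AddMonoid.End (forms Rel N)))

instance (Rel : L → L → S → Prop) : FunLike (Op Rel N) (forms Rel N) (forms Rel N) :=
  inferInstanceAs (FunLike (AddMonoid.End (forms Rel N)) _ _)

instance (Rel : L → L → S → Prop) : AddMonoidHomClass (Op Rel N) (forms Rel N) (forms Rel N) :=
  inferInstanceAs (AddMonoidHomClass (AddMonoid.End (forms Rel N)) _ _)

variable {Rel : L → L → S → Prop}

/-- Contraction with a vector. -/
def ins (v : L) : Op Rel N :=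
  AddMonoidHom.mk' (fun θ => ⟨fun u => θ.1 (v :: u), θ.2.cons v⟩) fun _ _ => rfl

/-- A form of degree zero. -/
def single (s : N) : forms Rel N :=
  ⟨fun w => if w = [] then s else 0, by
    constructor <;> intros <;> simp⟩

@[simp] theorem single_nil (s : N) : (single s : forms Rel N).1 [] = s := by
  simp [single]

@[simp] theorem single_cons (s : N) (x : L) (w : List L) :
    (single s : forms Rel N).1 (x :: w) = 0 := by
  simp [single]

@[simp] theorem ins_single (v : L) (s : N) : ins v (single s : forms Rel N) = 0 :=
  by
  refine Subtype.ext <| funext fun w => ?_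
  exact single_cons (Rel := Rel) s v w

theorem op_ext {Φ Φ' : Op Rel N} (h : ∀ θ w, (Φ θ).1 w = (Φ' θ).1 w) : Φ = Φ' :=
  AddMonoidHom.ext fun θ => Subtype.ext <| funext fun w => h θ w

@[simp] theorem op_add_apply (Φ Φ' : Op Rel N) (θ : forms Rel N) (w : List L) :
    ((Φ + Φ') θ).1 w = (Φ θ).1 w + (Φ' θ).1 w := rfl

@[simp] theorem op_zsmul_apply (c : ℤ) (Φ : Op Rel N) (θ : forms Rel N) (w : List L) :
    ((c • Φ) θ).1 w = c • (Φ θ).1 w := rfl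

@[simp] theorem op_zero_apply (θ : forms Rel N) (w : List L) :
    ((0 : Op Rel N) θ).1 w = 0 := rfl

/-- A value on a list is a repeated contraction evaluated on the empty list, so an operator that
commutes with contractions up to a constant is determined by its part of degree zero. -/
theorem eq_zero_of_ins {Φ : Op Rel N} (c : ℤ) (h : ∀ θ, (Φ θ).1 [] = 0)
    (h' : ∀ v, ins v * Φ = c • (Φ * ins v)) : Φ = 0 := by
  refine op_ext fun θ w => ?_
  induction w generalizing θ with
  | nil => exact h θ
  | cons v w ih =>
    have h2 : (Φ θ).1 (v :: w) = c • (Φ (ins v θ)).1 w :=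
      congrArg (fun Ψ : Op Rel N => (Ψ θ).1 w) (h' v)
    rw [h2, ih, op_zero_apply, op_zero_apply, smul_zero]

/-- Operators of wedge product with an `End N`-valued form of degree `p`. -/
def Tens : ℕ → Op Rel N → Prop
  | 0, Φ => ∃ φ : N →ₗ[S] N, ∀ θ w, (Φ θ).1 w = φ (θ.1 w)
  -- The antiderivation rule for contractions: `Ψ v` is the product with the contracted form, of
  -- degree `p`. A product with a form of positive degree has no component of degree zero.
  | p + 1, Φ => (∀ θ, (Φ θ).1 [] = 0) ∧ ∃ Ψ : L → Op Rel N, (∀ v, Tens p (Ψ v)) ∧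
      ∀ v, ins v * Φ = Ψ v + (-1 : ℤ) ^ (p + 1) • (Φ * ins v)

namespace Tens
variable {p q : ℕ} {Φ Φ' : Op Rel N}

theorem zero (p : ℕ) : Tens p (0 : Op Rel N) := by
  induction p with
  | zero => exact ⟨0, fun _ _ => rfl⟩
  | succ p ih => exact ⟨fun _ => rfl, fun _ => 0, fun _ => ih, fun v => by simp⟩

theorem add (h : Tens p Φ) (h' : Tens p Φ') : Tens p (Φ + Φ') := by
  induction p generalizing Φ Φ' with
  | zero =>
    obtain ⟨φ, h⟩ := h
    obtain ⟨φ', h'⟩ := h'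
    exact ⟨φ + φ', fun θ w => by simp [h, h']⟩
  | succ p ih =>
    obtain ⟨h0, Ψ, h1, h2⟩ := h
    obtain ⟨h0', Ψ', h1', h2'⟩ := h'
    refine ⟨fun θ => by simp [h0, h0'], Ψ + Ψ', fun v => ih (h1 v) (h1' v), fun v => ?_⟩
    rw [mul_add, h2, h2', add_mul, smul_add, Pi.add_apply]
    abel

theorem neg (h : Tens p Φ) : Tens p (-Φ) := by
  induction p generalizing Φ with
  | zero =>
    obtain ⟨φ, h⟩ := h
    exact ⟨-φ, fun θ w => congrArg Neg.neg (h θ w)⟩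
  | succ p ih =>
    obtain ⟨h0, Ψ, h1, h2⟩ := h
    refine ⟨fun θ => (congrArg Neg.neg (h0 θ)).trans neg_zero, -Ψ, fun v => ih (h1 v), fun v => ?_⟩
    rw [mul_neg, h2, neg_mul, smul_neg, Pi.neg_apply]
    abel

theorem sub (h : Tens p Φ) (h' : Tens p Φ') : Tens p (Φ - Φ') := by
  rw [sub_eq_add_neg]
  exact h.add h'.neg

theorem sum {ι : Type*} (s : Finset ι) (Φ : ι → Op Rel N) (h : ∀ i ∈ s, Tens p (Φ i)) :
    Tens p (∑ i ∈ s, Φ i) :=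
  Finset.sum_induction _ _ (fun _ _ => add) (zero p) h

theorem one : Tens 0 (1 : Op Rel N) := ⟨LinearMap.id, fun _ _ => rfl⟩

theorem zsmul (c : ℤ) (h : Tens p Φ) : Tens p (c • Φ) := by
  induction p generalizing Φ with
  | zero =>
    obtain ⟨φ, h⟩ := h
    exact ⟨c • φ, fun θ w => by rw [op_zsmul_apply, h]; rfl⟩
  | succ p ih =>
    obtain ⟨h0, Ψ, h1, h2⟩ := h
    refine ⟨fun θ => by rw [op_zsmul_apply, h0, smul_zero], c • Ψ, fun v => ih (h1 v), fun v => ?_⟩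
    rw [mul_smul_comm, h2, smul_mul_assoc, smul_add, Pi.smul_apply, smul_comm c]

theorem ins_comm (h : Tens 0 Φ) (v : L) : ins v * Φ = Φ * ins v := by
  obtain ⟨φ, h⟩ := h
  exact op_ext fun θ w => (h θ (v :: w)).trans (h (ins v θ) w).symm

theorem exists_ins (h : Tens p Φ) (v : L) : ∃ (q : ℕ) (Ψ : Op Rel N), Tens q Ψ ∧
    (-1 : ℤ) ^ q = -(-1 : ℤ) ^ p ∧ ins v * Φ = Ψ + (-1 : ℤ) ^ p • (Φ * ins v) := by
  cases p with
  -- The contraction of a form of degree zero vanishes; it is recorded as a product of degree one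
  -- only so that the parity changes as in all other degrees.
  | zero => exact ⟨1, 0, zero 1, by simp, by simp [h.ins_comm]⟩
  | succ p =>
    obtain ⟨h0, Ψ, h1, h2⟩ := h
    exact ⟨p, Ψ v, h1 v, by rw [pow_succ]; simp, h2 v⟩

/-- The induction is on the total degree because the contraction may fall on either factor. -/
theorem mul (h : Tens p Φ) (h' : Tens q Φ') : Tens (p + q) (Φ * Φ') := by
  obtain ⟨n, hn⟩ : ∃ n, n = p + q := ⟨_, rfl⟩
  rw [← hn]
  induction n generalizing p q Φ Φ' with
  | zero =>
    obtain ⟨rfl, rfl⟩ : p = 0 ∧ q = 0 := by omega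
    obtain ⟨φ, h⟩ := h
    obtain ⟨φ', h'⟩ := h'
    refine ⟨φ.comp φ', fun θ w => ?_⟩
    change (Φ (Φ' θ)).1 w = _
    rw [h, h']
    rfl
  | succ n ih =>
    refine ⟨fun θ => ?_, ?_⟩
    · change (Φ (Φ' θ)).1 [] = 0
      cases p with
      | succ p => exact h.1 _
      | zero =>
        obtain ⟨φ, h⟩ := h
        obtain rfl : q = n + 1 := by omega
        rw [h, h'.1, map_zero]
    · rw [hn]
      cases p with
      | zero =>
        obtain rfl : q = n + 1 := by omega
        obtain ⟨h0, Ψ, h1, h2⟩ := h'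
        refine ⟨fun v => Φ * Ψ v, fun v => ih h (h1 v) (by omega), fun v => ?_⟩
        rw [← mul_assoc, h.ins_comm, mul_assoc, h2, mul_add, mul_smul_comm, mul_assoc, zero_add]
      | succ p =>
        cases q with
        | zero =>
          obtain rfl : p = n := by omega
          obtain ⟨h0, Ψ, h1, h2⟩ := h
          refine ⟨fun v => Ψ v * Φ', fun v => ih (h1 v) h' (by omega), fun v => ?_⟩
          rw [← mul_assoc, h2, add_mul, smul_mul_assoc, mul_assoc Φ, h'.ins_comm, mul_assoc,
            add_zero]
        | succ q =>
          have ha := h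
          have hb := h'
          obtain ⟨h0, Ψ, h1, h2⟩ := h
          obtain ⟨h0', Ψ', h1', h2'⟩ := h'
          refine ⟨fun v => Ψ v * Φ' + (-1 : ℤ) ^ (p + 1) • (Φ * Ψ' v),
            fun v => (ih (h1 v) hb (by omega)).add
              (zsmul _ (ih ha (h1' v) (by omega))), fun v => ?_⟩
          rw [← mul_assoc, h2, add_mul, smul_mul_assoc, mul_assoc Φ, h2', mul_add, smul_add,
            mul_smul_comm, smul_smul, ← pow_add, mul_assoc, add_assoc, add_assoc]

theorem pow (h : Tens p Φ) (k : ℕ) : Tens (p * k) (Φ ^ k) := by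
  induction k with
  | zero => exact one
  | succ k ih => exact pow_succ Φ k ▸ ih.mul h

/-- Members of `Op` are merely additive, so that differentials are among them. Linearity over `S`
distinguishes products with forms and gives them endomorphisms as values. -/
theorem map_smul (h : Tens p Φ) (c : S) (θ θ' : forms Rel N) (hc : θ'.1 = c • θ.1) (w : List L) :
    (Φ θ').1 w = c • (Φ θ).1 w := by
  induction w generalizing p Φ θ θ' with
  | nil =>
    cases p with
    | zero =>
      obtain ⟨φ, h⟩ := h
      rw [h, h, hc, Pi.smul_apply, φ.map_smul]
    | succ p => rw [h.1, h.1, smul_zero]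
  | cons v w ih =>
    obtain ⟨q, Ψ, h1, -, h2⟩ := h.exists_ins v
    have h3 : ∀ θ, (Φ θ).1 (v :: w) = (Ψ θ).1 w + (-1 : ℤ) ^ p • (Φ (ins v θ)).1 w := fun θ =>
      congrArg (fun Ψ : Op Rel N => (Ψ θ).1 w) h2
    rw [h3, h3, ih h1 θ θ' hc, ih h (ins v θ) (ins v θ') (funext fun u => congrFun hc (v :: u)),
      smul_add, smul_comm c]

/-- The endomorphism that arises from a form with values in endomorphisms. -/
def toEnd (h : Tens p Φ) (w : List L) : N →ₗ[S] N where
  toFun s := (Φ (single s)).1 w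
  map_add' s t := by
    have : (single (s + t) : forms Rel N) = single s + single t :=
      Subtype.ext <| funext fun w => by cases w <;> simp
    rw [this, map_add]
    rfl
  map_smul' c s := h.map_smul c _ _ (funext fun w => by cases w <;> simp) w

end Tens

variable {br : L → L → L} {ρ : L → S → S} {D : L → N → N}

namespace IsConn

/-- The differential as an operator on forms. -/
def diff (h : IsConn Rel br ρ D) : Op Rel N :=
  AddMonoidHom.mk' (fun θ => ⟨fun w => ceList br D w θ.1, h.isAltForm_ceList θ.2⟩)
    fun θ θ' => Subtype.ext <| funext fun w => h.ceList_add w θ.1 θ'.1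

theorem diff_apply (h : IsConn Rel br ρ D) (θ : forms Rel N) (w : List L) :
    (h.diff θ).1 w = ceList br D w θ.1 := rfl

/-- The Lie derivative as an operator on forms. -/
def lie (h : IsConn Rel br ρ D) (v : L) : Op Rel N :=
  AddMonoidHom.mk' (fun θ => ⟨lieList br D v θ.1, h.isAltForm_lieList v θ.2⟩)
    fun θ θ' => Subtype.ext <| funext fun w => by
      change lieList br D v (θ.1 + θ'.1) w = lieList br D v θ.1 w + lieList br D v θ'.1 w
      simp only [lieList, slotSum_add, Pi.add_apply, h.D_add]
      abel

theorem lie_apply (h : IsConn Rel br ρ D) (v : L) (θ : forms Rel N) (w : List L) :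
    (h.lie v θ).1 w = D v (θ.1 w) - slotSum (br v) w θ.1 := rfl

/-- Cartan's formula, which is the definition of `ceList`. -/
theorem ins_diff (h : IsConn Rel br ρ D) (v : L) : ins v * h.diff = h.lie v - h.diff * ins v :=
  op_ext fun _ _ => rfl

theorem ins_lie (h : IsConn Rel br ρ D) (v w : L) :
    ins w * h.lie v = h.lie v * ins w - ins (br v w) := by
  refine op_ext fun θ u => ?_
  change D v (θ.1 (w :: u)) - (θ.1 (br v w :: u) + slotSum (br v) u fun u => θ.1 (w :: u)) =
    D v (θ.1 (w :: u)) - (slotSum (br v) u fun u => θ.1 (w :: u)) - θ.1 (br v w :: u)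
  abel

theorem lie_single (h : IsConn Rel br ρ D) (v : L) (s : N) : h.lie v (single s) = single (D v s) := by
  refine Subtype.ext <| funext fun w => ?_
  rw [h.lie_apply]
  cases w with
  | nil => simp [slotSum]
  | cons x w =>
    have : (fun u => (single s : forms Rel N).1 (x :: u)) = 0 := funext fun u => single_cons s x u
    rw [slotSum, this, slotSum_zero]
    simp [h.D_zero]

/-- Terms that alter two different slots cancel. Those that alter one slot twice leave a commutator,
in reversed order because cochains are contravariant in their arguments. -/
theorem slotSum_comm {θ : List L → N} (hθ : IsAltForm Rel θ) (b c : L → L) (w : List L) :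
    slotSum b w (fun u => slotSum c u θ) - slotSum c w (fun u => slotSum b u θ) =
      slotSum (fun x => c (b x) - b (c x)) w θ := by
  induction w generalizing θ with
  | nil => simp [slotSum]
  | cons x w ih =>
    have h1 : ∀ b c : L → L, slotSum b w (fun u => slotSum c (x :: u) θ) =
        slotSum b w (fun u => θ (c x :: u)) +
          slotSum b w fun u => slotSum c u fun u => θ (x :: u) := fun b c =>
      slotSum_add b w (fun u => θ (c x :: u)) fun u => slotSum c u fun u => θ (x :: u)
    have h2 := hθ.map_sub [] w (c (b x)) (b (c x))
    simp only [List.nil_append] at h2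
    have h3 : ∀ (b : L → L) x (θ : List L → N), slotSum b (x :: w) θ =
        θ (b x :: w) + slotSum b w fun u => θ (x :: u) := fun _ _ _ => rfl
    rw [h3, h3, h3, h1, h1, h3, h3, h2, ← ih (hθ.cons x)]
    abel

/-- By the Jacobi identity the actions on the arguments cancel, and only the curvature on the
coefficients is left. -/
theorem lie_comm (h : IsConn Rel br ρ D)
    (jac : ∀ x y z, br x (br y z) = br (br x y) z + br y (br x z)) (v w : L) (θ : forms Rel N)
    (u : List L) :
    ((h.lie v * h.lie w - h.lie w * h.lie v - h.lie (br v w)) θ).1 u =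
      D v (D w (θ.1 u)) - D w (D v (θ.1 u)) - D (br v w) (θ.1 u) := by
  have h1 : ∀ v w, slotSum (br v) u (lieList br D w θ.1) = D w (slotSum (br v) u θ.1) -
      slotSum (br v) u fun u => slotSum (br w) u θ.1 := fun v w => by
    change slotSum (br v) u ((fun u => h.toHom w (θ.1 u)) - fun u => slotSum (br w) u θ.1) = _
    rw [slotSum_sub, slotSum_map]
    rfl
  have h2 := slotSum_comm θ.2 (br v) (br w) u
  have h3 : (fun x => br w (br v x) - br v (br w x)) = fun x => -br (br v w) x := by
    funext x
    rw [jac v w x]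
    abel
  have h4 : slotSum (fun x => -br (br v w) x) u θ.1 = -slotSum (br (br v w)) u θ.1 := by
    rw [eq_neg_iff_add_eq_zero, ← θ.2.slotSum_add_left]
    convert θ.2.slotSum_zero_left u using 2
    funext x
    simp
  rw [h3, h4] at h2
  change D v (D w (θ.1 u) - slotSum (br w) u θ.1) - slotSum (br v) u (lieList br D w θ.1) -
    (D w (D v (θ.1 u) - slotSum (br v) u θ.1) - slotSum (br w) u (lieList br D v θ.1)) -
    (D (br v w) (θ.1 u) - slotSum (br (br v w)) u θ.1) = _
  rw [h1, h1, h.D_sub, h.D_sub, ← sub_eq_zero]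
  rw [← sub_eq_zero] at h2
  refine Eq.trans ?_ h2
  abel

theorem ins_diff_sq (h : IsConn Rel br ρ D) (v : L) : ins v * (h.diff * h.diff) =
    (h.lie v * h.diff - h.diff * h.lie v) + h.diff * h.diff * ins v := by
  rw [← mul_assoc, ins_diff, sub_mul, mul_assoc h.diff, ins_diff]
  noncomm_ring

theorem ins_lie_diff (h : IsConn Rel br ρ D) (v w : L) :
    ins w * (h.lie v * h.diff - h.diff * h.lie v) =
      (h.lie v * h.lie w - h.lie w * h.lie v - h.lie (br v w)) -
        (h.lie v * h.diff - h.diff * h.lie v) * ins w := by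
  rw [mul_sub, ← mul_assoc, ← mul_assoc, ins_diff, ins_lie, sub_mul, sub_mul, mul_assoc (h.lie v),
    ins_diff, ins_diff, mul_assoc h.diff (ins w), ins_lie]
  noncomm_ring

/-- The square of the covariant differential is the product with the curvature. -/
theorem tens_diff_sq (h : IsConn Rel br ρ D)
    (jac : ∀ x y z, br x (br y z) = br (br x y) z + br y (br x z))
    (curv : ∀ v w, ∃ R : N →ₗ[S] N, ∀ m, D v (D w m) - D w (D v m) - D (br v w) m = R m) :
    Tens 2 (h.diff * h.diff) := by
  -- The contraction of `d²` with `v` is `[L_v, d]`; contracting once more with `w` gives `[L_v,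
  -- L_w] - L_{[v, w]}`, the product with the endomorphism `R(v, w)`.
  refine ⟨fun θ => rfl, fun v => h.lie v * h.diff - h.diff * h.lie v, fun v => ⟨fun θ => ?_,
    fun w => h.lie v * h.lie w - h.lie w * h.lie v - h.lie (br v w), fun w => ?_, fun w => ?_⟩,
    fun v => ?_⟩
  · change D v 0 - 0 - 0 = 0
    rw [h.D_zero, sub_zero, sub_zero]
  · obtain ⟨R, hR⟩ := curv v w
    exact ⟨R, fun θ u => by rw [h.lie_comm jac, hR]⟩
  · rw [ins_lie_diff]
    simp [sub_eq_add_neg]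
  · rw [ins_diff_sq]
    simp

theorem diff_sq_eq_zero (h : IsConn Rel br ρ D)
    (jac : ∀ x y z, br x (br y z) = br (br x y) z + br y (br x z))
    (curv : ∀ v w m, D v (D w m) - D w (D v m) = D (br v w) m) : h.diff * h.diff = 0 := by
  -- `d²` commutes with contractions up to `[L_v, d]`, and `[L_v, d]` anticommutes with them up to
  -- the curvature, which is zero.
  refine eq_zero_of_ins 1 (fun θ => rfl) fun v => ?_
  rw [ins_diff_sq, one_smul, add_eq_right]
  refine eq_zero_of_ins (-1) (fun θ => ?_) fun w => ?_
  · change D v 0 - 0 - 0 = 0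
    rw [h.D_zero, sub_zero, sub_zero]
  · have : h.lie v * h.lie w - h.lie w * h.lie v - h.lie (br v w) = 0 :=
      op_ext fun θ u => by rw [h.lie_comm jac, curv, sub_self]; rfl
    rw [ins_lie_diff, this]
    simp

/-- All conditions are additive in bracket, symbol and operator together. This serves to add
connections in complementary directions, as in `d + ∇_σ`, and to add a one-form with values in
endomorphisms, whose bracket and symbol are zero. -/
theorem plus (h : IsConn Rel br ρ D) {br' : L → L → L} {ρ' : L → S → S} {D' : L → N → N}
    (h' : IsConn Rel br' ρ' D') : IsConn Rel (br + br') (ρ + ρ') (D + D') where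
  br_add_left x y z := by simp only [Pi.add_apply, h.br_add_left, h'.br_add_left]; abel
  br_add_right x y z := by simp only [Pi.add_apply, h.br_add_right, h'.br_add_right]; abel
  br_self x := by simp only [Pi.add_apply, h.br_self, h'.br_self, add_zero]
  ρ_add x a b := by simp only [Pi.add_apply, h.ρ_add, h'.ρ_add]; abel
  ρ_mul x a b := by simp only [Pi.add_apply, h.ρ_mul, h'.ρ_mul]; ring
  D_add x m m' := by simp only [Pi.add_apply, h.D_add, h'.D_add]; abel
  D_add_left x y m := by simp only [Pi.add_apply, h.D_add_left, h'.D_add_left]; abel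
  leibniz x a m := by simp only [Pi.add_apply, h.leibniz, h'.leibniz]; module
  D_rel x' x a hr m := by simp only [Pi.add_apply, h.D_rel _ _ _ hr, h'.D_rel _ _ _ hr, smul_add]
  br_rel x' x a hr w θ hθ l r := by
    simp only [Pi.add_apply, hθ.add, h.br_rel _ _ _ hr w θ hθ, h'.br_rel _ _ _ hr w θ hθ]
    module

theorem _root_.JetChern.IsAltForm.ceList_add_left {θ : List L → N} (hθ : IsAltForm Rel θ)
    (br br' : L → L → L) (D D' : L → N → N) (w : List L) :
    ceList (br + br') (D + D') w θ = ceList br D w θ + ceList br' D' w θ := by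
  induction w generalizing θ with
  | nil => simp [ceList]
  | cons x w ih =>
    simp only [ceList, lieList, ih (hθ.cons x), Pi.add_apply, hθ.slotSum_add_left]
    abel

theorem diff_plus (h : IsConn Rel br ρ D) {br' : L → L → L} {ρ' : L → S → S} {D' : L → N → N}
    (h' : IsConn Rel br' ρ' D') : (h.plus h').diff = h.diff + h'.diff :=
  op_ext fun θ w => θ.2.ceList_add_left br br' D D' w

/-- The product with a form of degree one with values in endomorphisms. -/
theorem ofLinear (A : L → N →ₗ[S] N) (hadd : ∀ x y, A (x + y) = A x + A y)
    (hrel : ∀ x' x a, Rel x' x a → A x' = a • A x) :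
    IsConn Rel (0 : L → L → L) (0 : L → S → S) (fun x m => A x m) where
  br_add_left _ _ _ := (add_zero _).symm
  br_add_right _ _ _ := (add_zero _).symm
  br_self _ := rfl
  ρ_add _ _ _ := (add_zero _).symm
  ρ_mul _ _ _ := by simp
  D_add x m m' := map_add _ _ _
  D_add_left x y m := by rw [hadd]; rfl
  leibniz x a m := by simp
  D_rel x' x a hr m := by rw [hrel _ _ _ hr]; rfl
  br_rel x' x a hr w θ hθ l r := by simp [hθ.map_zero]

/-- Without a bracket the Lie derivative along `v` just applies the endomorphism `D v` to the
values, so the differential is the product with the one-form `v ↦ D v`. -/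
theorem tens_diff_of_bracket_eq_zero (h : IsConn Rel (0 : L → L → L) (0 : L → S → S) D) :
    Tens 1 h.diff := by
  refine ⟨fun θ => rfl, h.lie, fun v => ⟨⟨⟨D v, h.D_add v⟩, fun a m => ?_⟩, fun θ w => ?_⟩,
    fun v => ?_⟩
  · change D v (a • m) = a • D v m
    rw [h.leibniz]
    simp
  · rw [h.lie_apply]
    change _ - slotSum (0 : L → L) w θ.1 = D v _
    rw [θ.2.slotSum_zero_left, sub_zero]
  · rw [ins_diff]
    simp [sub_eq_add_neg]

end IsConn
end Operators

/-! ### Traces defined by local dual bases, and their differentials. -/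

section Trace
variable {S N : Type*} [CommRing S] [AddCommGroup N] [Module S N]

namespace IsTrace
variable {φ ψ : N → N} {t u : S}

theorem zero : IsTrace (fun _ : N => 0) (0 : S) := fun χ r e e' _ => by simp

theorem add (h : IsTrace φ t) (h' : IsTrace ψ u) : IsTrace (fun m => φ m + ψ m) (t + u) :=
  fun χ r e e' he => by
    simp only [map_add, Finset.sum_add_distrib, mul_add, h χ r e e' he, h' χ r e e' he]

theorem smul (c : S) (h : IsTrace φ t) : IsTrace (fun m => c • φ m) (c * t) :=
  fun χ r e e' he => by
    simp only [map_smul, smul_eq_mul, ← Finset.mul_sum, ← h χ r e e' he]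
    ring

theorem neg (h : IsTrace φ t) : IsTrace (fun m => -φ m) (-t) := by
  simpa using h.smul (-1)

theorem sub (h : IsTrace φ t) (h' : IsTrace ψ u) : IsTrace (fun m => φ m - ψ m) (t - u) := by
  simpa only [sub_eq_add_neg] using h.add h'.neg

theorem sum {ι : Type*} (s : Finset ι) (φ : ι → N → N) (t : ι → S)
    (h : ∀ i ∈ s, IsTrace (φ i) (t i)) : IsTrace (fun m => ∑ i ∈ s, φ i m) (∑ i ∈ s, t i) := by
  classical
  induction s using Finset.induction_on with
  | empty => simpa using zero
  | insert a s ha ih =>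
    simp only [Finset.sum_insert ha]
    exact (h a (Finset.mem_insert_self _ _)).add
      (ih fun i hi => h i (Finset.mem_insert_of_mem hi))

/-- The trace of the commutator with a derivation is the derivative of the trace. -/
theorem commutator {ρ : S → S} {D : N → N} (ρ_add : ∀ a b, ρ (a + b) = ρ a + ρ b)
    (ρ_mul : ∀ a b, ρ (a * b) = ρ a * b + a * ρ b) (D_add : ∀ m m', D (m + m') = D m + D m')
    (leibniz : ∀ (a : S) m, D (a • m) = ρ a • m + a • D m) (h : IsTrace φ t) :
    IsTrace (fun m => D (φ m) - φ (D m)) (ρ t) := by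
  intro χ r e e' he
  let ρ' : S →+ S := AddMonoidHom.mk' ρ ρ_add
  let D' : N →+ N := AddMonoidHom.mk' D D_add
  -- The derivative of the covector `e' i`. It is linear because the symbol terms of `ρ` and of `D`
  -- cancel.
  let f : Fin r → N →ₗ[S] S := fun i =>
    { toFun := fun m => ρ (e' i m) - e' i (D m)
      map_add' := fun m m' => by rw [map_add, ρ_add, D_add, map_add]; ring
      map_smul' := fun a m => by
        simp only [map_smul, smul_eq_mul, ρ_mul, leibniz, map_add, RingHom.id_apply]
        ring }
  -- Differentiating `χ • m = ∑ e'ᵢ(m) eᵢ` shows that the vectors `eᵢ`, `D eᵢ` with the covectors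
  -- `fᵢ`, `e'ᵢ` expand `ρ χ`. Hence the defining property of the trace `t` applies to this system
  -- as well and yields `ρ χ * t`.
  have h1 : ∀ m, ρ χ • m = ∑ i, (f i m • e i + e' i m • D (e i)) := by
    intro m
    have h2 : D' (χ • m) = ∑ i, D' (e' i m • e i) := by rw [he, map_sum]
    change D (χ • m) = ∑ i, D (e' i m • e i) at h2
    simp only [leibniz, he (D m), Finset.sum_add_distrib] at h2
    change _ = ∑ i, ((ρ (e' i m) - e' i (D m)) • e i + e' i m • D (e i))
    simp only [sub_smul, Finset.sum_add_distrib, Finset.sum_sub_distrib]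
    rw [← eq_sub_iff_add_eq] at h2
    rw [h2]
    abel
  have h3 := h (ρ χ) (r + r) (Fin.append e fun i => D (e i)) (Fin.append f e') fun m => by
    rw [h1, Fin.sum_univ_add]
    simp only [Fin.append_left, Fin.append_right, Finset.sum_add_distrib]
  rw [Fin.sum_univ_add] at h3
  simp only [Fin.append_left, Fin.append_right] at h3
  change _ = ∑ i, (ρ (e' i (φ (e i))) - e' i (D (φ (e i)))) + _ at h3
  have h4 : ρ' (χ * t) = ∑ i, ρ' (e' i (φ (e i))) := by rw [h χ r e e' he, map_sum]
  change ρ (χ * t) = ∑ i, ρ (e' i (φ (e i))) at h4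
  rw [ρ_mul] at h4
  simp only [Finset.sum_sub_distrib] at h3
  simp only [map_sub, Finset.sum_sub_distrib]
  rw [← h4] at h3
  linear_combination -h3

end IsTrace

/-- Endomorphisms of `N` have traces, and these are unique. -/
structure HasTrace (S N : Type*) [CommRing S] [AddCommGroup N] [Module S N] : Prop where
  exists_isTrace : ∀ φ : N →ₗ[S] N, ∃ t : S, IsTrace φ t
  unique : ∀ (φ : N → N) (t u : S), IsTrace φ t → IsTrace φ u → t = u

namespace HasTrace

theorem isTrace (H : HasTrace S N) (φ : N →ₗ[S] N) : IsTrace φ (trace φ : S) := by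
  have h := H.exists_isTrace φ
  rw [trace, dif_pos h]
  exact h.choose_spec

theorem trace_eq (H : HasTrace S N) {φ : N → N} {t : S} (h : IsTrace φ t) : trace φ = t := by
  have h' : ∃ t : S, IsTrace φ t := ⟨t, h⟩
  rw [trace, dif_pos h']
  exact H.unique φ _ _ h'.choose_spec h

end HasTrace

variable {L : Type*} [AddCommGroup L] {Rel : L → L → S → Prop} {br : L → L → L} {ρ : L → S → S}
  {D : L → N → N}

theorem IsTrace.sum_slots {G : N → List L → N} {T : List L → S}
    (h : ∀ w, IsTrace (fun s => G s w) (T w)) (b : L → L) (w : List L) :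
    IsTrace (fun s => slotSum b w (G s)) (slotSum b w T) := by
  induction w generalizing G T with
  | nil => exact IsTrace.zero
  | cons x w ih => exact (h _).add (ih fun u => h (x :: u))

/-- The differential of the trace of a form with values in endomorphisms is the trace of the
commutator with the covariant differential. -/
theorem IsTrace.diff (h : IsConn Rel br ρ D) {p : ℕ} {Φ : Op Rel N} (hΦ : Tens p Φ)
    {T : List L → S} (hT : ∀ w, IsTrace (fun s => (Φ (single s)).1 w) (T w)) (w : List L) :
    IsTrace (fun s => ((h.diff * Φ - (-1 : ℤ) ^ p • (Φ * h.diff)) (single s)).1 w)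
      (ceList br ρ w T) := by
  induction w generalizing p Φ T with
  | nil =>
    have : ∀ s, ((h.diff * Φ - (-1 : ℤ) ^ p • (Φ * h.diff)) (single s)).1 [] = 0 := by
      intro s
      change 0 - (-1 : ℤ) ^ p • (Φ (h.diff (single s))).1 [] = 0
      cases p with
      | zero =>
        obtain ⟨φ, hφ⟩ := hΦ
        rw [hφ]
        change 0 - (-1 : ℤ) ^ 0 • φ 0 = 0
        simp
      | succ p => rw [hΦ.1]; simp
    simp only [this]
    exact IsTrace.zero
  | cons v w ih =>
    obtain ⟨q, Ψ, h1, h2, h3⟩ := hΦ.exists_ins v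
    -- Forms of degree zero are killed by contractions, so on them the contraction of the product is
    -- the product with the contracted form.
    have h4 : ∀ w, IsTrace (fun s => (Ψ (single s)).1 w) (T (v :: w)) := fun w => by
      have h5 : ∀ s, (Ψ (single s)).1 w = (Φ (single s)).1 (v :: w) := fun s => by
        have : ((ins v * Φ : Op Rel N) (single s)).1 w =
              ((Ψ + (-1 : ℤ) ^ p • (Φ * ins v) : Op Rel N) (single s)).1 w := by
          rw [h3]
        change (Φ (single s)).1 (v :: w) =
          (Ψ (single s)).1 w + (-1 : ℤ) ^ p • (Φ (ins v (single s))).1 w at this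
        rw [this, ins_single, map_zero]
        simp
      simp only [h5]
      exact hT _
    have h5 := ih h1 h4
    -- In terms of graded commutators: `ι_v [d, Φ] = [L_v, Φ] - [d, ι_v Φ]`, up to a multiple of
    -- `ι_v`, which vanishes on forms of degree zero. The first commutator has trace `L_v T`; the
    -- second is covered by the induction hypothesis.
    have h6 : ins v * (h.diff * Φ - (-1 : ℤ) ^ p • (Φ * h.diff)) =
        (h.lie v * Φ - Φ * h.lie v) - (h.diff * Ψ - (-1 : ℤ) ^ q • (Ψ * h.diff)) +
          (Φ * h.diff - (-1 : ℤ) ^ p • (h.diff * Φ)) * ins v := by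
      have h7 : ((-1 : ℤ) ^ p) * (-1 : ℤ) ^ p = 1 := by rw [← mul_pow]; simp
      rw [mul_sub, mul_smul_comm, ← mul_assoc, ← mul_assoc, h3, h.ins_diff, sub_mul, mul_assoc h.diff,
        h3, add_mul, smul_mul_assoc, mul_assoc Φ, h.ins_diff, h2, smul_add, smul_smul, h7]
      simp only [mul_sub, mul_add, sub_mul, mul_smul_comm, smul_mul_assoc, mul_assoc]
      module
    have h7 : ∀ s, ((h.diff * Φ - (-1 : ℤ) ^ p • (Φ * h.diff)) (single s)).1 (v :: w) =
        D v ((Φ (single s)).1 w) - slotSum (br v) w (Φ (single s)).1 - (Φ (single (D v s))).1 w -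
        ((h.diff * Ψ - (-1 : ℤ) ^ q • (Ψ * h.diff)) (single s)).1 w := by
      intro s
      refine (congrArg (fun R : Op Rel N => (R (single s)).1 w) h6).trans ?_
      change D v ((Φ (single s)).1 w) - slotSum (br v) w (Φ (single s)).1 -
        (Φ (h.lie v (single s))).1 w -
        ((h.diff * Ψ - (-1 : ℤ) ^ q • (Ψ * h.diff)) (single s)).1 w +
        ((Φ * h.diff - (-1 : ℤ) ^ p • (h.diff * Φ)) (ins v (single s))).1 w = _
      rw [ins_single, map_zero, h.lie_single]
      change _ + 0 = _
      rw [add_zero]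
    simp only [h7]
    have h8 := ((hT w).commutator (h.ρ_add v) (h.ρ_mul v) (h.D_add v) (h.leibniz v)).sub
      (IsTrace.sum_slots hT (br v) w)
    have h9 := h8.sub h5
    refine Eq.mp ?_ h9
    congr 1
    funext s
    abel

/-- The trace of a form with values in endomorphisms. -/
def trForm (Φ : Op Rel N) (w : List L) : S := trace fun s => (Φ (single s)).1 w

namespace HasTrace
variable (H : HasTrace S N) {p : ℕ} {Φ : Op Rel N}
include H

theorem isTrace_trForm (hΦ : Tens p Φ) (w : List L) :
    IsTrace (fun s => (Φ (single s)).1 w) (trForm Φ w) := H.isTrace (hΦ.toEnd w)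

theorem isAltForm_trForm (hΦ : Tens p Φ) : IsAltForm Rel (trForm Φ) where
  add l x y r := H.trace_eq <| by
    simp only [(Φ _).2.add]
    exact (H.isTrace_trForm hΦ _).add (H.isTrace_trForm hΦ _)
  alt l x r := H.trace_eq <| by
    simp only [(Φ _).2.alt]
    exact IsTrace.zero
  smul l r x' x a hr := H.trace_eq <| by
    simp only [(Φ _).2.smul _ _ _ _ _ hr]
    exact (H.isTrace_trForm hΦ _).smul a

/-- The Bianchi identity. -/
theorem ceList_trForm_eq_zero (h : IsConn Rel br ρ D) (hΦ : Tens (2 * p) Φ)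
    (hc : h.diff * Φ = Φ * h.diff) (w : List L) : ceList br ρ w (trForm Φ) = 0 := by
  have h1 := IsTrace.diff h hΦ (H.isTrace_trForm hΦ) w
  rw [pow_mul, hc] at h1
  refine H.unique _ _ _ h1 ?_
  simp only [even_two, Even.neg_pow, one_pow, one_smul, sub_self]
  exact IsTrace.zero

end HasTrace
end Trace

/-! ### Chern–Weil transgression between two connections. -/

section Transgression
variable {S L N : Type*} [CommRing S] [AddCommGroup L] [AddCommGroup N] [Module S N]
  {Rel : L → L → S → Prop} {br : L → L → L} {ρ : L → S → S} {D A : L → N → N}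

open Polynomial

/-- Polynomials whose coefficients are products with forms of degree `p`. -/
def TensPoly (p : ℕ) (Q : (Op Rel N)[X]) : Prop := ∀ i, Tens p (Q.coeff i)

namespace TensPoly
variable {p q : ℕ} {Q Q' : (Op Rel N)[X]}

theorem add (h : TensPoly p Q) (h' : TensPoly p Q') : TensPoly p (Q + Q') := fun i => by
  rw [coeff_add]
  exact (h i).add (h' i)

theorem mul (h : TensPoly p Q) (h' : TensPoly q Q') : TensPoly (p + q) (Q * Q') := fun i => by
  rw [coeff_mul]
  exact Tens.sum _ _ fun x _ => (h _).mul (h' _)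

theorem X_mul (h : TensPoly p Q) : TensPoly p (X * Q) := fun i => by
  cases i with
  | zero => rw [coeff_X_mul_zero]; exact Tens.zero p
  | succ i => rw [coeff_X_mul]; exact h i

theorem const {Φ : Op Rel N} (h : Tens p Φ) : TensPoly p (C Φ) := fun i => by
  rw [coeff_C]
  split_ifs
  exacts [h, Tens.zero p]

theorem pow (h : TensPoly p Q) (k : ℕ) : TensPoly (p * k) (Q ^ k) := by
  induction k with
  | zero => exact const Tens.one
  | succ k ih => exact pow_succ Q k ▸ ih.mul h

end TensPoly

/-- With `e = d + t a` and `P = e²` one has `P' = e a + a e`. As `e` commutes with `P`, the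
derivative of `P^(k+1)` is the graded commutator of `e` with `Q = ∑ Pⁱ a P^(k-i)`. -/
theorem exists_derivative_pow (d a : Op Rel N) (ha : Tens 1 a)
    (hF : TensPoly 2 ((C d + X * C a) * (C d + X * C a))) (k : ℕ) :
    ∃ Q : (Op Rel N)[X], TensPoly (2 * k + 1) Q ∧
      derivative (((C d + X * C a) * (C d + X * C a)) ^ (k + 1)) =
        (C d + X * C a) * Q + Q * (C d + X * C a) := by
  have h1 : derivative (C d + X * C a) = C a := by simp
  set e := C d + X * C a with he
  have h2 : derivative (e * e) = e * C a + C a * e := by rw [derivative_mul, h1, add_comm]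
  clear_value e
  induction k with
  | zero => exact ⟨C a, TensPoly.const ha, by rw [zero_add, pow_one, h2]⟩
  | succ k ih =>
    obtain ⟨Q, hQ, h3⟩ := ih
    refine ⟨Q * (e * e) + (e * e) ^ (k + 1) * C a, (hQ.mul hF).add ?_, ?_⟩
    · have := (hF.pow (k + 1)).mul (TensPoly.const ha)
      exact this
    · have h4 : e * (e * e) ^ (k + 1) = (e * e) ^ (k + 1) * e :=
        (((Commute.refl e).mul_right (Commute.refl e)).pow_right (k + 1)).eq
      rw [pow_succ _ (k + 1), derivative_mul, h3, h2, add_mul, mul_add, mul_add, add_mul,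
        ← mul_assoc ((e * e) ^ (k + 1)) e, ← h4]
      simp only [mul_assoc]
      abel

theorem dMul_eq_zero {a : S} (h : ∀ x, ρ x a = 0) (w : List L) (θ : List L → N) :
    dMul ρ a w θ = 0 := by
  induction w generalizing θ with
  | nil => rfl
  | cons x w ih => rw [dMul, h, ih, zero_smul, sub_zero]

/-- The coefficients `1 / (n + 1)` that come from integrating polynomials in `t` have to be
constants for the differential. -/
theorem IsConn.ρ_inv (h : IsConn Rel br ρ D) {n : ℕ} {c : S} (hc : ((n : S) + 1) * c = 1) (x : L) :
    ρ x c = 0 := by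
  let ρ' : S →+ S := AddMonoidHom.mk' (ρ x) (h.ρ_add x)
  have h1 : ρ x 1 = 0 := by simpa using h.ρ_mul x 1 1
  have h2 : ρ x ((n : S) + 1) = 0 := by
    have : ρ' ((n + 1 : ℕ) • (1 : S)) = (n + 1) • ρ' 1 := map_nsmul _ _ _
    change ρ x ((n + 1 : ℕ) • (1 : S)) = (n + 1) • ρ x 1 at this
    simpa [h1] using this
  have h3 := h.ρ_mul x ((n : S) + 1) c
  rw [hc, h1, h2, zero_mul, zero_add] at h3
  calc ρ x c = (((n : S) + 1) * c) * ρ x c := by rw [hc, one_mul]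
    _ = c * (((n : S) + 1) * ρ x c) := by ring
    _ = 0 := by rw [← h3, mul_zero]

theorem IsAltForm.ceList_zero_left {θ : List L → N} (hθ : IsAltForm Rel θ) (w : List L) :
    ceList (0 : L → L → L) (0 : L → N → N) w θ = 0 := by
  have := hθ.ceList_add_left 0 0 0 0 w
  rwa [add_zero, add_zero, left_eq_add] at this

theorem IsConn.ceList_sum_smul {θ : ℕ → List L → N} (h : IsConn Rel br ρ D) (c : ℕ → S)
    (hc : ∀ i x, ρ x (c i) = 0) (n : ℕ) (w : List L) :
    ceList br D w (∑ i ∈ Finset.range n, c i • θ i) =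
      ∑ i ∈ Finset.range n, c i • ceList br D w (θ i) := by
  induction n with
  | zero => simp [h.ceList_zero]
  | succ n ih =>
    rw [Finset.sum_range_succ, h.ceList_add, ih, Finset.sum_range_succ, h.ceList_smul,
      dMul_eq_zero (hc n), add_zero]

theorem IsAltForm.sum_smul {θ : ℕ → List L → N} (h : ∀ i, IsAltForm Rel (θ i)) (c : ℕ → S)
    (n : ℕ) : IsAltForm Rel (∑ i ∈ Finset.range n, c i • θ i) :=
  Finset.sum_induction _ _ (fun _ _ => IsAltForm.plus) IsAltForm.zero
    fun i _ => (h i).smul_left (c i)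

/-- The Chern–Weil forms of two connections differ by an exact form. -/
theorem HasTrace.exists_transgression (H : HasTrace S N)
    (inv : ∀ n : ℕ, ∃ c : S, ((n : S) + 1) * c = 1) (h : IsConn Rel br ρ D)
    (hS : IsConn (N := S) Rel br ρ ρ) (hA : IsConn Rel (0 : L → L → L) (0 : L → S → S) A)
    (hF : Tens 2 (h.diff * h.diff))
    (hF' : Tens 2 ((h.diff + hA.diff) * (h.diff + hA.diff))) (k : ℕ) :
    ∃ η : List L → S, IsAltForm Rel η ∧ ∀ w,
      trForm (((h.diff + hA.diff) * (h.diff + hA.diff)) ^ k) w =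
        trForm ((h.diff * h.diff) ^ k) w + ceList br ρ w η := by
  cases k with
  | zero => exact ⟨0, IsAltForm.zero, fun w => by rw [hS.ceList_zero, pow_zero, pow_zero, add_zero]⟩
  | succ k =>
  have ha : Tens 1 hA.diff := hA.tens_diff_of_bracket_eq_zero
  generalize hd : h.diff = d at *
  generalize ha' : hA.diff = a at *
  have hT : TensPoly 2 ((C d + X * C a) * (C d + X * C a)) := by
    -- Although `d` is no product with a form, the mixed term is one: it is the difference of the
    -- two curvatures minus `a²`.
    have h1 : Tens 2 (d * a + a * d) := by
      have : d * a + a * d = (d + a) * (d + a) - d * d - a * a := by noncomm_ring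
      rw [this]
      exact (hF'.sub hF).sub (ha.mul ha)
    have h2 : (C d + X * C a) * (C d + X * C a) =
        C (d * d) + X * (C (d * a + a * d) + X * C (a * a)) := by
      simp only [mul_add, add_mul, map_add, map_mul, ← mul_assoc]
      rw [← X_mul_C d]
      simp only [mul_assoc]
      rw [← mul_assoc (C a) X, ← X_mul_C a]
      simp only [mul_assoc]
      abel
    rw [h2]
    exact (TensPoly.const hF).add ((TensPoly.const h1).add (TensPoly.const (ha.mul ha)).X_mul).X_mul
  obtain ⟨Q, hQ, hder⟩ := exists_derivative_pow d a ha hT k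
  set P := ((C d + X * C a) * (C d + X * C a)) ^ (k + 1) with hP
  have hPt : TensPoly (2 * (k + 1)) P := hT.pow (k + 1)
  have hsign : (-1 : ℤ) ^ (2 * k + 1) = -1 := by rw [pow_succ, pow_mul]; simp
  -- The coefficient of `tⁱ` in `P' = [d + t a, Q]` is `(i + 1) P_{i+1} = [d, Q_i] + [a, Q_{i-1}]`.
  -- The first commutator has trace `d Tr(Q_i)`, the second has trace zero.
  have key : ∀ (i : ℕ) w, ((i : S) + 1) * trForm (P.coeff (i + 1)) w = ceList br ρ w (trForm (Q.coeff i)) := by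
    intro i w
    have h1 : ((i + 1 : ℕ) : ℤ) • P.coeff (i + 1) =
        (d * Q.coeff i + Q.coeff i * d) +
          ((X * (C a * Q)).coeff i + (X * (Q * C a)).coeff i) := by
      have h2 : (C d + X * C a) * Q + Q * (C d + X * C a) =
          (C d * Q + Q * C d) + (X * (C a * Q) + X * (Q * C a)) := by
        have : Q * X = X * Q := (X_mul).symm
        rw [mul_add Q, ← mul_assoc Q, this, add_mul]
        simp only [mul_assoc]
        abel
      have h3 := congrArg (fun R => coeff R i) hder
      simp only [h2, coeff_derivative, coeff_add, coeff_C_mul, coeff_mul_C] at h3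
      rw [← h3, zsmul_eq_mul]
      have := (Nat.cast_commute (i + 1) (P.coeff (i + 1))).eq
      push_cast at this ⊢
      exact this
    have h2 := (IsTrace.diff h (hQ i) (H.isTrace_trForm (hQ i)) w)
    rw [hd, hsign] at h2
    have h3 : IsTrace (fun s => (((X * (C a * Q)).coeff i + (X * (Q * C a)).coeff i)
        (single s)).1 w) (0 : S) := by
      cases i with
      | zero =>
        simp only [coeff_X_mul_zero, add_zero, op_zero_apply]
        exact IsTrace.zero
      | succ i =>
        -- `a` is itself a differential, for the zero bracket and the zero symbol. So the trace of
        -- its graded commutator with `Q_i` is a differential that vanishes identically.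
        have h4 := (IsTrace.diff hA (hQ i) (H.isTrace_trForm (hQ i)) w)
        rw [ha', hsign] at h4
        simp only [coeff_X_mul, coeff_C_mul, coeff_mul_C]
        rw [(H.isAltForm_trForm (hQ i)).ceList_zero_left] at h4
        simpa using h4
    refine H.unique (fun s => ((((i + 1 : ℕ) : ℤ) • P.coeff (i + 1)) (single s)).1 w) _ _ ?_ ?_
    · have h4 := (H.isTrace_trForm (hPt (i + 1)) w).smul ((i : S) + 1)
      simp only [op_zsmul_apply]
      convert h4 using 2 with s
      rw [← Int.cast_smul_eq_zsmul S]
      push_cast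
      rfl
    · rw [h1]
      simpa using h2.add h3
  choose c hc using inv
  -- The transgression form is the integral of `Tr(Q(t))` over `0 ≤ t ≤ 1`, computed coefficientwise
  -- with `c i = 1 / (i + 1)`.
  refine ⟨∑ i ∈ Finset.range P.natDegree, c i • trForm (Q.coeff i),
    IsAltForm.sum_smul (fun i => H.isAltForm_trForm (hQ i)) c _, fun w => ?_⟩
  rw [hS.ceList_sum_smul c fun i x => h.ρ_inv (hc i) x]
  have h1 : ((d + a) * (d + a)) ^ (k + 1) =
      ∑ i ∈ Finset.range P.natDegree, P.coeff (i + 1) + (d * d) ^ (k + 1) := by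
    -- Evaluation at `t = 1`, a ring homomorphism in spite of the noncommutative coefficients since
    -- `1` is central. It exhibits `(d + a)^(2k+2)` as the constant term `d^(2k+2)` plus the
    -- coefficients treated in `key`.
    let ev : (Op Rel N)[X] →+* Op Rel N :=
      eval₂RingHom' (RingHom.id _) 1 fun x => Commute.one_right x
    have h2 : ev P = ((d + a) * (d + a)) ^ (k + 1) := by
      have h3 : ev (C d + X * C a) = d + a := by
        rw [map_add, map_mul]
        simp [ev, eval₂RingHom']
      rw [hP, map_pow, map_mul, h3]
    have h3 : ev P = ∑ i ∈ Finset.range (P.natDegree + 1), P.coeff i := by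
      change eval₂ (RingHom.id _) 1 P = _
      rw [eval₂_eq_sum_range]
      simp
    have h4 : P.coeff 0 = (d * d) ^ (k + 1) := by
      change constantCoeff P = _
      rw [hP, map_pow, map_mul, map_add, map_mul]
      simp
    rw [← h2, h3, Finset.sum_range_succ', h4]
  have h2 : trForm (((d + a) * (d + a)) ^ (k + 1)) w =
      ∑ i ∈ Finset.range P.natDegree, trForm (P.coeff (i + 1)) w +
        trForm ((d * d) ^ (k + 1)) w := by
    refine H.trace_eq ?_
    rw [h1]
    have h3 := (IsTrace.sum (Finset.range P.natDegree) _ _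
      fun i _ => H.isTrace_trForm (hPt (i + 1)) w).add (H.isTrace_trForm (hF.pow (k + 1)) w)
    convert h3 using 2 with s
    have h5 : ∀ s' : Finset ℕ, ((∑ i ∈ s', P.coeff (i + 1)) (single s)).1 w =
        ∑ i ∈ s', ((P.coeff (i + 1)) (single s)).1 w := by
      intro s'
      classical
      induction s' using Finset.induction_on with
      | empty => simp
      | insert j s' hj ih => rw [Finset.sum_insert hj, Finset.sum_insert hj, op_add_apply, ih]
    rw [op_add_apply, h5]
  rw [h2, add_comm]
  congr 1
  refine Finset.sum_congr rfl fun i _ => ?_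
  rw [← key, smul_eq_mul, ← mul_assoc, mul_comm (c i), hc, one_mul]

end Transgression

/-! ### Local dual bases: existence of traces, uniqueness of derivations. -/

section LocalBases
variable {S N P : Type*} [CommRing S] [AddCommGroup N] [Module S N]

/-- Local dual bases of a module, with values in a family `G p` of elements. -/
structure DualBasis (S : Type*) {N : Type*} [CommRing S] [AddCommGroup N] [Module S N]
    (G : Set N) (χ : S) where
  rank : ℕ
  vec : Fin rank → N
  covec : Fin rank → N →ₗ[S] S
  vec_mem : ∀ i, vec i ∈ G
  expand : ∀ m, χ • m = ∑ i, covec i m • vec i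

/-- The local expressions `∑ e'ᵢ(φ eᵢ)` are compatible, so they glue to a trace; separatedness makes
it unique. -/
theorem HasTrace.of_dualBasis {χ : P → S} (B : ∀ p, DualBasis S (Set.univ : Set N) (χ p))
    (sep : ∀ t : S, (∀ p, χ p * t = 0) → t = 0)
    (glue : ∀ t : P → S, (∀ p q, χ q * t p = χ p * t q) → ∃ t', ∀ p, χ p * t' = t p) :
    HasTrace S N where
  unique φ t u h h' := by
    rw [← sub_eq_zero]
    refine sep _ fun p => ?_
    rw [mul_sub, h _ _ _ _ (B p).expand, h' _ _ _ _ (B p).expand, sub_self]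
  exists_isTrace φ := by
    -- Independence of the dual system: expanding the vectors of each system in the other one turns
    -- both sides into the same double sum.
    have key : ∀ (c : S) (r : ℕ) (e : Fin r → N) (e' : Fin r → N →ₗ[S] S),
        (∀ m, c • m = ∑ i, e' i m • e i) → ∀ p,
        c * ∑ i, (B p).covec i (φ ((B p).vec i)) = χ p * ∑ i, e' i (φ (e i)) := by
      intro c r e e' he p
      have h1 : ∀ i, c * (B p).covec i (φ ((B p).vec i)) =
          ∑ j, e' j ((B p).vec i) * (B p).covec i (φ (e j)) := fun i => by
        rw [← smul_eq_mul, ← map_smul, ← map_smul, he, map_sum, map_sum]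
        simp
      have h2 : ∀ j, χ p * e' j (φ (e j)) =
          ∑ i, (B p).covec i (φ (e j)) * e' j ((B p).vec i) := fun j => by
        rw [← smul_eq_mul, ← map_smul, (B p).expand, map_sum]
        simp
      simp only [Finset.mul_sum, h1, h2]
      rw [Finset.sum_comm]
      refine Finset.sum_congr rfl fun j _ => Finset.sum_congr rfl fun i _ => mul_comm _ _
    obtain ⟨t, ht⟩ := glue (fun p => ∑ i, (B p).covec i (φ ((B p).vec i))) fun p q =>
      key _ _ _ _ (B q).expand p
    refine ⟨t, fun χ r e e' he => ?_⟩
    rw [← sub_eq_zero]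
    refine sep _ fun p => ?_
    rw [mul_sub, ← key χ r e e' he p, ← ht, sub_eq_zero]
    ring

/-- Derivations of a module with the same symbol which agree on local generators agree. -/
theorem DualBasis.derivation_ext {G : Set N} {χ : P → S} (B : ∀ p, DualBasis S G (χ p))
    (sep : ∀ m : N, (∀ p, χ p • m = 0) → m = 0) {ρ : S → S} {D D' : N → N}
    (D_add : ∀ m m', D (m + m') = D m + D m') (D'_add : ∀ m m', D' (m + m') = D' m + D' m')
    (leibniz : ∀ (a : S) m, D (a • m) = ρ a • m + a • D m)
    (leibniz' : ∀ (a : S) m, D' (a • m) = ρ a • m + a • D' m)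
    (h : ∀ m ∈ G, D m = D' m) (m : N) : D m = D' m := by
  rw [← sub_eq_zero]
  refine sep _ fun p => ?_
  let T : N →ₗ[S] N :=
    { toFun := fun m => D m - D' m
      map_add' := fun m m' => by rw [D_add, D'_add]; abel
      map_smul' := fun a m => by
        simp only [leibniz, leibniz', RingHom.id_apply]
        module }
  change χ p • T m = 0
  rw [← map_smul, (B p).expand, map_sum]
  refine Finset.sum_eq_zero fun i _ => ?_
  rw [map_smul]
  change _ • (D _ - D' _) = 0
  rw [h _ ((B p).vec_mem i), sub_self, smul_zero]

end LocalBases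

/-! ### Vector fields: brackets and derivatives of functions. -/

section VectorFields
variable {EM HM : Type*} [NormedAddCommGroup EM] [NormedSpace ℝ EM]
  [TopologicalSpace HM] {IM : ModelWithCorners ℝ EM HM} {M : Type*} [TopologicalSpace M]
  [ChartedSpace HM M] [IsManifold IM ∞ M]

/-- The derivative of a real function along a vector field. -/
def lieReal (Z : VF IM M) (f : C^∞⟮IM, M; 𝓘(ℝ, ℝ), ℝ⟯) : C^∞⟮IM, M; 𝓘(ℝ, ℝ), ℝ⟯ :=
  ⟨fun p => derivAlong f p (Z p), fun _ =>
    contMDiffAt_derivAlong isOpen_univ f.contMDiff.contMDiffOn Z (Set.mem_univ _)⟩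

theorem derivAlong_clm {G G' : Type*} [NormedAddCommGroup G] [NormedSpace ℝ G]
    [NormedAddCommGroup G'] [NormedSpace ℝ G'] (L : G →L[ℝ] G') {g : M → G} {p : M}
    (hg : MDifferentiableAt IM 𝓘(ℝ, G) g p) (v : TangentSpace IM p) :
    derivAlong (fun q => L (g q)) p v = L (derivAlong g p v) := by
  have h2 := mfderiv_comp p (I' := 𝓘(ℝ, G)) (g := L) L.mdifferentiableAt hg
  unfold derivAlong
  change mfderiv IM 𝓘(ℝ, G') (L ∘ g) p v = _
  rw [h2, L.mfderiv_eq]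
  rfl

theorem lieDer_toFn (Z : VF IM M) (f : C^∞⟮IM, M; 𝓘(ℝ, ℝ), ℝ⟯) :
    lieDer Z (toFn f) = toFn (lieReal Z f) := by
  ext p
  exact derivAlong_clm Complex.ofRealCLM (f.contMDiff.mdifferentiableAt (by simp)) (Z p)

theorem lieDer_add_left (Z W : VF IM M) (f : Fn IM M) :
    lieDer (Z + W) f = lieDer Z f + lieDer W f := by
  ext p
  exact (mfderiv IM 𝓘(ℝ, ℂ) f p).map_add (Z p) (W p)

theorem lieDer_smulVF (f : C^∞⟮IM, M; 𝓘(ℝ, ℝ), ℝ⟯) (Z : VF IM M) (g : Fn IM M) :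
    lieDer (smulVF f Z) g = toFn f * lieDer Z g := by
  ext p
  refine ((mfderiv IM 𝓘(ℝ, ℂ) g p).map_smul (f p) (Z p)).trans ?_
  exact Complex.real_smul

theorem lieDer_constFn (Z : VF IM M) (c : ℂ) : lieDer Z (constFn c) = 0 := by
  ext p
  change mfderiv IM 𝓘(ℝ, ℂ) (fun _ => c) p (Z p) = 0
  rw [mfderiv_const]
  rfl

variable [FiniteDimensional ℝ EM]

theorem VF.mdifferentiableAt (Z : VF IM M) (p : M) :
    MDifferentiableAt IM IM.tangent (fun x => (⟨x, Z x⟩ : TangentBundle IM M)) p :=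
  (Z.contMDiff p).mdifferentiableAt (by simp)

theorem bracket_add_left (Z Z' W : VF IM M) :
    bracket (Z + Z') W = bracket Z W + bracket Z' W := by
  have : CompleteSpace EM := FiniteDimensional.complete ℝ EM
  ext p
  exact VectorField.mlieBracket_add_left (VF.mdifferentiableAt Z p) (VF.mdifferentiableAt Z' p)

theorem bracket_self (Z : VF IM M) : bracket Z Z = 0 := by
  ext p
  exact congrFun VectorField.mlieBracket_self p

theorem bracket_swap (Z W : VF IM M) : bracket Z W = -bracket W Z := by
  ext p
  exact VectorField.mlieBracket_swap_apply

theorem bracket_add_right (Z W W' : VF IM M) :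
    bracket Z (W + W') = bracket Z W + bracket Z W' := by
  rw [bracket_swap, bracket_add_left, bracket_swap Z W, bracket_swap Z W', neg_add]

theorem bracket_jacobi (U V W : VF IM M) :
    bracket U (bracket V W) = bracket (bracket U V) W + bracket V (bracket U W) := by
  have : CompleteSpace EM := FiniteDimensional.complete ℝ EM
  have : IsManifold IM (minSmoothness ℝ 3) M :=
    IsManifold.of_le (n := ∞) (by simpa using ENat.LEInfty.out)
  have h : ∀ Z : VF IM M, ContMDiff IM IM.tangent (minSmoothness ℝ 2)
      (fun x => (⟨x, Z x⟩ : TangentBundle IM M)) := fun Z =>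
    Z.contMDiff.of_le (by simpa using ENat.LEInfty.out)
  ext p
  exact VectorField.leibniz_identity_mlieBracket_apply (h U p) (h V p) (h W p)

theorem bracket_smulVF_right (f : C^∞⟮IM, M; 𝓘(ℝ, ℝ), ℝ⟯) (Z W : VF IM M) :
    bracket Z (smulVF f W) = smulVF (lieReal Z f) W + smulVF f (bracket Z W) := by
  have : CompleteSpace EM := FiniteDimensional.complete ℝ EM
  ext p
  exact VectorField.mlieBracket_smul_right (f.contMDiff.mdifferentiableAt (by simp))
    (VF.mdifferentiableAt W p)

theorem bracket_smulVF_left (f : C^∞⟮IM, M; 𝓘(ℝ, ℝ), ℝ⟯) (Z W : VF IM M) :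
    bracket (smulVF f Z) W = smulVF f (bracket Z W) - smulVF (lieReal W f) Z := by
  have h : smulVF f (bracket W Z) = -smulVF f (bracket Z W) := by
    ext p
    change f p • bracket W Z p = -(f p • bracket Z W p)
    rw [bracket_swap W Z]
    exact smul_neg (f p) (bracket Z W p)
  rw [bracket_swap, bracket_smulVF_right, h]
  abel

/-- This is read off from the Jacobi identity for `Z`, `W` and `f V`: after subtracting `f` times
the identity for `V`, the remaining terms are multiples of `V`. At a point where `Z` or `W` is
nonzero it serves as `V`; where both vanish, so does the bracket, and all terms are zero. -/
theorem lieReal_bracket (Z W : VF IM M) (f : C^∞⟮IM, M; 𝓘(ℝ, ℝ), ℝ⟯) :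
    lieReal (bracket Z W) f = lieReal Z (lieReal W f) - lieReal W (lieReal Z f) := by
  have key : ∀ (V : VF IM M) p, V p ≠ 0 → lieReal (bracket Z W) f p =
      lieReal Z (lieReal W f) p - lieReal W (lieReal Z f) p := by
    intro V p hV
    have h1 := bracket_jacobi Z W (smulVF f V)
    simp only [bracket_smulVF_right, bracket_add_right] at h1
    have h2 := DFunLike.congr_fun h1 p
    have h3 := DFunLike.congr_fun (bracket_jacobi Z W V) p
    let a : EM := V p
    let b : EM := bracket Z V p
    let c : EM := bracket W V p
    let d₁ : EM := bracket Z (bracket W V) p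
    let d₂ : EM := bracket (bracket Z W) V p
    let d₃ : EM := bracket W (bracket Z V) p
    change lieReal Z (lieReal W f) p • a + lieReal W f p • b + (lieReal Z f p • c + f p • d₁) =
      lieReal (bracket Z W) f p • a + f p • d₂ +
        (lieReal W (lieReal Z f) p • a + lieReal Z f p • c + (lieReal W f p • b + f p • d₃)) at h2
    change d₁ = d₂ + d₃ at h3
    rw [h3] at h2
    have h4 : (lieReal (bracket Z W) f p - (lieReal Z (lieReal W f) p -
        lieReal W (lieReal Z f) p)) • a = 0 := by
      rw [← sub_eq_zero] at h2
      rw [← neg_eq_zero, ← h2]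
      module
    exact sub_eq_zero.1 ((smul_eq_zero.1 h4).resolve_right hV)
  ext p
  by_cases hZ : Z p = 0
  · by_cases hW : W p = 0
    · have h1 : bracket Z W p = 0 := by
        rw [← VectorField.mlieBracketWithin_eq_zero_of_eq_zero (I := IM) (s := Set.univ) hZ hW,
          VectorField.mlieBracketWithin_univ]
        rfl
      have h2 : ∀ (V : VF IM M) (g : C^∞⟮IM, M; 𝓘(ℝ, ℝ), ℝ⟯), V p = 0 → lieReal V g p = 0 := by
        intro V g hV
        change mfderiv IM 𝓘(ℝ, ℝ) g p (V p) = 0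
        rw [hV]
        exact map_zero _
      change lieReal (bracket Z W) f p = lieReal Z (lieReal W f) p - lieReal W (lieReal Z f) p
      rw [h2 _ _ hZ, h2 _ _ hW, h2 _ _ h1, sub_zero]
    · exact key W p hW
  · exact key Z p hZ

/-- The real and imaginary parts of a function. -/
def compReal (L : ℂ →L[ℝ] ℝ) (f : Fn IM M) : C^∞⟮IM, M; 𝓘(ℝ, ℝ), ℝ⟯ :=
  ⟨fun p => L (f p), L.contMDiff.comp f.contMDiff⟩

theorem compReal_lieDer (L : ℂ →L[ℝ] ℝ) (Z : VF IM M) (f : Fn IM M) :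
    compReal L (lieDer Z f) = lieReal Z (compReal L f) := by
  ext p
  exact (derivAlong_clm L (f.contMDiff.mdifferentiableAt (by simp)) (Z p)).symm

theorem lieDer_bracket (Z W : VF IM M) (f : Fn IM M) :
    lieDer (bracket Z W) f = lieDer Z (lieDer W f) - lieDer W (lieDer Z f) := by
  have h : ∀ (L : ℂ →L[ℝ] ℝ) p, L (lieDer (bracket Z W) f p) =
      L (lieDer Z (lieDer W f) p) - L (lieDer W (lieDer Z f) p) := by
    intro L p
    have h1 : compReal L (lieDer (bracket Z W) f) =
        compReal L (lieDer Z (lieDer W f)) - compReal L (lieDer W (lieDer Z f)) := by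
      simp only [compReal_lieDer, lieReal_bracket]
    exact DFunLike.congr_fun h1 p
  ext p
  exact Complex.ext (h Complex.reCLM p) (h Complex.imCLM p)

/-- Tangent vectors which annihilate all smooth functions vanish. -/
theorem eq_zero_of_forall_derivAlong [T2Space M] {p : M} {v : TangentSpace IM p}
    (h : ∀ f : C^∞⟮IM, M; 𝓘(ℝ, ℝ), ℝ⟯, derivAlong f p v = 0) : v = 0 := by
  have h1 : IsManifold IM 1 M := IsManifold.of_le (n := ∞) (by simp)
  obtain ⟨b⟩ : Nonempty (SmoothBumpFunction IM p) := inferInstance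
  have hsm : ContMDiff IM 𝓘(ℝ, EM) ∞ (fun x => b x • extChartAt IM p x) :=
    b.contMDiff_smul contMDiffOn_extChartAt
  have hev : (fun x => b x • extChartAt IM p x) =ᶠ[nhds p] extChartAt IM p := by
    filter_upwards [b.eventuallyEq_one] with x hx
    simp [hx]
  have h2 : ∀ L : EM →L[ℝ] ℝ, L (derivAlong (fun x => b x • extChartAt IM p x) p v) = 0 := by
    intro L
    rw [← derivAlong_clm L (hsm.mdifferentiableAt (by simp))]
    exact h ⟨fun x => L (b x • extChartAt IM p x), L.contMDiff.comp hsm⟩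
  have h3 : derivAlong (fun x => b x • extChartAt IM p x) p v = 0 :=
    SeparatingDual.eq_zero_of_forall_dual_eq_zero (R := ℝ) h2
  unfold derivAlong at h3
  rw [hev.mfderiv_eq] at h3
  have h5 := isInvertible_mfderiv_extChartAt (I := IM) (mem_extChartAt_source p)
  exact h5.injective (h3.trans (map_zero _).symm)

end VectorFields

/-! ### Vector fields along the two factors of the product. -/

section ProductFields
variable {EM HM : Type*} [NormedAddCommGroup EM] [NormedSpace ℝ EM]
  [TopologicalSpace HM] {I : ModelWithCorners ℝ EM HM} {X : Type*} [TopologicalSpace X]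
  [ChartedSpace HM X] [IsManifold I ∞ X]

theorem derivAlong_comp_fst {G : Type*} [NormedAddCommGroup G] [NormedSpace ℝ G] {g : X → G}
    {p : X × X} (hg : MDifferentiableAt I 𝓘(ℝ, G) g p.1) (v : TangentSpace (I.prod I) p) :
    derivAlong (IM := I.prod I) (fun q : X × X => g q.1) p v =
      derivAlong (IM := I) g p.1 (show EM × EM from v).1 := by
  have h2 := mfderiv_comp p (I' := I) (g := g) hg (mdifferentiableAt_fst (I := I) (I' := I))
  rw [mfderiv_fst] at h2
  unfold derivAlong
  change mfderiv (I.prod I) 𝓘(ℝ, G) (g ∘ Prod.fst) p v = _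
  rw [h2]
  rfl

theorem derivAlong_comp_snd {G : Type*} [NormedAddCommGroup G] [NormedSpace ℝ G] {g : X → G}
    {p : X × X} (hg : MDifferentiableAt I 𝓘(ℝ, G) g p.2) (v : TangentSpace (I.prod I) p) :
    derivAlong (IM := I.prod I) (fun q : X × X => g q.2) p v =
      derivAlong (IM := I) g p.2 (show EM × EM from v).2 := by
  have h2 := mfderiv_comp p (I' := I) (g := g) hg (mdifferentiableAt_snd (I := I) (I' := I))
  rw [mfderiv_snd] at h2
  unfold derivAlong
  change mfderiv (I.prod I) 𝓘(ℝ, G) (g ∘ Prod.snd) p v = _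
  rw [h2]
  rfl

theorem derivAlong_slice_snd {G : Type*} [NormedAddCommGroup G] [NormedSpace ℝ G]
    {g : X × X → G} {p : X × X} (hg : MDifferentiableAt (I.prod I) 𝓘(ℝ, G) g p) (Z : VF I X) :
    derivAlong (IM := I) (fun y => g (p.1, y)) p.2 (Z p.2) =
      derivAlong (IM := I.prod I) g p (lift₂ Z p) := by
  have h : MDifferentiableAt I (I.prod I) (fun y : X => (p.1, y)) p.2 :=
    mdifferentiableAt_const.prodMk mdifferentiableAt_id
  have h2 := mfderiv_comp p.2 (I' := I.prod I) (g := g) hg h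
  rw [mfderiv_prod_right] at h2
  unfold derivAlong
  change mfderiv I 𝓘(ℝ, G) (g ∘ fun y => (p.1, y)) p.2 (Z p.2) = _
  rw [h2]
  rfl

/-- The restriction of a function of two points to a slice `X × {y}`. -/
def sliceFst (f : Fn₂ I X) (y : X) : Fn I X :=
  ⟨fun x => f (x, y), f.contMDiff.comp (contMDiff_id.prodMk contMDiff_const)⟩

/-- The restriction of a function of two points to a slice `{x} × X`. -/
def sliceSnd (f : Fn₂ I X) (x : X) : Fn I X :=
  ⟨fun y => f (x, y), f.contMDiff.comp (contMDiff_const.prodMk contMDiff_id)⟩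

theorem lieDer_sliceFst (Z : VF I X) (f : Fn₂ I X) (y : X) :
    lieDer Z (sliceFst f y) = sliceFst (lieDer (lift₁ Z) f) y := by
  ext x
  exact derivAlong_slice (p := (x, y)) (f.contMDiff.mdifferentiableAt (by simp)) Z

theorem lieDer_sliceSnd (Z : VF I X) (f : Fn₂ I X) (x : X) :
    lieDer Z (sliceSnd f x) = sliceSnd (lieDer (lift₂ Z) f) x := by
  ext y
  exact derivAlong_slice_snd (p := (x, y)) (f.contMDiff.mdifferentiableAt (by simp)) Z

theorem lieDer_lift₁_pullFst (Z : VF I X) (f : Fn I X) :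
    lieDer (lift₁ Z) (pullFst f) = pullFst (lieDer Z f) := by
  ext p
  exact derivAlong_comp_fst (f.contMDiff.mdifferentiableAt (by simp)) _

theorem lieDer_lift₂_pullSnd (Z : VF I X) (f : Fn I X) :
    lieDer (lift₂ Z) (pullSnd f) = pullSnd (lieDer Z f) := by
  ext p
  exact derivAlong_comp_snd (f.contMDiff.mdifferentiableAt (by simp)) _

theorem lieDer_lift₁_pullSnd (Z : VF I X) (f : Fn I X) : lieDer (lift₁ Z) (pullSnd f) = 0 := by
  ext p
  refine (derivAlong_comp_snd (f.contMDiff.mdifferentiableAt (by simp)) _).trans ?_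
  exact (mfderiv I 𝓘(ℝ, ℂ) f p.2).map_zero

theorem lieDer_lift₂_pullFst (Z : VF I X) (f : Fn I X) : lieDer (lift₂ Z) (pullFst f) = 0 := by
  ext p
  refine (derivAlong_comp_fst (f.contMDiff.mdifferentiableAt (by simp)) _).trans ?_
  exact (mfderiv I 𝓘(ℝ, ℂ) f p.1).map_zero

theorem lift₁_add (Z W : VF I X) : lift₁ (Z + W) = lift₁ Z + lift₁ W := by
  ext p
  exact (Prod.ext rfl (add_zero (0 : EM)).symm : ((Z p.1 + W p.1 : EM), (0 : EM)) = (Z p.1, 0) + (W p.1, 0))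

theorem lift₂_add (Z W : VF I X) : lift₂ (Z + W) = lift₂ Z + lift₂ W := by
  ext p
  exact (Prod.ext (add_zero (0 : EM)).symm rfl : ((0 : EM), (Z p.2 + W p.2 : EM)) = (0, Z p.2) + (0, W p.2))

theorem lieDer_lift₁_smulVF (f : C^∞⟮I, X; 𝓘(ℝ, ℝ), ℝ⟯) (Z : VF I X) (g : Fn₂ I X) :
    lieDer (lift₁ (smulVF f Z)) g = pullFst (toFn f) * lieDer (lift₁ Z) g := by
  ext p
  have h : (lift₁ (smulVF f Z) p : EM × EM) = f p.1 • (show EM × EM from lift₁ Z p) :=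
    Prod.ext rfl (smul_zero (f p.1)).symm
  change mfderiv (I.prod I) 𝓘(ℝ, ℂ) g p (lift₁ (smulVF f Z) p) = _
  rw [show lift₁ (smulVF f Z) p = f p.1 • lift₁ Z p from h]
  exact ((mfderiv (I.prod I) 𝓘(ℝ, ℂ) g p).map_smul _ _).trans Complex.real_smul

theorem lieDer_lift₂_smulVF (f : C^∞⟮I, X; 𝓘(ℝ, ℝ), ℝ⟯) (Z : VF I X) (g : Fn₂ I X) :
    lieDer (lift₂ (smulVF f Z)) g = pullSnd (toFn f) * lieDer (lift₂ Z) g := by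
  ext p
  have h : (lift₂ (smulVF f Z) p : EM × EM) = f p.2 • (show EM × EM from lift₂ Z p) :=
    Prod.ext (smul_zero (f p.2)).symm rfl
  change mfderiv (I.prod I) 𝓘(ℝ, ℂ) g p (lift₂ (smulVF f Z) p) = _
  rw [show lift₂ (smulVF f Z) p = f p.2 • lift₂ Z p from h]
  exact ((mfderiv (I.prod I) 𝓘(ℝ, ℂ) g p).map_smul _ _).trans Complex.real_smul

/-- The chain rule for the diagonal map, whose derivative sends `Z` to `(Z, 0) + (0, Z)`. -/
theorem restrictDiag_lieDer (Z : VF I X) (f : Fn₂ I X) :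
    restrictDiag (lieDer (lift₁ Z) f + lieDer (lift₂ Z) f) = lieDer Z (restrictDiag f) := by
  ext x
  have hf : MDifferentiableAt (I.prod I) 𝓘(ℝ, ℂ) f (x, x) := f.contMDiff.mdifferentiableAt (by simp)
  have hd : MDifferentiableAt I (I.prod I) (fun y : X => (y, y)) x :=
    mdifferentiableAt_id.prodMk mdifferentiableAt_id
  have h2 := mfderiv_comp x (I' := I.prod I) (g := f) (f := fun y : X => (y, y)) hf hd
  have h3 : mfderiv I (I.prod I) (fun y : X => (y, y)) x =
      (ContinuousLinearMap.id ℝ EM).prod (ContinuousLinearMap.id ℝ EM) := by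
    have := mfderiv_prodMk (I := I) (I' := I) (I'' := I) (f := id) (g := id) (x := x)
      mdifferentiableAt_id mdifferentiableAt_id
    rw [mfderiv_id] at this
    exact this
  rw [h3] at h2
  change mfderiv (I.prod I) 𝓘(ℝ, ℂ) f (x, x) (lift₁ Z (x, x)) +
    mfderiv (I.prod I) 𝓘(ℝ, ℂ) f (x, x) (lift₂ Z (x, x)) =
    mfderiv I 𝓘(ℝ, ℂ) (f ∘ fun y => (y, y)) x (Z x)
  rw [h2]
  refine ((mfderiv (I.prod I) 𝓘(ℝ, ℂ) f (x, x)).map_add _ _).symm.trans ?_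
  have h4 : ((Z x, 0) : EM × EM) + (0, Z x) = (Z x, Z x) :=
    Prod.ext (add_zero (show EM from Z x)) (zero_add (show EM from Z x))
  exact congrArg (mfderiv (I.prod I) 𝓘(ℝ, ℂ) f (x, x)) h4

variable [FiniteDimensional ℝ EM]

/-- For fixed `y` this is the formula on `X`, applied to the slice `f(·, y)`; no bracket on the
product is involved. -/
theorem lieDer_lift₁_bracket (Z W : VF I X) (f : Fn₂ I X) :
    lieDer (lift₁ (bracket Z W)) f =
      lieDer (lift₁ Z) (lieDer (lift₁ W) f) - lieDer (lift₁ W) (lieDer (lift₁ Z) f) := by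
  ext p
  have h := DFunLike.congr_fun (lieDer_bracket Z W (sliceFst f p.2)) p.1
  simp only [lieDer_sliceFst] at h
  exact h

theorem lieDer_lift₂_bracket (Z W : VF I X) (f : Fn₂ I X) :
    lieDer (lift₂ (bracket Z W)) f =
      lieDer (lift₂ Z) (lieDer (lift₂ W) f) - lieDer (lift₂ W) (lieDer (lift₂ Z) f) := by
  ext p
  have h := DFunLike.congr_fun (lieDer_bracket Z W (sliceSnd f p.1)) p.2
  simp only [lieDer_sliceSnd] at h
  exact h

/-- Each component of a tangent vector of the product is detected by functions pulled back from that
factor. On those, one of the two fields acts as zero and the other preserves the pulled-back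
functions, so the commutator vanishes. -/
theorem bracket_lift₁_lift₂ [T2Space X] (Z W : VF I X) : bracket (lift₁ Z) (lift₂ W) = 0 := by
  ext p
  have h0 : ∀ (V : VF (I.prod I) (X × X)), lieReal V 0 = 0 := by
    intro V
    ext q
    change mfderiv (I.prod I) 𝓘(ℝ, ℝ) (fun _ => 0) q (V q) = 0
    rw [mfderiv_const]
    rfl
  have h1 : (show EM × EM from bracket (lift₁ Z) (lift₂ W) p).1 = 0 := by
    refine eq_zero_of_forall_derivAlong (IM := I) (p := p.1) fun f => ?_
    let F : C^∞⟮I.prod I, X × X; 𝓘(ℝ, ℝ), ℝ⟯ := ⟨fun q => f q.1, f.contMDiff.comp contMDiff_fst⟩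
    let F' : C^∞⟮I.prod I, X × X; 𝓘(ℝ, ℝ), ℝ⟯ :=
      ⟨fun q => lieReal Z f q.1, (lieReal Z f).contMDiff.comp contMDiff_fst⟩
    have h2 : lieReal (lift₁ Z) F = F' := by
      ext q
      exact derivAlong_comp_fst (f.contMDiff.mdifferentiableAt (by simp)) _
    have h3 : ∀ g : C^∞⟮I, X; 𝓘(ℝ, ℝ), ℝ⟯, lieReal (lift₂ W)
        (⟨fun q => g q.1, g.contMDiff.comp contMDiff_fst⟩ : C^∞⟮I.prod I, X × X; 𝓘(ℝ, ℝ), ℝ⟯) = 0 := by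
      intro g
      ext q
      refine (derivAlong_comp_fst (g.contMDiff.mdifferentiableAt (by simp)) _).trans ?_
      exact (mfderiv I 𝓘(ℝ, ℝ) g q.1).map_zero
    have h4 := DFunLike.congr_fun (lieReal_bracket (lift₁ Z) (lift₂ W) F) p
    rw [h2, h3, h3, h0, sub_zero] at h4
    refine Eq.trans ?_ h4
    exact (derivAlong_comp_fst (f.contMDiff.mdifferentiableAt (by simp)) _).symm
  have h1' : (show EM × EM from bracket (lift₁ Z) (lift₂ W) p).2 = 0 := by
    refine eq_zero_of_forall_derivAlong (IM := I) (p := p.2) fun f => ?_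
    let F : C^∞⟮I.prod I, X × X; 𝓘(ℝ, ℝ), ℝ⟯ := ⟨fun q => f q.2, f.contMDiff.comp contMDiff_snd⟩
    let F' : C^∞⟮I.prod I, X × X; 𝓘(ℝ, ℝ), ℝ⟯ :=
      ⟨fun q => lieReal W f q.2, (lieReal W f).contMDiff.comp contMDiff_snd⟩
    have h2 : lieReal (lift₂ W) F = F' := by
      ext q
      exact derivAlong_comp_snd (f.contMDiff.mdifferentiableAt (by simp)) _
    have h3 : ∀ g : C^∞⟮I, X; 𝓘(ℝ, ℝ), ℝ⟯, lieReal (lift₁ Z)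
        (⟨fun q => g q.2, g.contMDiff.comp contMDiff_snd⟩ : C^∞⟮I.prod I, X × X; 𝓘(ℝ, ℝ), ℝ⟯) = 0 := by
      intro g
      ext q
      refine (derivAlong_comp_snd (g.contMDiff.mdifferentiableAt (by simp)) _).trans ?_
      exact (mfderiv I 𝓘(ℝ, ℝ) g q.2).map_zero
    have h4 := DFunLike.congr_fun (lieReal_bracket (lift₁ Z) (lift₂ W) F) p
    rw [h2, h3, h3, h0, sub_zero] at h4
    refine Eq.trans ?_ h4
    exact (derivAlong_comp_snd (f.contMDiff.mdifferentiableAt (by simp)) _).symm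
  exact Prod.ext h1 h1'

theorem lieDer_lift_comm [T2Space X] (Z W : VF I X) (f : Fn₂ I X) :
    lieDer (lift₁ Z) (lieDer (lift₂ W) f) = lieDer (lift₂ W) (lieDer (lift₁ Z) f) := by
  rw [← sub_eq_zero, ← lieDer_bracket, bracket_lift₁_lift₂]
  ext p
  exact (mfderiv (I.prod I) 𝓘(ℝ, ℂ) f p).map_zero

end ProductFields

/-! ### Actions of vector fields on jets of functions. -/

section JetActions
variable {EM HM : Type*} [NormedAddCommGroup EM] [NormedSpace ℝ EM]
  [TopologicalSpace HM] {I : ModelWithCorners ℝ EM HM} {X : Type*} [TopologicalSpace X]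
  [ChartedSpace HM X] [IsManifold I ∞ X]

theorem jmk_surjective (a : Jet I X) : ∃ f, jmk f = a := Ideal.Quotient.mk_surjective a

theorem jetDer_jmk (Z : VF (I.prod I) (X × X)) (f : Fn₂ I X) :
    jetDer Z (jmk f) = jmk (lieDer Z f) := rfl

theorem jetDer_add (Z : VF (I.prod I) (X × X)) (a b : Jet I X) :
    jetDer Z (a + b) = jetDer Z a + jetDer Z b := by
  obtain ⟨f, rfl⟩ := jmk_surjective a
  obtain ⟨g, rfl⟩ := jmk_surjective b
  rw [← map_add, jetDer_jmk, lieDer_add, map_add]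
  rfl

theorem jetDer_mul (Z : VF (I.prod I) (X × X)) (a b : Jet I X) :
    jetDer Z (a * b) = jetDer Z a * b + a * jetDer Z b := by
  obtain ⟨f, rfl⟩ := jmk_surjective a
  obtain ⟨g, rfl⟩ := jmk_surjective b
  rw [← map_mul, jetDer_jmk, lieDer_mul, map_add, map_mul, map_mul]
  rfl

theorem jetDer_add_left (Z W : VF (I.prod I) (X × X)) (a : Jet I X) :
    jetDer (Z + W) a = jetDer Z a + jetDer W a := by
  obtain ⟨f, rfl⟩ := jmk_surjective a
  rw [jetDer_jmk, lieDer_add_left, map_add]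
  rfl

theorem act₁_add_left (Z W : VF I X) (a : Jet I X) : act₁ (Z + W) a = act₁ Z a + act₁ W a := by
  rw [act₁, lift₁_add, jetDer_add_left]
  rfl

theorem act₂_add_left (Z W : VF I X) (a : Jet I X) : act₂ (Z + W) a = act₂ Z a + act₂ W a := by
  rw [act₂, lift₂_add, jetDer_add_left]
  rfl

theorem act₁_smulVF (f : C^∞⟮I, X; 𝓘(ℝ, ℝ), ℝ⟯) (Z : VF I X) (a : Jet I X) :
    act₁ (smulVF f Z) a = pr₁ (toFn f) * act₁ Z a := by
  obtain ⟨g, rfl⟩ := jmk_surjective a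
  rw [act₁, jetDer_jmk, lieDer_lift₁_smulVF, map_mul]
  rfl

theorem act₂_smulVF (f : C^∞⟮I, X; 𝓘(ℝ, ℝ), ℝ⟯) (Z : VF I X) (a : Jet I X) :
    act₂ (smulVF f Z) a = pr₂ (toFn f) * act₂ Z a := by
  obtain ⟨g, rfl⟩ := jmk_surjective a
  rw [act₂, jetDer_jmk, lieDer_lift₂_smulVF, map_mul]
  rfl

theorem act₁_pr₁ (Z : VF I X) (f : Fn I X) : act₁ Z (pr₁ f) = pr₁ (lieDer Z f) :=
  congrArg jmk (lieDer_lift₁_pullFst Z f)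

theorem act₂_pr₂ (Z : VF I X) (f : Fn I X) : act₂ Z (pr₂ f) = pr₂ (lieDer Z f) :=
  congrArg jmk (lieDer_lift₂_pullSnd Z f)

theorem act₁_pr₂ (Z : VF I X) (f : Fn I X) : act₁ Z (pr₂ f) = 0 :=
  (congrArg jmk (lieDer_lift₁_pullSnd Z f)).trans (map_zero _)

theorem act₂_pr₁ (Z : VF I X) (f : Fn I X) : act₂ Z (pr₁ f) = 0 :=
  (congrArg jmk (lieDer_lift₂_pullFst Z f)).trans (map_zero _)

theorem jetValue_act (Z : VF I X) (a : Jet I X) :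
    jetValue (act₁ Z a + act₂ Z a) = lieDer Z (jetValue a) := by
  obtain ⟨f, rfl⟩ := jmk_surjective a
  exact restrictDiag_lieDer Z f

theorem pr₁_constFn (c : ℂ) : (pr₁ (constFn c) : Jet I X) = pr₂ (constFn c) := rfl

theorem jetValue_pr₁ (f : Fn I X) : jetValue (pr₁ f) = f := rfl

theorem jetValue_pr₂ (f : Fn I X) : jetValue (pr₂ f) = f := rfl

variable [FiniteDimensional ℝ EM]

theorem act₁_bracket (Z W : VF I X) (a : Jet I X) :
    act₁ Z (act₁ W a) - act₁ W (act₁ Z a) = act₁ (bracket Z W) a := by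
  obtain ⟨f, rfl⟩ := jmk_surjective a
  simp only [act₁, jetDer_jmk, lieDer_lift₁_bracket, map_sub]

theorem act₂_bracket (Z W : VF I X) (a : Jet I X) :
    act₂ Z (act₂ W a) - act₂ W (act₂ Z a) = act₂ (bracket Z W) a := by
  obtain ⟨f, rfl⟩ := jmk_surjective a
  simp only [act₂, jetDer_jmk, lieDer_lift₂_bracket, map_sub]

theorem act_comm [T2Space X] (Z W : VF I X) (a : Jet I X) :
    act₁ Z (act₂ W a) = act₂ W (act₁ Z a) := by
  obtain ⟨f, rfl⟩ := jmk_surjective a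
  simp only [act₁, act₂, jetDer_jmk, lieDer_lift_comm]

end JetActions

/-! ### Local frames of `E`, cut off and extended by zero. -/

section Frames
variable {EM HM : Type*} [NormedAddCommGroup EM] [NormedSpace ℝ EM] [FiniteDimensional ℝ EM]
  [TopologicalSpace HM] {I : ModelWithCorners ℝ EM HM} {X : Type*} [TopologicalSpace X]
  [ChartedSpace HM X] [IsManifold I ∞ X]
  {F : Type*} [NormedAddCommGroup F] [NormedSpace ℂ F]
  {E : X → Type*} [TopologicalSpace (TotalSpace F E)] [∀ x, TopologicalSpace (E x)]
  [∀ x, AddCommGroup (E x)] [∀ x, Module ℂ (E x)] [FiberBundle F E]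
  [VectorBundle ℂ F E] [VectorBundle ℝ F E] [ContMDiffVectorBundle ∞ F E I]

theorem contMDiff_cutoff_frame (e : Trivialization F (TotalSpace.proj : TotalSpace F E → X))
    [MemTrivializationAtlas e] (ψ : Fn I X) (hψ : tsupport ψ ⊆ e.baseSet) (w : F) :
    ContMDiff I (I.prod 𝓘(ℝ, F)) ∞
      (fun y => (⟨y, ψ y • e.symm y w⟩ : TotalSpace F E)) := by
  intro y
  by_cases hy : y ∈ tsupport ψ
  · have hb := hψ hy
    have hm : (⟨y, ψ y • e.symm y w⟩ : TotalSpace F E) ∈ e.source := e.mem_source.2 hb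
    refine (e.contMDiffAt_iff (f := fun y => (⟨y, ψ y • e.symm y w⟩ : TotalSpace F E)) hm).2
      ⟨contMDiffAt_id, ?_⟩
    have h1 : ContMDiffAt I 𝓘(ℝ, F) ∞ (fun q => ψ q • w) y :=
      (contDiff_smul (𝕜 := ℝ) (F := F) (𝕜' := ℂ)).contMDiff.contMDiffAt.comp y
        ((ψ.contMDiff y).prodMk_space contMDiffAt_const)
    refine h1.congr_of_eventuallyEq ?_
    filter_upwards [e.open_baseSet.mem_nhds hb] with q hq
    have h2 := (e.linear ℂ hq).2 (ψ q) (e.symm q w)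
    have h3 : (e ⟨q, e.symm q w⟩).2 = w := by rw [e.apply_mk_symm hq]
    exact h2.trans (by rw [h3])
  · refine ((0 : Sec I F E).contMDiff y).congr_of_eventuallyEq ?_
    filter_upwards [notMem_tsupport_iff_eventuallyEq.1 hy] with q hq
    have : ψ q = 0 := hq
    simp [this]

theorem contMDiff_cutoff_coord {EN HN : Type*} [NormedAddCommGroup EN] [NormedSpace ℝ EN]
    [TopologicalSpace HN] {IN : ModelWithCorners ℝ EN HN} {N : Type*} [TopologicalSpace N]
    [ChartedSpace HN N] {h : N → X}
    (e : Trivialization F (TotalSpace.proj : TotalSpace F E → X))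
    [MemTrivializationAtlas e] (ψ : Fn I X) (hψ : tsupport ψ ⊆ e.baseSet) (l : F →L[ℂ] ℂ)
    {s : ∀ p, E (h p)}
    (hs : ContMDiff IN (I.prod 𝓘(ℝ, F)) ∞ (fun p => (⟨h p, s p⟩ : TotalSpace F E))) :
    ContMDiff IN 𝓘(ℝ, ℂ) ∞ (fun p => ψ (h p) * l (e.linearMapAt ℂ (h p) (s p))) := by
  intro p
  have hh : ContMDiffAt IN I ∞ h p := (contMDiffAt_totalSpace.1 (hs p)).1
  by_cases hy : h p ∈ tsupport ψ
  · have hb := hψ hy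
    have hm : (⟨h p, s p⟩ : TotalSpace F E) ∈ e.source := e.mem_source.2 hb
    have h1 := ((e.contMDiffAt_iff (f := fun p => (⟨h p, s p⟩ : TotalSpace F E)) hm).1 (hs p)).2
    have h2 : ContMDiffAt IN 𝓘(ℝ, ℂ) ∞ (fun p => l (e ⟨h p, s p⟩).2) p :=
      (l.restrictScalars ℝ).contMDiff.contMDiffAt.comp p h1
    refine (((ψ.contMDiff _).comp p hh).mul h2).congr_of_eventuallyEq ?_
    filter_upwards [hh.continuousAt (e.open_baseSet.mem_nhds hb)] with q hq
    rw [e.coe_linearMapAt_of_mem hq]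
    rfl
  · refine (contMDiffAt_const (c := (0 : ℂ))).congr_of_eventuallyEq ?_
    filter_upwards [hh.continuousAt.eventually (notMem_tsupport_iff_eventuallyEq.1 hy)] with q hq
    have : ψ (h q) = 0 := hq
    simp [this]

variable (I F E) in
/-- Sections of `E` and of its dual which, where `χ ≠ 0`, are dual frames up to the factor `χ`. -/
structure Frame (χ : Fn I X) where
  rank : ℕ
  vec : Fin rank → Sec I F E
  covec : Fin rank → ∀ y, E y →ₗ[ℂ] ℂ
  contMDiff_sec : ∀ i (s : Sec I F E), ContMDiff I 𝓘(ℝ, ℂ) ∞ fun y => covec i y (s y)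
  contMDiff_ksec : ∀ i (s : KSec I F E),
    ContMDiff (I.prod I) 𝓘(ℝ, ℂ) ∞ fun p : X × X => covec i p.2 (s.1 p)
  expand : ∀ y (v : E y), χ y • v = ∑ i, covec i y v • vec i y
  dual : ∀ i j y, covec i y (vec j y) = if i = j then χ y else 0

/-- A local trivialisation provides a frame and its dual frame. Both are multiplied by a bump
function `ψ` to make them global, which is why they expand `ψ²` instead of `1`. -/
theorem exists_frame [T2Space X] [FiniteDimensional ℂ F] (x : X) :
    ∃ χ : Fn I X, χ x = 1 ∧ Nonempty (Frame I F E χ) := by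
  obtain ⟨f, -, hf⟩ := (SmoothBumpFunction.nhds_basis_tsupport (I := I) x).mem_iff.1
    ((trivializationAt F E x).open_baseSet.mem_nhds (mem_baseSet_trivializationAt F E x))
  let ψ : Fn I X := toFn ⟨f, f.contMDiff⟩
  have hψ : tsupport ψ ⊆ (trivializationAt F E x).baseSet := by
    refine (closure_mono ?_).trans hf
    intro y hy hy'
    have : ((f y : ℝ) : ℂ) ≠ 0 := hy
    exact this (by rw [hy']; simp)
  let b := Module.finBasis ℂ F
  let e := trivializationAt F E x
  refine ⟨ψ * ψ, ?_, ⟨⟨Module.finrank ℂ F,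
    fun i => ⟨fun y => ψ y • e.symm y (b i), contMDiff_cutoff_frame e ψ hψ _⟩,
    fun i y => ψ y • (b.coord i ∘ₗ e.linearMapAt ℂ y),
    fun i s => contMDiff_cutoff_coord e ψ hψ (LinearMap.toContinuousLinearMap (b.coord i))
      s.contMDiff,
    fun i s => contMDiff_cutoff_coord e ψ hψ (LinearMap.toContinuousLinearMap (b.coord i))
      s.2, ?_, ?_⟩⟩⟩
  · change ((f x : ℝ) : ℂ) * ((f x : ℝ) : ℂ) = 1
    rw [f.eq_one]
    simp
  · intro y v
    by_cases hy : ψ y = 0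
    · change (ψ y * ψ y) • v = ∑ i, (ψ y * _) • ψ y • _
      simp [hy]
    · have hb : y ∈ e.baseSet := hψ (subset_tsupport _ hy)
      have h1 : e.symm y (e.linearMapAt ℂ y v) = v := e.symm_linearMapAt hb v
      have h2 : ∑ i, b.coord i (e.linearMapAt ℂ y v) • e.symm y (b i) = v := by
        conv_rhs => rw [← h1, ← b.sum_repr (e.linearMapAt ℂ y v)]
        rw [← e.coe_symmₗ (R := ℂ) hb, map_sum]
        refine Finset.sum_congr rfl fun i _ => ?_
        rw [map_smul]
        rfl
      change (ψ y * ψ y) • v = ∑ i, (ψ y * b.coord i (e.linearMapAt ℂ y v)) • ψ y • e.symm y (b i)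
      conv_lhs => rw [← h2, Finset.smul_sum]
      refine Finset.sum_congr rfl fun i _ => ?_
      rw [smul_smul, smul_smul]
      ring_nf
  · intro i j y
    change ψ y * b.coord i (e.linearMapAt ℂ y (ψ y • e.symm y (b j))) = if i = j then ψ y * ψ y else 0
    by_cases hy : ψ y = 0
    · simp [hy]
    · have hb : y ∈ e.baseSet := hψ (subset_tsupport _ hy)
      have h1 : e.linearMapAt ℂ y (e.symm y (b j)) = b j := by
        rw [← e.coe_symmₗ (R := ℂ) hb]
        exact e.linearMapAt_symmₗ hb _
      rw [map_smul, h1, map_smul, Module.Basis.coord_apply, b.repr_self, smul_eq_mul,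
        Finsupp.single_apply]
      by_cases hij : i = j
      · simp [hij]
      · simp [hij, Ne.symm hij]

end Frames

/-! ### Dual bases for sections and for their jets; separation. -/

section FrameModules
variable {EM HM : Type*} [NormedAddCommGroup EM] [NormedSpace ℝ EM] [FiniteDimensional ℝ EM]
  [TopologicalSpace HM] {I : ModelWithCorners ℝ EM HM} {X : Type*} [TopologicalSpace X]
  [ChartedSpace HM X] [IsManifold I ∞ X]
  {F : Type*} [NormedAddCommGroup F] [NormedSpace ℂ F]
  {E : X → Type*} [TopologicalSpace (TotalSpace F E)] [∀ x, TopologicalSpace (E x)]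
  [∀ x, AddCommGroup (E x)] [∀ x, Module ℂ (E x)] [FiberBundle F E]
  [VectorBundle ℂ F E] [VectorBundle ℝ F E] [ContMDiffVectorBundle ∞ F E I]

theorem map_mem_flat {N N' : Type*} [AddCommGroup N] [Module (Fn₂ I X) N] [AddCommGroup N']
    [Module (Fn₂ I X) N'] (T : N →ₗ[Fn₂ I X] N') {m : N} (hm : m ∈ flat I X N) :
    T m ∈ flat I X N' := by
  rw [flat, Submodule.mem_iInf] at hm ⊢
  intro k x
  obtain ⟨χ, h1, h2⟩ := hm k x
  refine ⟨χ, h1, ?_⟩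
  rw [← map_smul]
  have h3 := Submodule.mem_map_of_mem (f := T) h2
  rw [Submodule.map_smul''] at h3
  exact Submodule.smul_mono le_rfl le_top h3

theorem jetE_mk_surjective (m : JetE I F E) :
    ∃ s : KSec I F E, (Submodule.Quotient.mk s : JetE I F E) = m :=
  Submodule.Quotient.mk_surjective _ m

/-- A function on families, linear over the functions of two variables, as a function on jets. -/
def jetCovec (T : KSec I F E →ₗ[Fn₂ I X] Fn₂ I X) : JetE I F E →ₗ[Jet I X] Jet I X where
  toFun := Submodule.mapQ _ _ T fun _ => map_mem_flat T
  map_add' := map_add _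
  map_smul' a m := by
    obtain ⟨f, rfl⟩ := jmk_surjective a
    obtain ⟨s, rfl⟩ := jetE_mk_surjective m
    rw [jmk_smul_mk]
    exact (congrArg jmk (map_smul T f s)).trans (map_mul _ _ _)

namespace Frame
variable {χ : Fn I X} (B : Frame I F E χ)

/-- The functions of the dual frame on sections. -/
def secCovec (i : Fin B.rank) : Sec I F E →ₗ[Fn I X] Fn I X where
  toFun s := ⟨fun y => B.covec i y (s y), B.contMDiff_sec i s⟩
  map_add' s t := by ext y; exact map_add (B.covec i y) _ _
  map_smul' f s := by ext y; exact map_smul (B.covec i y) _ _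

/-- The functions of the dual frame on families of sections. -/
def ksecCovec (i : Fin B.rank) : KSec I F E →ₗ[Fn₂ I X] Fn₂ I X where
  toFun s := ⟨fun p => B.covec i p.2 (s.1 p), B.contMDiff_ksec i s⟩
  map_add' s t := by ext y; exact map_add (B.covec i _) _ _
  map_smul' f s := by ext y; exact map_smul (B.covec i _) _ _

theorem sum_apply {r : ℕ} (f : Fin r → Fn I X) (s : Fin r → Sec I F E) (y : X) :
    (∑ i, f i • s i) y = ∑ i, f i y • s i y := by
  let ev : Sec I F E →+ E y := ⟨⟨fun s => s y, rfl⟩, fun _ _ => rfl⟩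
  exact map_sum ev _ _

theorem ksum_apply {r : ℕ} (f : Fin r → Fn₂ I X) (s : Fin r → KSec I F E) (p : X × X) :
    (∑ i, f i • s i).1 p = ∑ i, f i p • (s i).1 p := by
  let ev : KSec I F E →+ E p.2 := ⟨⟨fun s => s.1 p, rfl⟩, fun _ _ => rfl⟩
  exact map_sum ev _ _

/-- The local dual basis of the module of sections. -/
def secBasis : DualBasis (N := Sec I F E) (Fn I X) Set.univ χ where
  rank := B.rank
  vec := B.vec
  covec := B.secCovec
  vec_mem _ := Set.mem_univ _
  expand s := by
    ext y
    rw [sum_apply]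
    exact B.expand y (s y)

theorem ksec_expand (s : KSec I F E) :
    pullSnd χ • s = ∑ i, B.ksecCovec i s • pullSec (B.vec i) := by
  ext p
  rw [ksum_apply]
  exact B.expand p.2 (s.1 p)

/-- The local dual basis of the module of jets of sections. -/
def jetBasis : DualBasis (N := JetE I F E) (Jet I X) (Set.range jetProlong) (pr₂ χ) where
  rank := B.rank
  vec i := jetProlong (B.vec i)
  covec i := jetCovec (B.ksecCovec i)
  vec_mem i := ⟨_, rfl⟩
  expand m := by
    obtain ⟨s, rfl⟩ := jetE_mk_surjective m
    refine (congrArg (Submodule.Quotient.mk (p := flat I X (KSec I F E)))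
      (B.ksec_expand s)).trans ?_
    change Submodule.mkQ _ _ = _
    rw [map_sum]
    rfl

theorem secCovec_vec (i j : Fin B.rank) : B.secCovec i (B.vec j) = if i = j then χ else 0 := by
  ext y
  refine (B.dual i j y).trans ?_
  split_ifs <;> rfl

theorem jetValue_jetCovec (i : Fin B.rank) (m : JetE I F E) :
    jetValue (jetCovec (B.ksecCovec i) m) = B.secCovec i (value m) := by
  obtain ⟨s, rfl⟩ := jetE_mk_surjective m
  rfl

end Frame

/-- A local dual basis without a condition on its vectors. -/
def DualBasis.toUniv {S N : Type*} [CommRing S] [AddCommGroup N] [Module S N] {G : Set N} {χ : S}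
    (B : DualBasis S G χ) : DualBasis S (Set.univ : Set N) χ :=
  { B with vec_mem := fun _ => Set.mem_univ _ }

theorem fn_eq_zero_of_mul {χ : X → Fn I X} (hχ : ∀ x, χ x x = 1) (f : Fn I X)
    (h : ∀ x, χ x * f = 0) : f = 0 := by
  ext x
  have h2 : χ x x * f x = 0 := DFunLike.congr_fun (h x) x
  rwa [hχ, one_mul] at h2

/-- Flatness along the diagonal is local at the points `(x, x)`: the localising functions in the
definition may be multiplied by `χ x`. -/
theorem mem_flat_of_smul {N : Type*} [AddCommGroup N] [Module (Fn₂ I X) N] {χ : X → Fn₂ I X}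
    (hχ : ∀ x, χ x (x, x) = 1) {m : N} (h : ∀ x, χ x • m ∈ flat I X N) : m ∈ flat I X N := by
  rw [flat, Submodule.mem_iInf]
  intro k x
  have h2 := h x
  rw [flat, Submodule.mem_iInf] at h2
  obtain ⟨ψ, h3, h4⟩ := h2 k x
  refine ⟨ψ * χ x, ?_, ?_⟩
  · change ψ (x, x) * χ x (x, x) = 1
    rw [h3, hχ, one_mul]
  · rwa [mul_smul]

theorem jet_eq_zero_of_mul {χ : X → Jet I X} (hχ : ∀ x, jetValue (χ x) x = 1) (a : Jet I X)
    (h : ∀ x, χ x * a = 0) : a = 0 := by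
  obtain ⟨f, rfl⟩ := jmk_surjective a
  choose ψ hψ using fun x => jmk_surjective (χ x)
  refine Ideal.Quotient.eq_zero_iff_mem.2 (mem_flat_of_smul (χ := ψ) (fun x => ?_) fun x => ?_)
  · rw [← hχ x, ← hψ x]
    rfl
  · refine Ideal.Quotient.eq_zero_iff_mem.1 ?_
    have h2 := h x
    rw [← hψ x] at h2
    exact h2

theorem jetE_eq_zero_of_smul {χ : X → Jet I X} (hχ : ∀ x, jetValue (χ x) x = 1) (m : JetE I F E)
    (h : ∀ x, χ x • m = 0) : m = 0 := by
  obtain ⟨s, rfl⟩ := jetE_mk_surjective m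
  choose ψ hψ using fun x => jmk_surjective (χ x)
  refine (Submodule.Quotient.mk_eq_zero _).2
    (mem_flat_of_smul (χ := ψ) (fun x => ?_) fun x => ?_)
  · rw [← hχ x, ← hψ x]
    rfl
  · refine (Submodule.Quotient.mk_eq_zero _).1 ?_
    have h2 := h x
    rw [← hψ x] at h2
    exact h2

end FrameModules

/-! ### Gluing of jets along the diagonal. -/

section Gluing
variable {EM HM : Type*} [NormedAddCommGroup EM] [NormedSpace ℝ EM] [FiniteDimensional ℝ EM]
  [TopologicalSpace HM] {I : ModelWithCorners ℝ EM HM} {X : Type*} [TopologicalSpace X]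
  [ChartedSpace HM X] [IsManifold I ∞ X]

theorem contMDiff_div_of_tsupport_subset {EN HN : Type*} [NormedAddCommGroup EN]
    [NormedSpace ℝ EN] [TopologicalSpace HN] {IN : ModelWithCorners ℝ EN HN} {N : Type*}
    [TopologicalSpace N] [ChartedSpace HN N] (f g : Fn IN N)
    (h : ∀ p ∈ tsupport f, g p ≠ 0) : ContMDiff IN 𝓘(ℝ, ℂ) ∞ fun p => f p * (g p)⁻¹ := by
  intro p
  by_cases hp : p ∈ tsupport f
  · exact (f.contMDiff p).mul
      ((contDiffAt_inv ℝ (h p hp)).contMDiffAt.comp p (g.contMDiff p))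
  · refine (contMDiffAt_const (c := (0 : ℂ))).congr_of_eventuallyEq ?_
    filter_upwards [notMem_tsupport_iff_eventuallyEq.1 hp] with q hq
    have : f q = 0 := hq
    simp [this]

variable (I X) in
/-- Locally finite sums exist in a module over the functions of two variables. -/
def HasLocallyFiniteSums (N : Type*) [AddCommGroup N] [Module (Fn₂ I X) N] : Prop :=
  ∀ (g : X → Fn₂ I X) (n : X → N), LocallyFinite (fun x => Function.support (g x)) →
    ∃ m, ∀ (φ : Fn₂ I X) (s : Finset X), (∀ x ∉ s, φ * g x = 0) →
      φ • m = φ • ∑ x ∈ s, g x • n x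

theorem fn_sum_apply {EN HN : Type*} [NormedAddCommGroup EN]
    [NormedSpace ℝ EN] [TopologicalSpace HN] {IN : ModelWithCorners ℝ EN HN} {N : Type*}
    [TopologicalSpace N] [ChartedSpace HN N] {ι : Type*} (s : Finset ι) (f : ι → Fn IN N) (p : N) :
    (∑ i ∈ s, f i) p = ∑ i ∈ s, f i p := by
  let ev : Fn IN N →+ ℂ := ⟨⟨fun f => f p, rfl⟩, fun _ _ => rfl⟩
  exact map_sum ev _ _

/-- The sets `ψ x ≠ 0` and the complement of the diagonal cover `X × X`. Dividing the members of a
subordinate partition of unity by `ψ x` gives `g x`, smooth because their supports avoid the zeros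
of `ψ x`, and `∑ g x ψ x = 1` near the diagonal. -/
theorem exists_partition [T2Space X] [SigmaCompactSpace X] {ψ : X → Fn₂ I X}
    (hψ : ∀ x, ψ x (x, x) = 1) :
    ∃ g : X → Fn₂ I X, LocallyFinite (fun x => Function.support (g x)) ∧
      ∀ z : X, ∃ (φ : Fn₂ I X) (s : Finset X), φ (z, z) = 1 ∧ (∀ x ∉ s, φ * g x = 0) ∧
        φ * ∑ x ∈ s, g x * ψ x = φ := by
  let U : Option X → Set (X × X) := fun o => o.elim (Set.diagonal X)ᶜ fun x => {p | ψ x p ≠ 0}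
  have hU : ∀ o, IsOpen (U o)
    | none => isClosed_diagonal.isOpen_compl
    | some x => isOpen_ne.preimage (ψ x).contMDiff.continuous
  obtain ⟨ρ, hρ⟩ := SmoothPartitionOfUnity.exists_isSubordinate (I.prod I) isClosed_univ U hU
    (by
      rintro ⟨x, y⟩ -
      by_cases hxy : x = y
      · refine Set.mem_iUnion.2 ⟨some x, ?_⟩
        change ψ x (x, y) ≠ 0
        rw [← hxy, hψ]
        exact one_ne_zero
      · exact Set.mem_iUnion.2 ⟨none, hxy⟩)
  have hts : ∀ o, tsupport (toFn (ρ o)) ⊆ U o := fun o =>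
    (closure_mono (t := Function.support (ρ o)) fun p (hp : toFn (ρ o) p ≠ 0) hp' => hp (by
      change ((ρ o p : ℝ) : ℂ) = 0
      rw [hp']; simp)).trans (hρ o)
  let g : X → Fn₂ I X := fun x => ⟨fun p => toFn (ρ (some x)) p * (ψ x p)⁻¹,
    contMDiff_div_of_tsupport_subset _ _ fun p hp => hts (some x) hp⟩
  have hg : ∀ x p, ρ (some x) p = 0 → g x p = 0 := fun x p hp => by
    change ((ρ (some x) p : ℝ) : ℂ) * _ = 0
    rw [hp]; simp
  have hgψ : ∀ x p, g x p * ψ x p = ((ρ (some x) p : ℝ) : ℂ) := fun x p => by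
    by_cases hp : ψ x p = 0
    · have : p ∉ tsupport (ρ (some x)) := fun h => hρ (some x) h hp
      rw [hp, mul_zero, image_eq_zero_of_notMem_tsupport this]
      simp
    · exact inv_mul_cancel_right₀ hp _
  refine ⟨g, ?_, fun z => ?_⟩
  · have h1 := ρ.locallyFinite.comp_injective (Option.some_injective X)
    exact h1.subset fun x p hp hp' => hp (hg x p hp')
  -- The bump function `φ` is supported where only finitely many members of the partition are
  -- nonzero and the member for the complement of the diagonal vanishes; there the remaining members
  -- add up to one.
  · obtain ⟨V, hV, hfin⟩ := ρ.locallyFinite (z, z)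
    have hz : (tsupport (ρ none))ᶜ ∈ nhds (z, z) :=
      (isClosed_tsupport _).isOpen_compl.mem_nhds fun h => hρ none h rfl
    obtain ⟨f, -, hf⟩ := (SmoothBumpFunction.nhds_basis_tsupport (I := I.prod I) (z, z)).mem_iff.1
      (Filter.inter_mem hV hz)
    let φ : Fn₂ I X := toFn ⟨f, f.contMDiff⟩
    have hφ : ∀ p, φ p ≠ 0 → p ∈ V ∧ p ∉ tsupport (ρ none) := fun p hp => by
      refine hf (subset_tsupport _ fun h => hp ?_)
      change ((f p : ℝ) : ℂ) = 0
      rw [h]; simp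
    let T : Finset (Option X) := hfin.toFinset
    have hT : ∀ o, o ∉ T → ∀ p ∈ V, ρ o p = 0 := fun o ho p hp => by
      by_contra h
      exact ho (hfin.mem_toFinset.2 ⟨p, h, hp⟩)
    have hs : ∀ x, x ∉ T.eraseNone → some x ∉ T := fun x hx h =>
      hx (Finset.mem_eraseNone.2 h)
    refine ⟨φ, T.eraseNone, ?_, fun x hx => ?_, ?_⟩
    · change ((f (z, z) : ℝ) : ℂ) = 1
      rw [f.eq_one]; simp
    · ext p
      change φ p * g x p = 0
      by_cases hp : φ p = 0
      · rw [hp, zero_mul]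
      · rw [hg x p (hT _ (hs x hx) p (hφ p hp).1), mul_zero]
    · ext p
      change φ p * (∑ x ∈ T.eraseNone, g x * ψ x : Fn₂ I X) p = φ p
      by_cases hp : φ p = 0
      · rw [hp, zero_mul]
      · have h1 : (∑ x ∈ T.eraseNone, g x * ψ x : Fn₂ I X) p =
            ∑ x ∈ T.eraseNone, ((ρ (some x) p : ℝ) : ℂ) := by
          rw [fn_sum_apply]
          exact Finset.sum_congr rfl fun x _ => hgψ x p
        have h0 : ρ none p = 0 := image_eq_zero_of_notMem_tsupport (hφ p hp).2
        have h2 : ∑ x ∈ T.eraseNone, ρ (some x) p = 1 := by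
          rw [← ρ.sum_eq_one (Set.mem_univ p), finsum_eq_sum_of_support_subset (s := T) _ ?_]
          · refine (Finset.sum_map T.eraseNone Function.Embedding.some fun o => ρ o p).symm.trans ?_
            refine Finset.sum_subset (fun o ho => ?_) fun o ho ho' => ?_
            · obtain ⟨x, hx, rfl⟩ := Finset.mem_map.1 ho
              exact Finset.mem_eraseNone.1 hx
            · cases o with
              | none => exact h0
              | some x =>
                exact absurd (Finset.mem_map.2 ⟨x, Finset.mem_eraseNone.2 ho, rfl⟩) ho'
          · intro o ho
            by_contra h
            exact ho (hT o h p (hφ p hp).1)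
        rw [h1, ← Complex.ofReal_sum, h2]
        simp

/-- The glued element is `m = ∑ g x • n x`. Near the diagonal `ψ y • m - n y = ∑ g x • (ψ y • n x -
ψ x • n y)`, which is flat by compatibility. -/
theorem glue_mod_flat [T2Space X] [SigmaCompactSpace X] {N : Type*} [AddCommGroup N]
    [Module (Fn₂ I X) N] (hN : HasLocallyFiniteSums I X N) {ψ : X → Fn₂ I X}
    (hψ : ∀ x, ψ x (x, x) = 1) {n : X → N}
    (h : ∀ x y, ψ y • n x - ψ x • n y ∈ flat I X N) :
    ∃ m, ∀ y, ψ y • m - n y ∈ flat I X N := by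
  obtain ⟨g, hg, hφ⟩ := exists_partition hψ
  choose φ s h1 h2 h3 using hφ
  obtain ⟨m, hm⟩ := hN g n hg
  refine ⟨m, fun y => mem_flat_of_smul (χ := φ) h1 fun z => ?_⟩
  have h4 : φ z • (ψ y • m - n y) =
      φ z • ∑ x ∈ s z, g x • (ψ y • n x - ψ x • n y) := by
    have h5 : φ z • n y = (φ z * ∑ x ∈ s z, g x * ψ x) • n y := by rw [h3 z]
    rw [smul_sub, smul_comm, hm _ _ (h2 z), h5, mul_smul, smul_comm (ψ y), ← smul_sub,
      Finset.smul_sum, Finset.sum_smul, ← Finset.sum_sub_distrib]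
    congr 1
    refine Finset.sum_congr rfl fun x _ => ?_
    rw [smul_sub, mul_smul, smul_comm (ψ y)]
  rw [h4]
  exact Submodule.smul_mem _ _ (Submodule.sum_mem _ fun x _ => Submodule.smul_mem _ _ (h x y))

theorem LocallyFinite.exists_finset {N ι : Type*} [TopologicalSpace N] {f : ι → Set N}
    (hf : LocallyFinite f) (p : N) : ∃ s : Finset ι, ∀ᶠ q in nhds p, ∀ i ∉ s, q ∉ f i := by
  obtain ⟨V, hV, hfin⟩ := hf p
  refine ⟨hfin.toFinset, ?_⟩
  filter_upwards [hV] with q hq i hi hqi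
  exact hi (hfin.mem_toFinset.2 ⟨q, hqi, hq⟩)

theorem finsum_smul_eq_sum {ι S M : Type*} [Ring S] [AddCommGroup M] [Module S M] (g : ι → S)
    (n : ι → M) (s : Finset ι) (h : ∀ i ∉ s, g i = 0) :
    ∑ᶠ i, g i • n i = ∑ i ∈ s, g i • n i := by
  refine finsum_eq_sum_of_support_subset _ fun i hi => ?_
  by_contra his
  exact hi (by simp only [h i his, zero_smul])

theorem hasLocallyFiniteSums_fn : HasLocallyFiniteSums I X (Fn₂ I X) := by
  intro g n hg
  refine ⟨⟨fun p => ∑ᶠ x, g x p • n x p, fun p => ?_⟩, fun φ s hs => ?_⟩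
  · obtain ⟨s, hs⟩ := LocallyFinite.exists_finset hg p
    refine ((∑ x ∈ s, g x • n x : Fn₂ I X).contMDiff p).congr_of_eventuallyEq ?_
    filter_upwards [hs] with q hq
    rw [finsum_smul_eq_sum _ _ s fun x hx => by simpa using hq x hx, fn_sum_apply]
    rfl
  · ext p
    change φ p * ∑ᶠ x, g x p • n x p = φ p * (∑ x ∈ s, g x • n x : Fn₂ I X) p
    by_cases hp : φ p = 0
    · rw [hp, zero_mul, zero_mul]
    · rw [finsum_smul_eq_sum _ _ s fun x hx => ?_, fn_sum_apply]
      · rfl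
      · have := DFunLike.congr_fun (hs x hx) p
        exact (mul_eq_zero.1 this).resolve_left hp

variable {F : Type*} [NormedAddCommGroup F] [NormedSpace ℂ F]
  {E : X → Type*} [TopologicalSpace (TotalSpace F E)] [∀ x, TopologicalSpace (E x)]
  [∀ x, AddCommGroup (E x)] [∀ x, Module ℂ (E x)] [FiberBundle F E]
  [VectorBundle ℂ F E] [VectorBundle ℝ F E] [ContMDiffVectorBundle ∞ F E I]

theorem ksec_sum_apply (s : Finset X) (g : X → Fn₂ I X) (n : X → KSec I F E) (p : X × X) :
    (∑ x ∈ s, g x • n x).1 p = ∑ x ∈ s, g x p • (n x).1 p := by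
  let ev : KSec I F E →+ E p.2 := ⟨⟨fun s => s.1 p, rfl⟩, fun _ _ => rfl⟩
  exact map_sum ev _ _

theorem hasLocallyFiniteSums_ksec : HasLocallyFiniteSums I X (KSec I F E) := by
  intro g n hg
  refine ⟨⟨fun p => ∑ᶠ x, g x p • (n x).1 p, fun p => ?_⟩, fun φ s hs => ?_⟩
  · obtain ⟨s, hs⟩ := LocallyFinite.exists_finset hg p
    refine ((∑ x ∈ s, g x • n x : KSec I F E).2 p).congr_of_eventuallyEq ?_
    filter_upwards [hs] with q hq
    rw [finsum_smul_eq_sum _ _ s fun x hx => by simpa using hq x hx, ksec_sum_apply]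
  · ext p
    change φ p • ∑ᶠ x, g x p • (n x).1 p = φ p • (∑ x ∈ s, g x • n x : KSec I F E).1 p
    by_cases hp : φ p = 0
    · rw [hp, zero_smul, zero_smul]
    · rw [finsum_smul_eq_sum _ _ s fun x hx => ?_, ksec_sum_apply]
      have := DFunLike.congr_fun (hs x hx) p
      exact (mul_eq_zero.1 this).resolve_left hp

theorem jet_glue [T2Space X] [SigmaCompactSpace X] {χ : X → Jet I X}
    (hχ : ∀ x, jetValue (χ x) x = 1) (t : X → Jet I X) (h : ∀ x y, χ y * t x = χ x * t y) :
    ∃ t', ∀ x, χ x * t' = t x := by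
  choose ψ hψ using fun x => jmk_surjective (χ x)
  choose n hn using fun x => jmk_surjective (t x)
  obtain ⟨m, hm⟩ := glue_mod_flat hasLocallyFiniteSums_fn (ψ := ψ) (n := n) (fun x => by
    rw [← hχ x, ← hψ x]; rfl) (fun x y => by
      refine Ideal.Quotient.eq_zero_iff_mem.1 ?_
      change jmk (ψ y * n x - ψ x * n y) = 0
      rw [map_sub, map_mul, map_mul, hψ, hψ, hn, hn, h, sub_self])
  refine ⟨jmk m, fun x => ?_⟩
  have h2 : jmk (ψ x * m - n x) = 0 := Ideal.Quotient.eq_zero_iff_mem.2 (hm x)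
  rwa [map_sub, map_mul, hψ, hn, sub_eq_zero] at h2

theorem jetE_glue [T2Space X] [SigmaCompactSpace X] {χ : X → Jet I X}
    (hχ : ∀ x, jetValue (χ x) x = 1) (t : X → JetE I F E) (h : ∀ x y, χ y • t x = χ x • t y) :
    ∃ t', ∀ x, χ x • t' = t x := by
  choose ψ hψ using fun x => jmk_surjective (χ x)
  choose n hn using fun x => jetE_mk_surjective (t x)
  obtain ⟨m, hm⟩ := glue_mod_flat hasLocallyFiniteSums_ksec (ψ := ψ) (n := n) (fun x => by
    rw [← hχ x, ← hψ x]; rfl) (fun x y => by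
      refine (Submodule.Quotient.mk_eq_zero _).1 ?_
      rw [Submodule.Quotient.mk_sub, ← jmk_smul_mk, ← jmk_smul_mk, hψ, hψ, hn, hn, h, sub_self])
  refine ⟨Submodule.Quotient.mk m, fun x => ?_⟩
  have h2 := (Submodule.Quotient.mk_eq_zero _).2 (hm x)
  rwa [Submodule.Quotient.mk_sub, ← jmk_smul_mk, hψ, hn, sub_eq_zero] at h2

/-- Functions on `X` are determined by values, so no partition of unity is needed: at `x` the glued
function takes the value `t x x`, and near `x` it equals `t x / χ x`. -/
theorem fn_glue {χ : X → Fn I X} (hχ : ∀ x, χ x x = 1) (t : X → Fn I X)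
    (h : ∀ x y, χ y * t x = χ x * t y) : ∃ t', ∀ x, χ x * t' = t x := by
  have key : ∀ x y, χ x y * t y y = t x y := fun x y => by
    have h1 : χ y y * t x y = χ x y * t y y := DFunLike.congr_fun (h x y) y
    rw [← h1, hχ, one_mul]
  refine ⟨⟨fun x => t x x, fun x => ?_⟩, fun x => ?_⟩
  · have hne : χ x x ≠ 0 := by rw [hχ]; exact one_ne_zero
    have h2 : ContMDiffAt I 𝓘(ℝ, ℂ) ∞ (fun y => (χ x y)⁻¹ * t x y) x :=
      ((contDiffAt_inv ℝ hne).contMDiffAt.comp x ((χ x).contMDiff x)).mul ((t x).contMDiff x)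
    refine h2.congr_of_eventuallyEq ?_
    filter_upwards [(χ x).contMDiff.continuous.continuousAt.eventually_ne hne] with y hy
    rw [← key x y, inv_mul_cancel_left₀ hy]
  · ext y
    exact key x y

end Gluing

/-! ### Derivations of modules with a given symbol. -/

section Derivations
variable {S N : Type*} [CommRing S] [AddCommGroup N] [Module S N]

/-- `D` is a derivation of the module `N` with symbol `ρ`. -/
structure IsDer (ρ : S → S) (D : N → N) : Prop where
  map_add : ∀ m m', D (m + m') = D m + D m'
  leibniz : ∀ (a : S) m, D (a • m) = ρ a • m + a • D m

namespace IsDer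
variable {ρ ρ' : S → S} {D D' : N → N}

theorem map_zero (h : IsDer ρ D) : D 0 = 0 := by
  have h1 := h.map_add 0 0
  rwa [add_zero, left_eq_add] at h1

theorem map_sum (h : IsDer ρ D) {ι : Type*} (s : Finset ι) (m : ι → N) :
    D (∑ i ∈ s, m i) = ∑ i ∈ s, D (m i) := by
  let T : N →+ N := ⟨⟨D, h.map_zero⟩, h.map_add⟩
  exact _root_.map_sum T m s

theorem zero : IsDer (0 : S → S) (0 : N → N) where
  map_add _ _ := by simp
  leibniz _ _ := by simp

theorem add (h : IsDer ρ D) (h' : IsDer ρ' D') :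
    IsDer (fun a => ρ a + ρ' a) (fun m => D m + D' m) where
  map_add m m' := by rw [h.map_add, h'.map_add]; abel
  leibniz a m := by rw [h.leibniz, h'.leibniz]; module

theorem sub (h : IsDer ρ D) (h' : IsDer ρ' D') :
    IsDer (fun a => ρ a - ρ' a) (fun m => D m - D' m) where
  map_add m m' := by rw [h.map_add, h'.map_add]; abel
  leibniz a m := by rw [h.leibniz, h'.leibniz]; module

theorem smul (h : IsDer ρ D) (c : S) : IsDer (fun a => c * ρ a) (fun m => c • D m) where
  map_add m m' := by rw [h.map_add, smul_add]
  leibniz a m := by rw [h.leibniz]; module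

theorem comm (h : IsDer ρ D) (h' : IsDer ρ' D') :
    IsDer (fun a => ρ (ρ' a) - ρ' (ρ a)) (fun m => D (D' m) - D' (D m)) where
  map_add m m' := by rw [h'.map_add, h.map_add, h.map_add, h'.map_add]; abel
  leibniz a m := by
    rw [h'.leibniz, h.map_add, h.leibniz, h.leibniz, h.leibniz, h'.map_add, h'.leibniz,
      h'.leibniz]
    module

theorem congr (h : IsDer ρ D) (e : ∀ a, ρ a = ρ' a) : IsDer ρ' D := by
  rwa [← (funext e : ρ = ρ')]

theorem exists_linear (h : IsDer ρ D) (e : ∀ a, ρ a = 0) : ∃ T : N →ₗ[S] N, ∀ m, D m = T m :=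
  ⟨{ toFun := D, map_add' := h.map_add, map_smul' := fun a m => by
      rw [h.leibniz, e, zero_smul, zero_add]; rfl }, fun _ => rfl⟩

end IsDer

theorem IsDer.ext {P : Type*} {G : Set N} {χ : P → S} (B : ∀ p, DualBasis S G (χ p))
    (sep : ∀ m : N, (∀ p, χ p • m = 0) → m = 0) {ρ : S → S} {D D' : N → N} (h : IsDer ρ D)
    (h' : IsDer ρ D') (e : ∀ m ∈ G, D m = D' m) (m : N) : D m = D' m :=
  DualBasis.derivation_ext B sep h.map_add h'.map_add h.leibniz h'.leibniz e m

end Derivations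

/-! ### Extension of derivations to a larger module. -/

section Extension
variable {S N R Q P : Type*} [CommRing S] [AddCommGroup N] [Module S N] [CommRing R]
  [AddCommGroup Q] [Module R Q]

/-- A local dual basis, up to the factor `u = w φ(χ)`, of the `S`-module `N` which comes from a
local dual basis, up to the factor `χ`, of the `R`-module `Q`. -/
structure InducedBasis (φ : R →+* S) (f : Q → N) (u : S) where
  rank : ℕ
  vec : Fin rank → Q
  covec : Fin rank → N →ₗ[S] S
  expand : ∀ m, u • m = ∑ i, covec i m • f (vec i)
  base : R
  baseCovec : Fin rank → Q → R
  base_expand : ∀ q, base • q = ∑ i, baseCovec i q • vec i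
  factor : S
  covec_apply : ∀ i q, covec i (f q) = factor * φ (baseCovec i q)
  eq_mul : u = factor * φ base

/-- The dual basis underlying an induced one. -/
def InducedBasis.toDualBasis {φ : R →+* S} {f : Q → N} {u : S} (B : InducedBasis φ f u) :
    DualBasis S (Set.range f) u where
  rank := B.rank
  vec i := f (B.vec i)
  covec := B.covec
  vec_mem _ := ⟨_, rfl⟩
  expand := B.expand

namespace InducedBasis
variable {φ : R →+* S} {f : Q → N} {u : S} (B : InducedBasis φ f u) (ρ : S → S) (d : Q → Q)

/-- `u` times the derivation with symbol `ρ` which extends `d`. -/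
def der (m : N) : N :=
  ∑ i, (ρ (B.covec i m) • f (B.vec i) + B.covec i m • f (d (B.vec i))) - ρ u • m

variable {ρ d} {ρR : R → R}

/-- An extension `D` of `d` would satisfy `u • D m = D (u • m) - ρ u • m`, and `der` is the
right-hand side with `u • m` expanded in the basis. Accordingly its symbol is `u ρ`. -/
theorem isDer_der (hρ : IsDer ρ ρ) : IsDer (fun a => u * ρ a) (B.der ρ d) where
  map_add m m' := by
    simp only [der, map_add, hρ.map_add, add_smul, smul_add, Finset.sum_add_distrib]
    abel
  leibniz a m := by
    have h1 : ρ a • u • m = ∑ i, (ρ a * B.covec i m) • f (B.vec i) := by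
      rw [B.expand, Finset.smul_sum]
      exact Finset.sum_congr rfl fun i _ => (mul_smul _ _ _).symm
    have h2 : ∀ b c : S, ρ (b * c) = ρ b * c + b * ρ c := hρ.leibniz
    rw [mul_comm u, mul_smul, h1]
    simp only [der, map_smul, smul_eq_mul, h2, add_smul, smul_add, smul_sub, Finset.smul_sum,
      Finset.sum_add_distrib, mul_smul, smul_comm a (ρ u) m]
    abel

/-- On the image of `f` the coordinates come from `Q`, up to a common factor. The sum can therefore
be evaluated in `Q` by the Leibniz rule of `d`, and the derivatives of the factors cancel against `ρ
u`. -/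
theorem der_apply (hρ : IsDer ρ ρ) (hd : IsDer ρR d) (hφ : ∀ r, ρ (φ r) = φ (ρR r))
    (hf : ∀ q q', f (q + q') = f q + f q') (hf' : ∀ r q, f (r • q) = φ r • f q) (q : Q) :
    B.der ρ d (f q) = u • f (d q) := by
  have h2 : ∀ b c : S, ρ (b * c) = ρ b * c + b * ρ c := hρ.leibniz
  let f' : Q →+ N := AddMonoidHom.mk' f hf
  have hsum : ∀ g : Fin B.rank → Q, ∑ i, f (g i) = f (∑ i, g i) := fun g =>
    (map_sum f' g _).symm
  have h3 : ∑ i, φ (B.baseCovec i q) • f (B.vec i) = φ B.base • f q := by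
    simp only [← hf', hsum, ← B.base_expand]
  have h4 : ∑ i, (φ (ρR (B.baseCovec i q)) • f (B.vec i) +
      φ (B.baseCovec i q) • f (d (B.vec i))) = φ (ρR B.base) • f q + φ B.base • f (d q) := by
    simp only [← hf', ← hf, hsum, ← hd.leibniz]
    rw [← hd.map_sum, ← B.base_expand]
  have h5 : ∀ i, ρ (B.covec i (f q)) • f (B.vec i) + B.covec i (f q) • f (d (B.vec i)) =
      ρ B.factor • (φ (B.baseCovec i q) • f (B.vec i)) + B.factor •
        (φ (ρR (B.baseCovec i q)) • f (B.vec i) + φ (B.baseCovec i q) • f (d (B.vec i))) := by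
    intro i
    rw [B.covec_apply, h2, hφ]
    module
  have hu1 : ρ u • f q = (ρ B.factor * φ B.base + B.factor * φ (ρR B.base)) • f q := by
    rw [congrArg ρ B.eq_mul, h2, hφ]
  have hu2 : u • f (d q) = (B.factor * φ B.base) • f (d q) := congrArg (· • f (d q)) B.eq_mul
  rw [der, Finset.sum_congr rfl fun i _ => h5 i, Finset.sum_add_distrib, ← Finset.smul_sum,
    ← Finset.smul_sum, h3, h4, hu1, hu2]
  module

end InducedBasis

/-- A derivation of `Q` extends to a derivation of `N`. -/
theorem InducedBasis.exists_derivation {φ : R →+* S} {f : Q → N} {u : P → S}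
    (B : ∀ p, InducedBasis φ f (u p)) (sep : ∀ m : N, (∀ p, u p • m = 0) → m = 0)
    (glue : ∀ t : P → N, (∀ p q, u q • t p = u p • t q) → ∃ t', ∀ p, u p • t' = t p)
    {ρ : S → S} {ρR : R → R} {d : Q → Q} (hρ : IsDer ρ ρ) (hd : IsDer ρR d)
    (hφ : ∀ r, ρ (φ r) = φ (ρR r)) (hf : ∀ q q', f (q + q') = f q + f q')
    (hf' : ∀ r q, f (r • q) = φ r • f q) :
    ∃ D : N → N, IsDer ρ D ∧ ∀ q, D (f q) = f (d q) := by
  -- Both sides are derivations with symbol `u p * u q * ρ` and agree on the generators `f q`.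
  have hcompat : ∀ m p q, u q • (B p).der ρ d m = u p • (B q).der ρ d m := by
    intro m p q
    refine IsDer.ext (fun p => (B p).toDualBasis) sep (((B p).isDer_der hρ).smul (u q))
      ((((B q).isDer_der hρ).smul (u p)).congr fun a => by ring) ?_ m
    rintro _ ⟨s, rfl⟩
    simp only [InducedBasis.der_apply _ hρ hd hφ hf hf']
    exact smul_comm _ _ _
  choose D hD using fun m => glue (fun p => (B p).der ρ d m) (hcompat m)
  have hext : ∀ m m' : N, (∀ p, u p • m = u p • m') → m = m' := fun m m' h =>
    sub_eq_zero.1 (sep _ fun p => by rw [smul_sub, h, sub_self])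
  refine ⟨D, ⟨fun m m' => hext _ _ fun p => ?_, fun a m => hext _ _ fun p => ?_⟩,
    fun q => hext _ _ fun p => ?_⟩
  · rw [smul_add, hD, hD, hD, ((B p).isDer_der hρ).map_add]
  · rw [smul_add, hD, ((B p).isDer_der hρ).leibniz, smul_comm (u p) a, hD, mul_smul]
  · rw [hD, InducedBasis.der_apply _ hρ hd hφ hf hf']

end Extension

/-! ### Derivations of jets of sections; bases adapted to a splitting. -/

section JetExtension
variable {EM HM : Type*} [NormedAddCommGroup EM] [NormedSpace ℝ EM] [FiniteDimensional ℝ EM]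
  [TopologicalSpace HM] {I : ModelWithCorners ℝ EM HM} {X : Type*} [TopologicalSpace X]
  [ChartedSpace HM X] [IsManifold I ∞ X]
  {F : Type*} [NormedAddCommGroup F] [NormedSpace ℂ F]
  {E : X → Type*} [TopologicalSpace (TotalSpace F E)] [∀ x, TopologicalSpace (E x)]
  [∀ x, AddCommGroup (E x)] [∀ x, Module ℂ (E x)] [FiberBundle F E]
  [VectorBundle ℂ F E] [VectorBundle ℝ F E] [ContMDiffVectorBundle ∞ F E I]

theorem jetProlong_add (s t : Sec I F E) : jetProlong (s + t) = jetProlong s + jetProlong t := rfl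

theorem jetProlong_smul (f : Fn I X) (s : Sec I F E) :
    jetProlong (f • s) = pr₂ f • jetProlong s := rfl

theorem value_jetProlong (s : Sec I F E) : value (jetProlong s) = s := rfl

theorem value_smul (a : Jet I X) (m : JetE I F E) : value (a • m) = jetValue a • value m := by
  obtain ⟨f, rfl⟩ := jmk_surjective a
  obtain ⟨s, rfl⟩ := jetE_mk_surjective m
  rfl

/-- The basis of `J(E)` which consists of jet prolongations. -/
def Frame.prolongBasis {χ : Fn I X} (B : Frame I F E χ) :
    InducedBasis (N := JetE I F E) (Q := Sec I F E) (pr₂ : Fn I X →+* Jet I X) jetProlong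
      (pr₂ χ) where
  rank := B.rank
  vec := B.vec
  covec i := jetCovec (B.ksecCovec i)
  expand := B.jetBasis.expand
  base := χ
  baseCovec i := B.secCovec i
  base_expand := B.secBasis.expand
  factor := 1
  covec_apply _ _ := (one_mul _).symm
  eq_mul := (one_mul _).symm

variable {σ : Sec I F E → JetE I F E}

theorem IsSplitting.map_sum (hσ : IsSplitting σ) {r : ℕ} (s : Fin r → Sec I F E) :
    σ (∑ i, s i) = ∑ i, σ (s i) :=
  _root_.map_sum (AddMonoidHom.mk' σ hσ.map_add) s _

namespace Frame
variable {χ : Fn I X} (B : Frame I F E χ)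

variable (σ) in
/-- The coordinates of the splitting of the frame. -/
def splitMatrix : Matrix (Fin B.rank) (Fin B.rank) (Jet I X) :=
  Matrix.of fun i b => jetCovec (B.ksecCovec i) (σ (B.vec b))

/-- On the diagonal `q σ = id`, so the matrix of `σ` restricts to the pairing of the frame with its
dual, which is `χ` times the identity. Hence the determinant has value `1` wherever `χ` does. -/
theorem jetValue_det_splitMatrix (hσ : IsSplitting σ) :
    jetValue (B.splitMatrix σ).det = χ ^ B.rank := by
  rw [RingHom.map_det]
  have h : (jetValue : Jet I X →+* Fn I X).mapMatrix (B.splitMatrix σ) =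
      Matrix.diagonal fun _ => χ := by
    ext1 i j
    change jetValue (jetCovec (B.ksecCovec i) (σ (B.vec j))) = _
    rw [jetValue_jetCovec, hσ.value_eq, secCovec_vec, Matrix.diagonal_apply]
  rw [h, Matrix.det_diagonal, Finset.prod_const, Finset.card_univ, Fintype.card_fin]

/-- The basis of `J(E)` which consists of values of a splitting. -/
def splitBasis (hσ : IsSplitting σ) :
    InducedBasis (N := JetE I F E) (Q := Sec I F E) (pr₁ : Fn I X →+* Jet I X) σ
      (pr₂ χ * (B.splitMatrix σ).det * pr₁ χ) where
  rank := B.rank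
  vec := B.vec
  -- Cramer's rule. The factor `χ(y)` is needed to expand `σ` of the frame in the prolonged frame,
  -- and `χ(x)` to expand `s` in the frame before `σ` is applied.
  covec b := (pr₁ χ * pr₂ χ) • ∑ k, (B.splitMatrix σ).adjugate b k • jetCovec (B.ksecCovec k)
  expand m := by
    have h1 : ∀ b, pr₂ χ • σ (B.vec b) = ∑ i, B.splitMatrix σ i b • jetProlong (B.vec i) :=
      fun b => B.jetBasis.expand _
    have h2 : ∀ k, ∑ b, (B.splitMatrix σ).adjugate b k • pr₂ χ • σ (B.vec b) =
        (B.splitMatrix σ).det • jetProlong (B.vec k) := by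
      intro k
      simp only [h1, Finset.smul_sum, smul_smul]
      rw [Finset.sum_comm]
      have h3 : ∀ i, ∑ b, ((B.splitMatrix σ).adjugate b k * B.splitMatrix σ i b) •
          jetProlong (B.vec i) = (if i = k then (B.splitMatrix σ).det else 0) •
            jetProlong (B.vec i) := by
        intro i
        rw [← Finset.sum_smul]
        have h4 := congrFun (congrFun (Matrix.mul_adjugate (B.splitMatrix σ)) i) k
        rw [Matrix.mul_apply, Matrix.smul_apply, Matrix.one_apply] at h4
        simp only [mul_comm ((B.splitMatrix σ).adjugate _ k)]
        rw [h4]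
        simp
      rw [Finset.sum_congr rfl fun i _ => h3 i, Finset.sum_eq_single k]
      · rw [if_pos rfl]
      · intro i _ hik
        rw [if_neg hik]
        exact zero_smul (Jet I X) (jetProlong (B.vec i) : JetE I F E)
      · exact fun hk => absurd (Finset.mem_univ k) hk
    have h5 : ∀ b, ((pr₁ χ * pr₂ χ) •
        ∑ k, (B.splitMatrix σ).adjugate b k • jetCovec (B.ksecCovec k)) m • σ (B.vec b) =
        pr₁ χ • ∑ k, jetCovec (B.ksecCovec k) m •
          ((B.splitMatrix σ).adjugate b k • pr₂ χ • σ (B.vec b)) := by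
      intro b
      simp only [LinearMap.smul_apply, LinearMap.sum_apply, smul_eq_mul, mul_smul, Finset.sum_smul,
        Finset.smul_sum]
      refine Finset.sum_congr rfl fun k _ => ?_
      module
    rw [Finset.sum_congr rfl fun b _ => h5 b, ← Finset.smul_sum, Finset.sum_comm]
    simp only [← Finset.smul_sum, h2]
    have h6 : ∑ i, jetCovec (B.ksecCovec i) m • jetProlong (B.vec i) = pr₂ χ • m :=
      (B.jetBasis.expand m).symm
    simp only [smul_comm _ (B.splitMatrix σ).det]
    rw [← Finset.smul_sum, h6]
    module
  base := χ
  baseCovec i := B.secCovec i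
  base_expand := B.secBasis.expand
  factor := pr₂ χ * (B.splitMatrix σ).det
  covec_apply b s := by
    -- Since `σ` is linear over functions of `x`, the expansion of `χ • s` in the frame is carried
    -- to one of `σ s`, with the same coefficients at `x`.
    have h1 : ∀ k, pr₁ χ * jetCovec (B.ksecCovec k) (σ s) =
        ∑ c, B.splitMatrix σ k c * pr₁ (B.secCovec c s) := by
      intro k
      have h2 : χ • s = ∑ i, B.secCovec i s • B.vec i := B.secBasis.expand s
      rw [← smul_eq_mul, ← map_smul, ← hσ.map_smul, h2, hσ.map_sum, _root_.map_sum]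
      refine Finset.sum_congr rfl fun c _ => ?_
      rw [hσ.map_smul, _root_.map_smul, smul_eq_mul, mul_comm]
      rfl
    have h3 : ∑ k, (B.splitMatrix σ).adjugate b k * (pr₁ χ * jetCovec (B.ksecCovec k) (σ s)) =
        (B.splitMatrix σ).det * pr₁ (B.secCovec b s) := by
      simp only [h1]
      have h4 := congrFun (congrArg (fun A : Matrix (Fin B.rank) (Fin B.rank) (Jet I X) =>
        A.mulVec fun c => pr₁ (B.secCovec c s)) (Matrix.adjugate_mul (B.splitMatrix σ))) b
      simp only [← Matrix.mulVec_mulVec, Matrix.smul_mulVec, Matrix.one_mulVec] at h4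
      exact h4
    rw [mul_assoc, ← h3, LinearMap.smul_apply, LinearMap.sum_apply, smul_eq_mul, Finset.mul_sum,
      Finset.mul_sum]
    refine Finset.sum_congr rfl fun k _ => ?_
    rw [LinearMap.smul_apply, smul_eq_mul]
    ring
  eq_mul := rfl

end Frame

variable (I F E) in
theorem exists_frames [T2Space X] [FiniteDimensional ℂ F] :
    ∃ χ : X → Fn I X, (∀ x, χ x x = 1) ∧ Nonempty (∀ x, Frame I F E (χ x)) := by
  choose χ hχ h using exists_frame (I := I) (F := F) (E := E)
  exact ⟨χ, hχ, ⟨fun x => (h x).some⟩⟩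

variable (I F E) in
theorem hasTrace_sec [T2Space X] [FiniteDimensional ℂ F] : HasTrace (Fn I X) (Sec I F E) := by
  obtain ⟨χ, hχ, ⟨B⟩⟩ := exists_frames I F E
  exact HasTrace.of_dualBasis (fun x => (B x).secBasis) (fn_eq_zero_of_mul hχ) (fn_glue hχ)

variable (I F E) in
theorem hasTrace_jetE [T2Space X] [SigmaCompactSpace X] [FiniteDimensional ℂ F] :
    HasTrace (Jet I X) (JetE I F E) := by
  obtain ⟨χ, hχ, ⟨B⟩⟩ := exists_frames I F E
  exact HasTrace.of_dualBasis (fun x => (B x).jetBasis.toUniv)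
    (jet_eq_zero_of_mul (χ := fun x => pr₂ (χ x)) hχ) (jet_glue (χ := fun x => pr₂ (χ x)) hχ)

/-- Prolonged frames generate `J(E)` locally over jets of functions. -/
theorem isDer_ext_jetProlong [T2Space X] [FiniteDimensional ℂ F] {ρ : Jet I X → Jet I X}
    {D D' : JetE I F E → JetE I F E} (h : IsDer ρ D) (h' : IsDer ρ D')
    (e : ∀ s, D (jetProlong s) = D' (jetProlong s)) (m : JetE I F E) : D m = D' m := by
  obtain ⟨χ, hχ, ⟨B⟩⟩ := exists_frames I F E
  refine IsDer.ext (fun x => (B x).jetBasis) (jetE_eq_zero_of_smul (χ := fun x => pr₂ (χ x)) hχ)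
    h h' ?_ m
  rintro _ ⟨s, rfl⟩
  exact e s

/-- Near the diagonal the values of the splitting generate `J(E)`; this is what determines `∇_σ`. -/
theorem IsSplitting.exists_bases [T2Space X] [FiniteDimensional ℂ F] (hσ : IsSplitting σ) :
    ∃ u : X → Jet I X, (∀ x, jetValue (u x) x = 1) ∧
      Nonempty (∀ x, InducedBasis (N := JetE I F E) (Q := Sec I F E)
        (pr₁ : Fn I X →+* Jet I X) σ (u x)) := by
  obtain ⟨χ, hχ, ⟨B⟩⟩ := exists_frames I F E
  refine ⟨_, fun x => ?_, ⟨fun x => (B x).splitBasis hσ⟩⟩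
  rw [map_mul, map_mul, Frame.jetValue_det_splitMatrix _ hσ, jetValue_pr₁, jetValue_pr₂]
  change χ x x * χ x x ^ (B x).rank * χ x x = 1
  simp [hχ]

theorem IsSplitting.isDer_ext [T2Space X] [FiniteDimensional ℂ F] (hσ : IsSplitting σ)
    {ρ : Jet I X → Jet I X}
    {D D' : JetE I F E → JetE I F E} (h : IsDer ρ D) (h' : IsDer ρ D')
    (e : ∀ s, D (σ s) = D' (σ s)) (m : JetE I F E) : D m = D' m := by
  obtain ⟨u, hu, ⟨B⟩⟩ := hσ.exists_bases
  refine IsDer.ext (fun x => (B x).toDualBasis) (jetE_eq_zero_of_smul hu) h h' ?_ m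
  rintro _ ⟨s, rfl⟩
  exact e s

theorem isDer_act₁ (Z : VF I X) : IsDer (act₁ Z) (act₁ Z) := ⟨jetDer_add _, jetDer_mul _⟩

theorem isDer_act₂ (Z : VF I X) : IsDer (act₂ Z) (act₂ Z) := ⟨jetDer_add _, jetDer_mul _⟩

/-- The connection `∇_σ` exists. -/
theorem IsSplitting.exists_der [T2Space X] [SigmaCompactSpace X] [FiniteDimensional ℂ F]
    (hσ : IsSplitting σ) (Z : VF I X) :
    ∃ D : JetE I F E → JetE I F E, IsDer (act₂ Z) D ∧ ∀ s, D (σ s) = 0 := by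
  obtain ⟨u, hu, ⟨B⟩⟩ := hσ.exists_bases
  -- `∇_σ` extends the zero derivation of the sections of `E` along `σ`. The symbols match because
  -- the derivative in `y` kills functions of `x`.
  obtain ⟨D, hD, h⟩ := InducedBasis.exists_derivation B (jetE_eq_zero_of_smul hu) (jetE_glue hu)
    (isDer_act₂ Z) (IsDer.zero (S := Fn I X) (N := Sec I F E)) (fun r => by
      rw [act₂_pr₁]; exact (map_zero _).symm) hσ.map_add hσ.map_smul
  refine ⟨D, hD, fun s => (h s).trans ?_⟩
  exact (AddMonoidHom.mk' σ hσ.map_add).map_zero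

/-- A derivation of the sections of `E` prolongs to the jets. -/
theorem exists_prolong_der [T2Space X] [SigmaCompactSpace X] [FiniteDimensional ℂ F]
    {Z : VF I X} {d : Sec I F E → Sec I F E} (hd : IsDer (lieDer Z) d) :
    ∃ D : JetE I F E → JetE I F E, IsDer (act₂ Z) D ∧
      ∀ s, D (jetProlong s) = jetProlong (d s) := by
  obtain ⟨χ, hχ, ⟨B⟩⟩ := exists_frames I F E
  exact InducedBasis.exists_derivation (fun x => (B x).prolongBasis)
    (jetE_eq_zero_of_smul (χ := fun x => pr₂ (χ x)) hχ) (jetE_glue (χ := fun x => pr₂ (χ x)) hχ)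
    (isDer_act₂ Z) hd (act₂_pr₂ Z) jetProlong_add jetProlong_smul

theorem actE₁_mk (Z : VF I X) (s : KSec I F E) :
    actE₁ Z (Submodule.Quotient.mk s : JetE I F E) = Submodule.Quotient.mk (derivFst Z s) := rfl

theorem isDer_actE₁ (Z : VF I X) : IsDer (act₁ Z) (actE₁ Z : JetE I F E → JetE I F E) where
  map_add m m' := by
    obtain ⟨s, rfl⟩ := jetE_mk_surjective m
    obtain ⟨t, rfl⟩ := jetE_mk_surjective m'
    rw [← Submodule.Quotient.mk_add, actE₁_mk, derivFst_add]
    rfl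
  leibniz a m := by
    obtain ⟨f, rfl⟩ := jmk_surjective a
    obtain ⟨s, rfl⟩ := jetE_mk_surjective m
    rw [jmk_smul_mk, actE₁_mk, derivFst_smul]
    rfl

theorem actE₁_jetProlong (Z : VF I X) (s : Sec I F E) : actE₁ Z (jetProlong s) = 0 := by
  have h : derivFst Z (pullSec s) = 0 := by
    ext p
    have hy : p.2 ∈ (trivializationAt F E p.2).baseSet := mem_baseSet_trivializationAt F E p.2
    change (trivializationAt F E p.2).symm p.2 (derivAlong (IM := I)
      (fun _ => (trivializationAt F E p.2 ⟨p.2, s p.2⟩).2) p.1 (Z p.1)) = 0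
    rw [derivAlong, mfderiv_const, ← Trivialization.coe_symmₗ (R := ℂ) _ hy]
    exact map_zero _
  rw [jetProlong, actE₁_mk, h]
  rfl

variable [T2Space X] [FiniteDimensional ℂ F]

/-- Both sides are derivations with the same symbol and kill prolongations. The rules for multiples
of vector fields and for brackets hold for the same reason. -/
theorem actE₁_add_left (Z W : VF I X) (m : JetE I F E) :
    actE₁ (Z + W) m = actE₁ Z m + actE₁ W m :=
  isDer_ext_jetProlong (isDer_actE₁ _) (((isDer_actE₁ Z).add (isDer_actE₁ W)).congr fun a =>
    (act₁_add_left Z W a).symm) (fun s => by simp only [actE₁_jetProlong, add_zero]) m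

theorem actE₁_smulVF (f : C^∞⟮I, X; 𝓘(ℝ, ℝ), ℝ⟯) (Z : VF I X) (m : JetE I F E) :
    actE₁ (smulVF f Z) m = pr₁ (toFn f) • actE₁ Z m :=
  isDer_ext_jetProlong (isDer_actE₁ _) (((isDer_actE₁ Z).smul (pr₁ (toFn f))).congr fun a =>
    (act₁_smulVF f Z a).symm) (fun s => by simp only [actE₁_jetProlong, smul_zero]) m

theorem actE₁_bracket (Z W : VF I X) (m : JetE I F E) :
    actE₁ Z (actE₁ W m) - actE₁ W (actE₁ Z m) = actE₁ (bracket Z W) m :=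
  isDer_ext_jetProlong (((isDer_actE₁ Z).comm (isDer_actE₁ W)).congr fun a => act₁_bracket Z W a)
    (isDer_actE₁ _) (fun s => by simp only [actE₁_jetProlong, (isDer_actE₁ _).map_zero, sub_zero]) m

end JetExtension

/-! ### Curvature: comparison and naturality. -/

section Comparison
variable {S L N : Type*} [CommRing S] [AddCommGroup L] [AddCommGroup N] [Module S N]
  {Rel : L → L → S → Prop} {br : L → L → L} {ρ : L → S → S} {D D' : L → N → N}

theorem IsConn.isDer (h : IsConn Rel br ρ D) (v : L) : IsDer (ρ v) (D v) :=
  ⟨h.D_add v, h.leibniz v⟩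

/-- The curvature of a connection whose symbol is a representation. -/
theorem IsConn.tens_curvature (h : IsConn Rel br ρ D)
    (jac : ∀ x y z, br x (br y z) = br (br x y) z + br y (br x z))
    (hρ : ∀ v w a, ρ v (ρ w a) - ρ w (ρ v a) = ρ (br v w) a) : Tens 2 (h.diff * h.diff) :=
  h.tens_diff_sq jac fun v w =>
    (((h.isDer v).comm (h.isDer w)).sub (h.isDer (br v w))).exists_linear fun a => by
      rw [hρ, sub_self]

/-- The traces of the powers of the curvatures of two connections differ by an exact form. -/
theorem HasTrace.exists_trForm_sub (H : HasTrace S N)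
    (inv : ∀ n : ℕ, ∃ c : S, ((n : S) + 1) * c = 1) (h : IsConn Rel br ρ D)
    (h' : IsConn Rel br ρ D') (hS : IsConn (N := S) Rel br ρ ρ)
    (jac : ∀ x y z, br x (br y z) = br (br x y) z + br y (br x z))
    (hρ : ∀ v w a, ρ v (ρ w a) - ρ w (ρ v a) = ρ (br v w) a) (k : ℕ) :
    ∃ η : List L → S, IsAltForm Rel η ∧ ∀ w,
      trForm ((h'.diff * h'.diff) ^ k) w - trForm ((h.diff * h.diff) ^ k) w =
        ceList br ρ w η := by
  -- The difference of two connections with the same symbol is linear over `S`, that is, a one-form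
  -- with values in endomorphisms, as transgression requires.
  choose A hA using fun v => ((h'.isDer v).sub (h.isDer v)).exists_linear fun a => sub_self _
  have hA' : IsConn Rel (0 : L → L → L) (0 : L → S → S) (fun x m => A x m) :=
    IsConn.ofLinear A (fun x y => LinearMap.ext fun m => by
      rw [LinearMap.add_apply, ← hA, ← hA, ← hA, h'.D_add_left, h.D_add_left]; abel)
      (fun x' x a hr => LinearMap.ext fun m => by
        rw [LinearMap.smul_apply, ← hA, ← hA, h'.D_rel _ _ _ hr, h.D_rel _ _ _ hr, smul_sub])
  have hsum : h.diff + hA'.diff = h'.diff := by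
    rw [← h.diff_plus hA']
    refine op_ext fun θ w => ?_
    rw [IsConn.diff_apply, IsConn.diff_apply]
    congr 1
    · exact add_zero br
    · funext v m
      change D v m + A v m = D' v m
      rw [← hA]
      abel
  obtain ⟨η, h1, h2⟩ := H.exists_transgression inv h hS hA' (h.tens_curvature jac hρ)
    (by rw [hsum]; exact h'.tens_curvature jac hρ) k
  rw [hsum] at h2
  exact ⟨η, h1, fun w => by rw [h2, add_sub_cancel_left]⟩

theorem ceDiff_form (h : IsConn Rel br ρ D) (θ : forms Rel N) {n : ℕ} :
    ceDiff br D (fun u : Fin n → L => θ.1 (List.ofFn u)) =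
      fun v => (h.diff θ).1 (List.ofFn v) :=
  funext fun v => θ.2.ceDiff_ofFn br D v

/-- Curvature is natural. -/
theorem curvature_pow_comp {S' L' N' : Type*} [CommRing S'] [AddCommGroup L'] [AddCommGroup N']
    [Module S' N'] {Rel' : L' → L' → S' → Prop} {br' : L' → L' → L'} {ρ' : L' → S' → S'}
    {D' : L' → N' → N'} (h : IsConn Rel br ρ D) (h' : IsConn Rel' br' ρ' D') (f : L → L')
    (q : N' →+ N) (hf : ∀ x y, f (br x y) = br' (f x) (f y))
    (hq : ∀ x m, q (D' (f x) m) = D x (q m)) (k : ℕ) (m : N') (w : List L) :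
    (((h.diff * h.diff) ^ k) (single (q m))).1 w =
      q ((((h'.diff * h'.diff) ^ k) (single m)).1 (w.map f)) := by
  have key : ∀ (θ : forms Rel N) (θ' : forms Rel' N'), (∀ w, θ.1 w = q (θ'.1 (w.map f))) →
      ∀ w, (h.diff θ).1 w = q ((h'.diff θ').1 (w.map f)) := by
    intro θ θ' hθ w
    rw [h.diff_apply, h'.diff_apply, ← ceList_comp f q hf hq, (funext hθ : θ.1 = _)]
  induction k generalizing w with
  | zero =>
    cases w with
    | nil => rfl
    | cons x w => exact (map_zero q).symm
  | succ k ih =>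
    rw [pow_succ', pow_succ']
    exact key _ _ (key _ _ ih) w

theorem ceList_const_smul (h : IsConn (N := S) Rel br ρ ρ) {c : S} (hc : ∀ x, ρ x c = 0)
    (w : List L) (θ : List L → S) : ceList br ρ w (c • θ) = c * ceList br ρ w θ := by
  rw [h.ceList_smul, dMul_eq_zero hc, add_zero, smul_eq_mul]

end Comparison

/-! ### From lists back to families of arguments. -/

section Slots

/-- Translates an update at one index into the replacement of one list entry; the other entries are
tracked for the sake of alternation. -/
theorem exists_ofFn_update {L : Type*} {n : ℕ} (v : Fin n → L) (i : Fin n) :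
    ∃ l r : List L, (∀ x, List.ofFn (Function.update v i x) = l ++ x :: r) ∧
      ∀ j, j ≠ i → v j ∈ l ∨ v j ∈ r := by
  induction n with
  | zero => exact i.elim0
  | succ n ih =>
    cases i using Fin.cases with
    | zero =>
      refine ⟨[], List.ofFn fun j : Fin n => v j.succ, fun x => ?_, fun j hj => Or.inr ?_⟩
      · rw [List.ofFn_succ]
        simp
      · obtain ⟨k, rfl⟩ := Fin.exists_succ_eq.2 hj
        exact (List.mem_ofFn' _ _).2 ⟨k, rfl⟩
    | succ i =>
      obtain ⟨l, r, h1, h2⟩ := ih (fun j => v j.succ) i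
      refine ⟨v 0 :: l, r, fun x => ?_, fun j hj => ?_⟩
      · rw [List.ofFn_succ, List.cons_append, ← h1 x]
        rw [Function.update_of_ne (Fin.succ_ne_zero i).symm]
        congr 2
        funext j
        simp [Function.update_apply]
      · cases j using Fin.cases with
        | zero => exact Or.inl List.mem_cons_self
        | succ j =>
          rcases h2 j fun h => hj (h ▸ rfl) with h | h
          · exact Or.inl (List.mem_cons_of_mem _ h)
          · exact Or.inr h

variable {S L N : Type*} [CommRing S] [AddCommGroup L] [AddCommGroup N] [Module S N]
  {Rel : L → L → S → Prop} {θ : List L → N}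

theorem IsAltForm.ofFn_add (hθ : IsAltForm Rel θ) {n : ℕ} (v : Fin n → L) (i : Fin n) (x y : L) :
    θ (List.ofFn (Function.update v i (x + y))) =
      θ (List.ofFn (Function.update v i x)) + θ (List.ofFn (Function.update v i y)) := by
  obtain ⟨l, r, h, -⟩ := exists_ofFn_update v i
  rw [h, h, h, hθ.add]

theorem IsAltForm.ofFn_smul (hθ : IsAltForm Rel θ) {n : ℕ} (v : Fin n → L) (i : Fin n) {x' x : L}
    {a : S} (hr : Rel x' x a) : θ (List.ofFn (Function.update v i x')) =
      a • θ (List.ofFn (Function.update v i x)) := by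
  obtain ⟨l, r, h, -⟩ := exists_ofFn_update v i
  rw [h, h, hθ.smul _ _ _ _ _ hr]

theorem IsAltForm.ofFn_eq_zero (hθ : IsAltForm Rel θ) {n : ℕ} (v : Fin n → L) (i j : Fin n)
    (hv : v i = v j) (hij : i ≠ j) : θ (List.ofFn v) = 0 := by
  obtain ⟨l, r, h, h'⟩ := exists_ofFn_update v i
  have h1 := h (v i)
  rw [Function.update_eq_self] at h1
  have h2 := h' j hij.symm
  rw [← hv] at h2
  rw [h1]
  rcases h2 with h2 | h2
  · obtain ⟨s, t, rfl⟩ := List.append_of_mem h2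
    have := hθ.eq_zero s t r (v i)
    simpa using this
  · obtain ⟨s, t, rfl⟩ := List.append_of_mem h2
    exact hθ.eq_zero l s t (v i)

end Slots

/-! ### Forms on `X` and forms with values in jets as alternating cochains. -/

section ManifoldForms
variable {EM HM : Type*} [NormedAddCommGroup EM] [NormedSpace ℝ EM] [FiniteDimensional ℝ EM]
  [TopologicalSpace HM] {I : ModelWithCorners ℝ EM HM} {X : Type*} [TopologicalSpace X]
  [ChartedSpace HM X] [IsManifold I ∞ X]

/-- `Z'` is the product of the function `a` and the vector field `Z`. -/
def relFn (Z' Z : VF I X) (a : Fn I X) : Prop := ∃ f, Z' = smulVF f Z ∧ a = toFn f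

/-- `z'` is the product of the jet `a` and one component `z` of a pair of vector fields. -/
def relJet (z' z : VF I X × VF I X) (a : Jet I X) : Prop :=
  (∃ f Y, z' = (smulVF f Y, 0) ∧ z = (Y, 0) ∧ a = pr₁ (toFn f)) ∨
    ∃ f Y, z' = (0, smulVF f Y) ∧ z = (0, Y) ∧ a = pr₂ (toFn f)

theorem IsAltForm.isForm {θ : List (VF I X) → Fn I X} (hθ : IsAltForm relFn θ) {n : ℕ} :
    IsForm fun v : Fin n → VF I X => θ (List.ofFn v) where
  map_add v i x y := hθ.ofFn_add v i x y
  map_smul v i f _ := hθ.ofFn_smul v i ⟨f, rfl, rfl⟩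
  map_eq_zero v i j := hθ.ofFn_eq_zero v i j

theorem IsAltForm.isJetForm {θ : List (VF I X × VF I X) → Jet I X} (hθ : IsAltForm relJet θ)
    {n : ℕ} : IsJetForm fun v : Fin n → VF I X × VF I X => θ (List.ofFn v) where
  map_add v i x y := hθ.ofFn_add v i x y
  map_smul_fst v i f Y := hθ.ofFn_smul v i (Or.inl ⟨f, Y, rfl, rfl, rfl⟩)
  map_smul_snd v i f Y := hθ.ofFn_smul v i (Or.inr ⟨f, Y, rfl, rfl, rfl⟩)
  map_eq_zero v i j := hθ.ofFn_eq_zero v i j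

theorem bracket_zero_left (W : VF I X) : bracket 0 W = 0 := by
  have h := bracket_add_left 0 0 W
  rwa [add_zero, left_eq_add] at h

theorem isConn_fn {N : Type*} [AddCommGroup N] [Module (Fn I X) N] {D : VF I X → N → N}
    (hD : ∀ Z, IsDer (lieDer Z) (D Z)) (hadd : ∀ Z W m, D (Z + W) m = D Z m + D W m)
    (hsmul : ∀ f Z m, D (smulVF f Z) m = toFn f • D Z m) : IsConn relFn bracket lieDer D where
  br_add_left := bracket_add_left
  br_add_right := bracket_add_right
  br_self := bracket_self
  ρ_add := lieDer_add
  ρ_mul := lieDer_mul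
  D_add Z := (hD Z).map_add
  D_add_left := hadd
  leibniz Z := (hD Z).leibniz
  D_rel := by
    rintro _ Z _ ⟨f, rfl, rfl⟩ m
    exact hsmul f Z m
  br_rel := by
    rintro _ Z _ ⟨f, rfl, rfl⟩ W θ hθ l r
    rw [bracket_smulVF_left, hθ.map_sub, hθ.smul _ _ _ _ _ ⟨f, rfl, rfl⟩,
      hθ.smul _ _ _ _ _ ⟨lieReal W f, rfl, rfl⟩, lieDer_toFn]

theorem mk_sub_fst (A B : VF I X) : ((A - B, 0) : VF I X × VF I X) = (A, 0) - (B, 0) :=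
  Prod.ext rfl (sub_zero 0).symm

theorem mk_sub_snd (A B : VF I X) : ((0, A - B) : VF I X × VF I X) = (0, A) - (0, B) :=
  Prod.ext (sub_zero 0).symm rfl

/-- Pairs `(f Y, 0)` behave as on `X`. For pairs `(0, f Z)` there is nothing to compensate: `br₁`
and `D` ignore the second component, and the derivative in `x` kills functions of `y`. -/
theorem isConn_jet₁ {N : Type*} [AddCommGroup N] [Module (Jet I X) N] {D : VF I X → N → N}
    (hD : ∀ Z, IsDer (act₁ Z) (D Z)) (hadd : ∀ Z W m, D (Z + W) m = D Z m + D W m)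
    (hsmul : ∀ f Z m, D (smulVF f Z) m = pr₁ (toFn f) • D Z m) :
    IsConn relJet br₁ (fun v => act₁ v.1) (fun v => D v.1) where
  br_add_left x y z := Prod.ext (bracket_add_left _ _ _) (add_zero 0).symm
  br_add_right x y z := Prod.ext (bracket_add_right _ _ _) (add_zero 0).symm
  br_self x := Prod.ext (bracket_self _) rfl
  ρ_add x := (isDer_act₁ x.1).map_add
  ρ_mul x := (isDer_act₁ x.1).leibniz
  D_add x := (hD x.1).map_add
  D_add_left x y := hadd x.1 y.1
  leibniz x := (hD x.1).leibniz
  D_rel := by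
    have h0 : ∀ m, D 0 m = 0 := fun m => by
      have h := hadd 0 0 m
      rwa [add_zero, left_eq_add] at h
    rintro _ _ _ (⟨f, Y, rfl, rfl, rfl⟩ | ⟨f, Y, rfl, rfl, rfl⟩) m
    · exact hsmul f Y m
    · rw [h0, smul_zero]
  br_rel := by
    rintro _ _ _ (⟨f, Y, rfl, rfl, rfl⟩ | ⟨f, Y, rfl, rfl, rfl⟩) W θ hθ l r
    · simp only [br₁]
      rw [bracket_smulVF_left, mk_sub_fst, hθ.map_sub,
        hθ.smul _ _ _ _ _ (Or.inl ⟨f, bracket Y W.1, rfl, rfl, rfl⟩),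
        hθ.smul _ _ _ _ _ (Or.inl ⟨lieReal W.1 f, Y, rfl, rfl, rfl⟩), act₁_pr₁, lieDer_toFn]
    · simp only [br₁]
      have h0 : act₁ W.1 (pr₂ (toFn f)) • θ (l ++ (0, Y) :: r) = 0 := by
        rw [act₁_pr₂]
        exact zero_smul (Jet I X) (θ (l ++ (0, Y) :: r))
      rw [bracket_zero_left, h0, sub_zero]
      change θ (l ++ 0 :: r) = _ • θ (l ++ 0 :: r)
      rw [hθ.map_zero, smul_zero]

theorem isConn_jet₂ {N : Type*} [AddCommGroup N] [Module (Jet I X) N] {D : VF I X → N → N}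
    (hD : ∀ Z, IsDer (act₂ Z) (D Z)) (hadd : ∀ Z W m, D (Z + W) m = D Z m + D W m)
    (hsmul : ∀ f Z m, D (smulVF f Z) m = pr₂ (toFn f) • D Z m) :
    IsConn relJet br₂ (fun v => act₂ v.2) (fun v => D v.2) where
  br_add_left x y z := Prod.ext (add_zero 0).symm (bracket_add_left _ _ _)
  br_add_right x y z := Prod.ext (add_zero 0).symm (bracket_add_right _ _ _)
  br_self x := Prod.ext rfl (bracket_self _)
  ρ_add x := (isDer_act₂ x.2).map_add
  ρ_mul x := (isDer_act₂ x.2).leibniz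
  D_add x := (hD x.2).map_add
  D_add_left x y := hadd x.2 y.2
  leibniz x := (hD x.2).leibniz
  D_rel := by
    have h0 : ∀ m, D 0 m = 0 := fun m => by
      have h := hadd 0 0 m
      rwa [add_zero, left_eq_add] at h
    rintro _ _ _ (⟨f, Y, rfl, rfl, rfl⟩ | ⟨f, Y, rfl, rfl, rfl⟩) m
    · rw [h0, smul_zero]
    · exact hsmul f Y m
  br_rel := by
    rintro _ _ _ (⟨f, Y, rfl, rfl, rfl⟩ | ⟨f, Y, rfl, rfl, rfl⟩) W θ hθ l r
    · simp only [br₂]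
      have h0 : act₂ W.2 (pr₁ (toFn f)) • θ (l ++ (Y, 0) :: r) = 0 := by
        rw [act₂_pr₁]
        exact zero_smul (Jet I X) (θ (l ++ (Y, 0) :: r))
      rw [bracket_zero_left, h0, sub_zero]
      change θ (l ++ 0 :: r) = _ • θ (l ++ 0 :: r)
      rw [hθ.map_zero, smul_zero]
    · simp only [br₂]
      rw [bracket_smulVF_left, mk_sub_snd, hθ.map_sub,
        hθ.smul _ _ _ _ _ (Or.inr ⟨f, bracket Y W.2, rfl, rfl, rfl⟩),
        hθ.smul _ _ _ _ _ (Or.inr ⟨lieReal W.2 f, Y, rfl, rfl, rfl⟩), act₂_pr₂, lieDer_toFn]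

variable (I X) in
theorem isConn_act₁ : IsConn (N := Jet I X) relJet br₁ (fun v => act₁ v.1) (fun v => act₁ v.1) :=
  isConn_jet₁ isDer_act₁ act₁_add_left act₁_smulVF

variable (I X) in
theorem isConn_act₂ : IsConn (N := Jet I X) relJet br₂ (fun v => act₂ v.2) (fun v => act₂ v.2) :=
  isConn_jet₂ isDer_act₂ act₂_add_left act₂_smulVF

variable (I X) in
theorem isConn_lieDer : IsConn (N := Fn I X) relFn bracket lieDer lieDer :=
  isConn_fn (fun Z => ⟨lieDer_add Z, lieDer_mul Z⟩) lieDer_add_left fun f Z a => lieDer_smulVF f Z a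

theorem br₁_jacobi (x y z : VF I X × VF I X) :
    br₁ x (br₁ y z) = br₁ (br₁ x y) z + br₁ y (br₁ x z) :=
  Prod.ext (bracket_jacobi _ _ _) (add_zero 0).symm

theorem br₂_jacobi (x y z : VF I X × VF I X) :
    br₂ x (br₂ y z) = br₂ (br₂ x y) z + br₂ y (br₂ x z) :=
  Prod.ext (add_zero 0).symm (bracket_jacobi _ _ _)

theorem br_add_eq (x y : VF I X × VF I X) :
    br₁ x y + br₂ x y = (bracket x.1 y.1, bracket x.2 y.2) :=
  Prod.ext (add_zero _) (zero_add _)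

theorem br_add_jacobi (x y z : VF I X × VF I X) :
    br₁ x (br₁ y z + br₂ y z) + br₂ x (br₁ y z + br₂ y z) =
      br₁ (br₁ x y + br₂ x y) z + br₂ (br₁ x y + br₂ x y) z +
        (br₁ y (br₁ x z + br₂ x z) + br₂ y (br₁ x z + br₂ x z)) := by
  simp only [br_add_eq]
  exact Prod.ext (bracket_jacobi _ _ _) (bracket_jacobi _ _ _)

/-- The cross terms cancel because derivatives in `x` and in `y` commute. -/
theorem act_add_bracket [T2Space X] (v w : VF I X × VF I X) (a : Jet I X) :
    act₁ v.1 (act₁ w.1 a + act₂ w.2 a) + act₂ v.2 (act₁ w.1 a + act₂ w.2 a) -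
      (act₁ w.1 (act₁ v.1 a + act₂ v.2 a) + act₂ w.2 (act₁ v.1 a + act₂ v.2 a)) =
      act₁ (bracket v.1 w.1) a + act₂ (bracket v.2 w.2) a := by
  rw [← act₁_bracket, ← act₂_bracket]
  simp only [(isDer_act₁ _).map_add, (isDer_act₂ _).map_add, act_comm]
  abel

theorem exists_inv_fn (n : ℕ) : ∃ c : Fn I X, ((n : Fn I X) + 1) * c = 1 := by
  refine ⟨constFn ((n : ℂ) + 1)⁻¹, ?_⟩
  have h : ((n : Fn I X) + 1) = constFn ((n : ℂ) + 1) := by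
    induction n with
    | zero => ext; simp [constFn]
    | succ n ih => rw [Nat.cast_succ, ih, Nat.cast_succ]; rfl
  rw [h]
  ext p
  exact mul_inv_cancel₀ (Nat.cast_add_one_ne_zero n)

theorem exists_inv_jet (n : ℕ) : ∃ c : Jet I X, ((n : Jet I X) + 1) * c = 1 := by
  obtain ⟨c, hc⟩ := exists_inv_fn (I := I) (X := X) n
  exact ⟨pr₁ c, by simpa using congrArg pr₁ hc⟩

end ManifoldForms

/-! ### The connection of a splitting and its Atiyah class. -/

section Connections
variable {EM HM : Type*} [NormedAddCommGroup EM] [NormedSpace ℝ EM] [FiniteDimensional ℝ EM]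
  [TopologicalSpace HM] {I : ModelWithCorners ℝ EM HM} {X : Type*} [TopologicalSpace X]
  [ChartedSpace HM X] [IsManifold I ∞ X]
  {F : Type*} [NormedAddCommGroup F] [NormedSpace ℂ F]
  {E : X → Type*} [TopologicalSpace (TotalSpace F E)] [∀ x, TopologicalSpace (E x)]
  [∀ x, AddCommGroup (E x)] [∀ x, Module ℂ (E x)] [FiberBundle F E]
  [VectorBundle ℂ F E] [VectorBundle ℝ F E] [ContMDiffVectorBundle ∞ F E I]
  {σ : Sec I F E → JetE I F E} {nab : VF I X → JetE I F E → JetE I F E}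
  {D : VF I X → Sec I F E → Sec I F E}

theorem IsConnection.isDer (hD : IsConnection D) (Z : VF I X) : IsDer (lieDer Z) (D Z) :=
  ⟨hD.map_add Z, hD.leibniz Z⟩

theorem IsConnection.isConn (hD : IsConnection D) : IsConn relFn bracket lieDer D :=
  isConn_fn hD.isDer hD.add_vector hD.smul_vector

theorem curvaturePow_eq (hD : IsConnection D) (k : ℕ) (s : Sec I F E) : curvaturePow D k s =
    fun v => (((hD.isConn.diff * hD.isConn.diff) ^ k) (single s)).1 (List.ofFn v) := by
  induction k with
  | zero => rfl
  | succ k ih =>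
    rw [pow_succ', curvaturePow, ih]
    erw [ceDiff_form hD.isConn (((hD.isConn.diff * hD.isConn.diff) ^ k) (single s))]
    erw [ceDiff_form hD.isConn]
    rfl

theorem tens_curvature_sec (hD : IsConnection D) : Tens 2 (hD.isConn.diff * hD.isConn.diff) :=
  hD.isConn.tens_curvature bracket_jacobi fun v w a => (lieDer_bracket v w a).symm

theorem chernWeil_eq (hD : IsConnection D) (k : ℕ) : chernWeil D k = fun v =>
    ((constFn (chernConst k) : Fn I X) • trForm ((hD.isConn.diff * hD.isConn.diff) ^ k) :
      List (VF I X) → Fn I X) (List.ofFn v) := by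
  funext v
  simp only [chernWeil, curvaturePow_eq hD]
  rfl

theorem isConnection_induced [T2Space X] (hadd : ∀ Z m m', nab Z (m + m') = nab Z m + nab Z m')
    (leib : ∀ Z (j : Jet I X) m, nab Z (j • m) = act₂ Z j • m + j • nab Z m)
    (hvec : ∀ Z W m, nab (Z + W) m = nab Z m + nab W m)
    (hsmul : ∀ f Z m, nab (smulVF f Z) m = pr₂ (toFn f) • nab Z m) :
    IsConnection (inducedConnection nab) where
  map_add Z s t := by rw [inducedConnection, jetProlong_add, hadd, map_add]; rfl
  leibniz Z f s := by
    rw [inducedConnection, jetProlong_smul, leib, map_add, value_smul, value_smul, act₂_pr₂]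
    rfl
  add_vector Z W s := by rw [inducedConnection, hvec, map_add]; rfl
  smul_vector f Z s := by rw [inducedConnection, hsmul, value_smul]; rfl

namespace IsSplittingConnection

theorem isDer (h : IsSplittingConnection σ nab) (Z : VF I X) : IsDer (act₂ Z) (nab Z) :=
  ⟨h.map_add Z, h.leibniz Z⟩

theorem apply_self (h : IsSplittingConnection σ nab) (Z : VF I X) (s : Sec I F E) :
    nab Z (σ s) = 0 := by
  have h1 := h.apply_splitting Z 1 s
  have h2 := h.leibniz Z 1 (σ s)
  rw [h1, left_eq_add, one_smul] at h2
  exact h2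

theorem isConnection [T2Space X] (h : IsSplittingConnection σ nab) :
    IsConnection (inducedConnection nab) :=
  isConnection_induced h.map_add h.leibniz h.add_vector h.smul_vector

theorem isConn (h : IsSplittingConnection σ nab) :
    IsConn relJet br₂ (fun v => act₂ v.2) (fun v => nab v.2) :=
  isConn_jet₂ h.isDer h.add_vector h.smul_vector

end IsSplittingConnection

variable [T2Space X] [FiniteDimensional ℂ F]

/-- For each vector field the operator is the derivation that kills all `σ s`. Linearity in the
vector field and uniqueness both follow since derivations with the same symbol that kill all `σ s`
coincide. -/
theorem IsSplitting.existsUnique_connection [SigmaCompactSpace X] (hσ : IsSplitting σ) :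
    ∃! nab, IsSplittingConnection σ nab := by
  choose nab hnab hnab0 using hσ.exists_der
  refine ⟨nab, ⟨fun Z => (hnab Z).map_add, fun Z => (hnab Z).leibniz, fun Z W => ?_,
    fun f Z => ?_, fun Z j s => ?_⟩, fun nab' h => ?_⟩
  · exact hσ.isDer_ext (hnab _) (((hnab Z).add (hnab W)).congr fun a =>
      (act₂_add_left Z W a).symm) fun s => by simp only [hnab0, add_zero]
  · exact hσ.isDer_ext (hnab _) (((hnab Z).smul (pr₂ (toFn f))).congr fun a =>
      (act₂_smulVF f Z a).symm) fun s => by simp only [hnab0, smul_zero]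
  · rw [(hnab Z).leibniz, hnab0, smul_zero, add_zero]
  · funext Z m
    exact hσ.isDer_ext (h.isDer Z) (hnab Z) (fun s => by rw [h.apply_self, hnab0]) m

/-- Both sides are derivations with symbol the action of `[Y, Z]`, and both kill every `σ s`. -/
theorem IsSplittingConnection.flat (hσ : IsSplitting σ) (h : IsSplittingConnection σ nab)
    (Y Z : VF I X) (m : JetE I F E) :
    nab Y (nab Z m) - nab Z (nab Y m) = nab (bracket Y Z) m :=
  hσ.isDer_ext (((h.isDer Y).comm (h.isDer Z)).congr fun a => act₂_bracket Y Z a)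
    (h.isDer _) (fun s => by
      simp only [h.apply_self, (h.isDer _).map_zero, sub_zero]) m

variable (I F E) in
theorem isConn_actE₁ : IsConn (N := JetE I F E) relJet br₁ (fun v => act₁ v.1)
    (fun v => actE₁ v.1) :=
  isConn_jet₁ isDer_actE₁ actE₁_add_left actE₁_smulVF

variable (I F E) in
theorem diff_actE₁_sq : (isConn_actE₁ I F E).diff * (isConn_actE₁ I F E).diff = 0 :=
  (isConn_actE₁ I F E).diff_sq_eq_zero br₁_jacobi fun v w m => actE₁_bracket v.1 w.1 m

theorem IsSplittingConnection.diff_sq (hσ : IsSplitting σ) (h : IsSplittingConnection σ nab) :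
    h.isConn.diff * h.isConn.diff = 0 :=
  h.isConn.diff_sq_eq_zero br₂_jacobi fun v w m => h.flat hσ v.2 w.2 m

theorem act_total_bracket (v w : VF I X × VF I X) (a : Jet I X) :
    ((fun v => act₁ v.1) + fun v => act₂ v.2 : VF I X × VF I X → Jet I X → Jet I X) v
        (((fun v => act₁ v.1) + fun v => act₂ v.2 : VF I X × VF I X → Jet I X → Jet I X) w a) -
      ((fun v => act₁ v.1) + fun v => act₂ v.2 : VF I X × VF I X → Jet I X → Jet I X) w
        (((fun v => act₁ v.1) + fun v => act₂ v.2 : VF I X × VF I X → Jet I X → Jet I X) v a) =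
      ((fun v => act₁ v.1) + fun v => act₂ v.2 : VF I X × VF I X → Jet I X → Jet I X)
        (br₁ v w + br₂ v w) a := by
  rw [br_add_eq]
  exact act_add_bracket v w a

section Total
variable {Δ : VF I X → JetE I F E → JetE I F E}
  (h : IsConn relJet br₂ (fun v => act₂ v.2) (fun v => Δ v.2))
include h

/-- The total connection `d + Δ` along pairs of vector fields. It is used with `Δ = ∇_σ` and with
`Δ` the prolongation of a connection on `E`, so flatness of `Δ` is not assumed. -/
theorem isConn_total : IsConn relJet (br₁ + br₂)
    ((fun v => act₁ v.1) + fun v => act₂ v.2) ((fun v => actE₁ v.1) + fun v => Δ v.2) :=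
  (isConn_actE₁ I F E).plus h

theorem tens_curvature_jet :
    Tens 2 ((isConn_total h).diff * (isConn_total h).diff) :=
  (isConn_total h).tens_curvature br_add_jacobi act_total_bracket

end Total

/-- Both squares vanish, so only the mixed terms of `(d + ∇_σ)²` survive. -/
theorem IsSplittingConnection.curvature_eq (hσ : IsSplitting σ)
    (h : IsSplittingConnection σ nab) :
    (isConn_total h.isConn).diff * (isConn_total h.isConn).diff =
      h.isConn.diff * (isConn_actE₁ I F E).diff + (isConn_actE₁ I F E).diff * h.isConn.diff := by
  have h1 : (isConn_total h.isConn).diff = (isConn_actE₁ I F E).diff + h.isConn.diff :=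
    (isConn_actE₁ I F E).diff_plus h.isConn
  rw [h1, add_mul, mul_add, mul_add, diff_actE₁_sq, h.diff_sq hσ]
  abel

theorem atiyah_eq (hσ : IsSplitting σ) (h : IsSplittingConnection σ nab)
    (θ : forms relJet (JetE I F E)) {n : ℕ} :
    atiyah nab (fun u : Fin n → VF I X × VF I X => θ.1 (List.ofFn u)) = fun v =>
      (((isConn_total h.isConn).diff * (isConn_total h.isConn).diff) θ).1 (List.ofFn v) := by
  rw [h.curvature_eq hσ]
  unfold atiyah covDeriv dBaseE
  rw [ceDiff_form (isConn_actE₁ I F E) θ, ceDiff_form h.isConn θ, ceDiff_form h.isConn,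
    ceDiff_form (isConn_actE₁ I F E)]
  rfl

theorem atiyahPow_eq (hσ : IsSplitting σ) (h : IsSplittingConnection σ nab) (k : ℕ)
    (m : JetE I F E) : atiyahPow nab k m = fun v =>
      (((((isConn_total h.isConn).diff * (isConn_total h.isConn).diff)) ^ k) (single m)).1
        (List.ofFn v) := by
  induction k with
  | zero => rfl
  | succ k ih =>
    rw [pow_succ', atiyahPow, ih]
    exact atiyah_eq hσ h _

theorem chernJet_eq (hσ : IsSplitting σ) (h : IsSplittingConnection σ nab) (k : ℕ) :
    chernJet nab k = fun v => ((pr₁ (constFn (chernConst k)) : Jet I X) •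
      trForm (((isConn_total h.isConn).diff * (isConn_total h.isConn).diff) ^ k) :
      List (VF I X × VF I X) → Jet I X) (List.ofFn v) := by
  funext v
  simp only [chernJet, atiyahPow_eq hσ h]
  rfl

/-- On values, the sum of the two connections is the induced connection. -/
theorem value_actE₁_add (h : ∀ Z, IsDer (act₂ Z) (nab Z)) (hD : IsConnection (inducedConnection nab))
    (Z : VF I X) (m : JetE I F E) :
    value (actE₁ Z m + nab Z m) = inducedConnection nab Z (value m) := by
  obtain ⟨χ, hχ, ⟨B⟩⟩ := exists_frames I F E
  let T : JetE I F E →+ Sec I F E := AddMonoidHom.mk'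
    (fun m => value (actE₁ Z m + nab Z m) - inducedConnection nab Z (value m)) fun m m' => by
      simp only [map_add, (isDer_actE₁ Z).map_add, (h Z).map_add, hD.map_add]
      abel
  -- The difference of the two sides is linear over restriction to the diagonal, because the symbols
  -- agree there by `jetValue_act`. It kills prolongations, which generate locally, and so it
  -- vanishes.
  have hT : ∀ (a : Jet I X) m, T (a • m) = jetValue a • T m := by
    intro a m
    change value (actE₁ Z (a • m) + nab Z (a • m)) - inducedConnection nab Z (value (a • m)) =
      jetValue a • (value (actE₁ Z m + nab Z m) - inducedConnection nab Z (value m))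
    rw [(isDer_actE₁ Z).leibniz, (h Z).leibniz, value_smul, hD.leibniz, ← jetValue_act]
    simp only [map_add, value_smul]
    module
  have hj : ∀ s, T (jetProlong s) = 0 := by
    intro s
    change value (actE₁ Z (jetProlong s) + nab Z (jetProlong s)) - _ = 0
    rw [actE₁_jetProlong, zero_add, value_jetProlong]
    exact sub_self _
  refine sub_eq_zero.1 (?_ : T m = 0)
  have h1 : ∀ x, χ x • T m = 0 := by
    intro x
    have h2 := congrArg T ((B x).jetBasis.expand m)
    rw [hT, map_sum] at h2
    refine h2.trans (Finset.sum_eq_zero fun i _ => ?_)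
    rw [hT]
    exact (congrArg _ (hj _)).trans (smul_zero _)
  ext x
  have h3 : χ x x • T m x = 0 := DFunLike.congr_fun (h1 x) x
  rwa [hχ, one_smul] at h3

/-- Both traces are computed in a frame and its prolongation, where the coordinates of `j s` are the
prolonged coordinates of `s`. -/
theorem trace_prolong [SigmaCompactSpace X] (φ : JetE I F E →ₗ[Jet I X] JetE I F E)
    (φ' : Sec I F E →ₗ[Fn I X] Sec I F E) (h : ∀ s, φ (jetProlong s) = jetProlong (φ' s)) :
    (trace φ : Jet I X) = pr₂ (trace φ' : Fn I X) := by
  obtain ⟨χ, hχ, ⟨B⟩⟩ := exists_frames I F E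
  refine sub_eq_zero.1 (jet_eq_zero_of_mul (χ := fun x => pr₂ (χ x)) hχ _ fun x => ?_)
  have h1 := (hasTrace_jetE I F E).isTrace φ _ _ _ _ (B x).jetBasis.expand
  have h2 := (hasTrace_sec I F E).isTrace φ' _ _ _ _ (B x).secBasis.expand
  rw [mul_sub, h1, ← map_mul, h2, map_sum, sub_eq_zero]
  refine Finset.sum_congr rfl fun i _ => ?_
  exact congrArg (jetCovec ((B x).ksecCovec i)) (h ((B x).vec i))

theorem jetValue_trace [SigmaCompactSpace X] (φ : JetE I F E →ₗ[Jet I X] JetE I F E)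
    (φ' : Sec I F E →ₗ[Fn I X] Sec I F E) (h : ∀ m, value (φ m) = φ' (value m)) :
    jetValue (trace φ : Jet I X) = (trace φ' : Fn I X) := by
  obtain ⟨χ, hχ, ⟨B⟩⟩ := exists_frames I F E
  refine sub_eq_zero.1 (fn_eq_zero_of_mul hχ _ fun x => ?_)
  have h1 := (hasTrace_jetE I F E).isTrace φ _ _ _ _ (B x).jetBasis.expand
  have h2 := (hasTrace_sec I F E).isTrace φ' _ _ _ _ (B x).secBasis.expand
  have h3 := congrArg jetValue h1
  rw [map_mul, jetValue_pr₂, map_sum] at h3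
  rw [mul_sub, h2, h3, sub_eq_zero]
  refine Finset.sum_congr rfl fun i _ => ?_
  exact ((B x).jetValue_jetCovec i _).trans (congrArg ((B x).secCovec i) (h (jetProlong ((B x).vec i))))

end Connections

/-! ### Chern forms: closedness and comparison of classes. -/

section ChernForms
variable {EM HM : Type*} [NormedAddCommGroup EM] [NormedSpace ℝ EM] [FiniteDimensional ℝ EM]
  [TopologicalSpace HM] {I : ModelWithCorners ℝ EM HM} {X : Type*} [TopologicalSpace X]
  [ChartedSpace HM X] [IsManifold I ∞ X]
  {F : Type*} [NormedAddCommGroup F] [NormedSpace ℂ F]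
  {E : X → Type*} [TopologicalSpace (TotalSpace F E)] [∀ x, TopologicalSpace (E x)]
  [∀ x, AddCommGroup (E x)] [∀ x, Module ℂ (E x)] [FiberBundle F E]
  [VectorBundle ℂ F E] [VectorBundle ℝ F E] [ContMDiffVectorBundle ∞ F E I]
  {σ : Sec I F E → JetE I F E} {nab : VF I X → JetE I F E → JetE I F E}
  {D D' : VF I X → Sec I F E → Sec I F E}
  [T2Space X] [FiniteDimensional ℂ F]

theorem isForm_chernWeil (hD : IsConnection D) (k : ℕ) : IsForm (chernWeil D k) := by
  rw [chernWeil_eq hD]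
  exact (((hasTrace_sec I F E).isAltForm_trForm
    ((tens_curvature_sec hD).pow k)).smul_left _).isForm

theorem extDeriv_chernWeil (hD : IsConnection D) (k : ℕ) : extDeriv (chernWeil D k) = 0 := by
  have hΦ := (tens_curvature_sec hD).pow k
  have hc : hD.isConn.diff * (hD.isConn.diff * hD.isConn.diff) ^ k =
      (hD.isConn.diff * hD.isConn.diff) ^ k * hD.isConn.diff :=
    ((Commute.refl hD.isConn.diff).mul_right (Commute.refl _)).pow_right k
  rw [chernWeil_eq hD]
  funext v
  refine ((((hasTrace_sec I F E).isAltForm_trForm hΦ).smul_left _).ceDiff_ofFn bracket lieDer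
    v).trans ?_
  rw [ceList_const_smul (isConn_lieDer I X) fun Z => lieDer_constFn Z _,
    (hasTrace_sec I F E).ceList_trForm_eq_zero hD.isConn hΦ hc, mul_zero]
  rfl

theorem isExact_chernWeil_sub (hD : IsConnection D) (hD' : IsConnection D') (k : ℕ) :
    IsExact (chernWeil D' k - chernWeil D k) := by
  obtain ⟨η, h1, h2⟩ := (hasTrace_sec I F E).exists_trForm_sub exists_inv_fn hD.isConn hD'.isConn
    (isConn_lieDer I X) bracket_jacobi (fun v w a => (lieDer_bracket v w a).symm) k
  rw [chernWeil_eq hD, chernWeil_eq hD']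
  cases k with
  | zero =>
    rw [pow_zero, pow_zero]
    exact sub_self _
  | succ k =>
    refine ⟨fun v => ((constFn (chernConst (k + 1)) : Fn I X) • η) (List.ofFn v),
      (h1.smul_left _).isForm, funext fun v => ?_⟩
    refine Eq.trans ?_ ((h1.smul_left _).ceDiff_ofFn bracket lieDer v).symm
    rw [ceList_const_smul (isConn_lieDer I X) fun Z => lieDer_constFn Z _, ← h2, mul_sub]
    rfl

theorem isJetForm_chernJet [SigmaCompactSpace X] (hσ : IsSplitting σ)
    (h : IsSplittingConnection σ nab) (k : ℕ) : IsJetForm (chernJet nab k) := by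
  rw [chernJet_eq hσ h]
  exact (((hasTrace_jetE I F E).isAltForm_trForm
    ((tens_curvature_jet h.isConn).pow k)).smul_left _).isJetForm

theorem act₁_const (Z : VF I X) (c : ℂ) : act₁ Z (pr₁ (constFn c) : Jet I X) = 0 := by
  rw [pr₁_constFn, act₁_pr₂]

theorem act₂_const (Z : VF I X) (c : ℂ) : act₂ Z (pr₁ (constFn c) : Jet I X) = 0 := act₂_pr₁ Z _

/-- Since `d² = 0`, both `d α` and `α d` equal `d ∇_σ d`. Thus `α` commutes with `d` alone, and the
Bianchi identity holds for `d` and not only for the total differential. -/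
theorem dBase_chernJet [SigmaCompactSpace X] (hσ : IsSplitting σ)
    (h : IsSplittingConnection σ nab) (k : ℕ) : dBase (chernJet nab k) = 0 := by
  have hΦ := (tens_curvature_jet h.isConn).pow k
  have hc : Commute (isConn_actE₁ I F E).diff
      (((isConn_total h.isConn).diff * (isConn_total h.isConn).diff) ^ k) := by
    refine Commute.pow_right ?_ k
    rw [h.curvature_eq hσ, Commute, SemiconjBy, mul_add, add_mul, ← mul_assoc, ← mul_assoc,
      diff_actE₁_sq, mul_assoc, mul_assoc, diff_actE₁_sq]
    noncomm_ring
  rw [chernJet_eq hσ h]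
  funext v
  refine ((((hasTrace_jetE I F E).isAltForm_trForm hΦ).smul_left _).ceDiff_ofFn br₁
    (fun v => act₁ v.1) v).trans ?_
  rw [ceList_const_smul (isConn_act₁ I X) fun Z => act₁_const _ _,
    (hasTrace_jetE I F E).ceList_trForm_eq_zero (isConn_actE₁ I F E) hΦ hc, mul_zero]
  rfl

/-- Here flatness of `∇_σ` takes the role of `d² = 0`: both products of `α` with `∇_σ` equal `∇_σ d
∇_σ`. -/
theorem dJet_chernJet [SigmaCompactSpace X] (hσ : IsSplitting σ)
    (h : IsSplittingConnection σ nab) (k : ℕ) : dJet (chernJet nab k) = 0 := by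
  have hΦ := (tens_curvature_jet h.isConn).pow k
  have hc : Commute h.isConn.diff
      (((isConn_total h.isConn).diff * (isConn_total h.isConn).diff) ^ k) := by
    refine Commute.pow_right ?_ k
    rw [h.curvature_eq hσ, Commute, SemiconjBy, mul_add, add_mul, ← mul_assoc, ← mul_assoc,
      h.diff_sq hσ, mul_assoc, mul_assoc, h.diff_sq hσ]
    noncomm_ring
  rw [chernJet_eq hσ h]
  funext v
  refine ((((hasTrace_jetE I F E).isAltForm_trForm hΦ).smul_left _).ceDiff_ofFn br₂
    (fun v => act₂ v.2) v).trans ?_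
  rw [ceList_const_smul (isConn_act₂ I X) fun Z => act₂_const _ _,
    (hasTrace_jetE I F E).ceList_trForm_eq_zero h.isConn hΦ hc, mul_zero]
  rfl

/-- Naturality of curvature along `Z ↦ (Z, Z)`, which respects brackets, and `q`, which intertwines
the total connection with the induced one. -/
theorem value_curvature_pow (h : IsSplittingConnection σ nab) (k : ℕ) (m : JetE I F E)
    (w : List (VF I X)) :
    value (((((isConn_total h.isConn).diff * (isConn_total h.isConn).diff) ^ k)
      (single m)).1 (w.map fun Z => (Z, Z))) =
      (((h.isConnection.isConn.diff * h.isConnection.isConn.diff) ^ k)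
        (single (value m))).1 w :=
  (curvature_pow_comp h.isConnection.isConn (isConn_total h.isConn) (fun Z => (Z, Z)) value
    (fun x y => (br_add_eq (x, x) (y, y)).symm)
    (fun x m => value_actE₁_add h.isDer h.isConnection x m) k m w).symm

theorem value_atiyah (hσ : IsSplitting σ) (h : IsSplittingConnection σ nab) (m : JetE I F E)
    (Y Z : VF I X) : value (atiyah nab (n := 0) (fun _ => m) ![(Y, Y), (Z, Z)]) =
      curvature (inducedConnection nab) Y Z (value m) := by
  have h1 := congrFun (atiyah_eq hσ h (single m) (n := 0)) ![(Y, Y), (Z, Z)]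
  have h2 := value_curvature_pow h 1 m [Y, Z]
  rw [pow_one, pow_one] at h2
  refine (congrArg value h1).trans (h2.trans ?_)
  change ceList _ _ _ (h.isConnection.isConn.diff (single (value m))).1 = _
  simp only [ceList, lieList, slotSum, IsConn.diff_apply, single_nil, curvature, add_zero,
    sub_zero]
  abel

/-- An equality of forms, not merely of classes: traces restrict to the diagonal, and there the
curvature is that of the induced connection. -/
theorem valueForm_chernJet [SigmaCompactSpace X] (hσ : IsSplitting σ)
    (h : IsSplittingConnection σ nab) (k : ℕ) :
    valueForm (chernJet nab k) = chernWeil (inducedConnection nab) k := by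
  rw [chernJet_eq hσ h, chernWeil_eq h.isConnection]
  funext v
  have h1 : (List.ofFn fun i => (v i, v i)) = (List.ofFn v).map fun Z => (Z, Z) := by
    rw [List.map_ofFn]
    rfl
  have h2 := jetValue_trace (((tens_curvature_jet h.isConn).pow k).toEnd
    (List.ofFn fun i => (v i, v i))) (((tens_curvature_sec h.isConnection).pow k).toEnd
    (List.ofFn v)) fun m => by
      rw [h1]
      exact value_curvature_pow h k m (List.ofFn v)
  exact (map_mul jetValue _ _).trans (congrArg (_ * ·) h2)

/-- The prolongation of a connection to the jets. -/
theorem IsConnection.exists_prolong [SigmaCompactSpace X] (hD : IsConnection D) :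
    ∃ Δ : VF I X → JetE I F E → JetE I F E,
      IsConn relJet br₂ (fun v => act₂ v.2) (fun v => Δ v.2) ∧
      ∀ Z s, Δ Z (jetProlong s) = jetProlong (D Z s) := by
  choose Δ hΔ hΔj using fun Z => exists_prolong_der (hD.isDer Z)
  refine ⟨Δ, isConn_jet₂ hΔ (fun Z W => ?_) (fun f Z => ?_), hΔj⟩
  · exact isDer_ext_jetProlong (hΔ _) (((hΔ Z).add (hΔ W)).congr fun a =>
      (act₂_add_left Z W a).symm) fun s => by
        simp only [hΔj, hD.add_vector, jetProlong_add]
  · exact isDer_ext_jetProlong (hΔ _) (((hΔ Z).smul (pr₂ (toFn f))).congr fun a =>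
      (act₂_smulVF f Z a).symm) fun s => by
        simp only [hΔj, hD.smul_vector, jetProlong_smul]

/-- As `d` kills prolongations and `Δ` prolongs `D`, the map `j` intertwines `D` with the total
connection along `(Y, Z) ↦ Z`. Hence the Chern form of `d + Δ` is the jet prolongation of that of
`D`. -/
theorem trForm_prolong [SigmaCompactSpace X] (hD : IsConnection D)
    {Δ : VF I X → JetE I F E → JetE I F E}
    (h : IsConn relJet br₂ (fun v => act₂ v.2) (fun v => Δ v.2))
    (hj : ∀ Z s, Δ Z (jetProlong s) = jetProlong (D Z s)) (k : ℕ) (w : List (VF I X × VF I X)) :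
    (trForm (((isConn_total h).diff * (isConn_total h).diff) ^ k) w : Jet I X) =
      pr₂ (trForm ((hD.isConn.diff * hD.isConn.diff) ^ k) (w.map Prod.snd)) :=
  trace_prolong (((tens_curvature_jet h).pow k).toEnd w)
    (((tens_curvature_sec hD).pow k).toEnd (w.map Prod.snd)) fun s =>
      curvature_pow_comp (isConn_total h) hD.isConn Prod.snd
        (AddMonoidHom.mk' jetProlong jetProlong_add)
        (fun x y => congrArg Prod.snd (br_add_eq x y)) (fun x s => by
          change jetProlong (D x.2 s) = actE₁ x.1 (jetProlong s) + Δ x.2 (jetProlong s)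
          rw [actE₁_jetProlong, hj, zero_add]) k s w

/-- The two Chern forms belong to the total connections `d + Δ` and `d + ∇_σ`, so transgression for
the total differential applies. -/
theorem isJetExact_sub [SigmaCompactSpace X] (hσ : IsSplitting σ)
    (h : IsSplittingConnection σ nab) (hD : IsConnection D) (k : ℕ) :
    IsJetExact (jetForm (chernWeil D k) - chernJet nab k) := by
  obtain ⟨Δ, hΔ, hj⟩ := hD.exists_prolong
  have hS := (isConn_act₁ I X).plus (isConn_act₂ I X)
  obtain ⟨η, h1, h2⟩ := (hasTrace_jetE I F E).exists_trForm_sub exists_inv_jet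
    (isConn_total h.isConn) (isConn_total hΔ) hS br_add_jacobi
    act_total_bracket k
  have h3 : ∀ v : Fin (2 * k) → VF I X × VF I X,
      (jetForm (chernWeil D k) - chernJet nab k) v =
        pr₁ (constFn (chernConst k)) * ceList (br₁ + br₂)
          ((fun v => act₁ v.1) + fun v => act₂ v.2) (List.ofFn v) η := by
    intro v
    rw [← h2, trForm_prolong hD hΔ hj, mul_sub, chernJet_eq hσ h, chernWeil_eq hD, List.map_ofFn]
    exact congrArg (· - _) (map_mul (pr₂ : Fn I X →+* Jet I X) _ _)
  cases k with
  | zero =>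
    funext v
    have h4 := h2 (List.ofFn v)
    -- In degree zero exactness means vanishing; it holds since both powers of the curvature are the
    -- identity.
    rw [pow_zero, pow_zero, sub_self] at h4
    rw [h3, ← h4, mul_zero]
    rfl
  | succ k =>
    refine ⟨fun v => ((pr₁ (constFn (chernConst (k + 1))) : Jet I X) • η) (List.ofFn v),
      (h1.smul_left _).isJetForm, funext fun v => ?_⟩
    rw [h3, ← ceList_const_smul hS, (h1.smul_left _).ceList_add_left]
    · exact (congrArg₂ (· + ·) ((h1.smul_left _).ceDiff_ofFn br₁ (fun v => act₁ v.1) v)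
        ((h1.smul_left _).ceDiff_ofFn br₂ (fun v => act₂ v.2) v)).symm
    · intro x
      change act₁ _ _ + act₂ _ _ = _
      rw [act₁_const, act₂_const, add_zero]

end ChernForms

end
end JetChern

theorem mainTheorem11
    {EM HM : Type*} [NormedAddCommGroup EM] [NormedSpace ℝ EM] [FiniteDimensional ℝ EM]
    [TopologicalSpace HM] (I : ModelWithCorners ℝ EM HM) [I.Boundaryless]
    {X : Type*} [TopologicalSpace X] [ChartedSpace HM X] [IsManifold I ∞ X]
    [T2Space X] [SigmaCompactSpace X]
    (F : Type*) [NormedAddCommGroup F] [NormedSpace ℂ F] [FiniteDimensional ℂ F]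
    (E : X → Type*) [TopologicalSpace (TotalSpace F E)] [∀ x, TopologicalSpace (E x)]
    [∀ x, AddCommGroup (E x)] [∀ x, Module ℂ (E x)] [FiberBundle F E]
    [VectorBundle ℂ F E] [VectorBundle ℝ F E] [ContMDiffVectorBundle ∞ F E I]
    (σ : JetChern.Sec I F E → JetChern.JetE I F E) (hσ : JetChern.IsSplitting σ) :
    -- the splitting defines the connection `∇_σ`
    (∃! nab, JetChern.IsSplittingConnection σ nab) ∧
    ∀ nab, JetChern.IsSplittingConnection σ nab →
      -- it is flat
      (∀ Y Z m, nab Y (nab Z m) - nab Z (nab Y m) = nab (JetChern.bracket Y Z) m) ∧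
      -- it induces a connection on `E`, whose curvature is the constant part of the Atiyah class
      JetChern.IsConnection (JetChern.inducedConnection nab) ∧
      (∀ (m : JetChern.JetE I F E) (Y Z : JetChern.VF I X),
        JetChern.value (JetChern.atiyah nab (n := 0) (fun _ => m) ![(Y, Y), (Z, Z)]) =
          JetChern.curvature (JetChern.inducedConnection nab) Y Z (JetChern.value m)) ∧
      ∀ k : ℕ,
        -- `1 / (k! (-2πi)ᵏ) Tr(α^k)` is a form which is closed under both differentials
        JetChern.IsJetForm (JetChern.chernJet nab k) ∧
        JetChern.dBase (JetChern.chernJet nab k) = 0 ∧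
        JetChern.dJet (JetChern.chernJet nab k) = 0 ∧
        -- and it represents the class of the closed form `chernWeil D k`, that is, `ch_k(E)`
        ∀ D : JetChern.VF I X → JetChern.Sec I F E → JetChern.Sec I F E,
          JetChern.IsConnection D →
          JetChern.IsForm (JetChern.chernWeil D k) ∧
          JetChern.extDeriv (JetChern.chernWeil D k) = 0 ∧
          JetChern.IsJetExact
            (JetChern.jetForm (JetChern.chernWeil D k) - JetChern.chernJet nab k) ∧
          JetChern.IsExact
            (JetChern.chernWeil D k - JetChern.valueForm (JetChern.chernJet nab k)) := by
  refine ⟨hσ.existsUnique_connection, fun nab h => ⟨h.flat hσ, h.isConnection,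
    JetChern.value_atiyah hσ h, fun k => ⟨JetChern.isJetForm_chernJet hσ h k,
    JetChern.dBase_chernJet hσ h k, JetChern.dJet_chernJet hσ h k, fun D hD =>
    ⟨JetChern.isForm_chernWeil hD k, JetChern.extDeriv_chernWeil hD k,
    JetChern.isJetExact_sub hσ h hD k, ?_⟩⟩⟩⟩
  -- The restriction of `ω_k` to the diagonal is the Chern form of the induced connection, so what
  -- remains is the comparison of two connections on `E`.
  rw [JetChern.valueForm_chernJet hσ h]
  exact JetChern.isExact_chernWeil_sub h.isConnection hD k
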